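/- Let $d\ge1$, let $\mathbb T^d=(\mathbb R/\mathbb Z)^d$ and $\mathbb D=\mathbb T^d\times\mathbb R^d$, and for $\beta\in(0,\infty)$ let $M_\beta(v)=(\beta/2\pi)^{d/2}e^{-\beta|v|^2/2}$. For $m\ge0$, let $\operatorname{L}^2_\beta(\mathbb D^{m+1})$ be the complex Hilbert space of functions $G=G(z_0,\ldots,z_m)$, $z_j=(x_j,v_j)\in\mathbb D$, with scalar product $\langle H,G\rangle=\int_{\mathbb D^{m+1}}\overline H\,G\,M_\beta^{\otimes(m+1)}$. For $s\ge0$, let $\|G\|_{H^s_\beta}=\|\langle(\nabla_x,\nabla_v)\rangle^sG\|_{\operatorname{L}^2_\beta}$, where $\langle(\nabla_x,\nabla_v)\rangle^2=1-\Delta_x-(\nabla_v-\beta v)\cdot\nabla_v=1+\nabla_x^*\nabla_x+\nabla_v^*\nabla_v$ is understood as a positive self-adjoint operator on $\operatorname{L}^2_\beta(\mathbb D^{m+1})$, diagonal in the Fourier–Hermite basis; let $H^s_\beta(\mathbb D^{m+1})$ be the space of all $G\in\operatorname{L}^2_\beta(\mathbb D^{m+1})$ for which this norm is finite; and let $\|G\|_{H^{-s}_\beta}=\sup\{|\langle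 H,G\rangle|:\|H\|_{H^s_\beta}\le1\}$ be the dual norm with respect to the scalar product of $\operatorname{L}^2_\beta(\mathbb D^{m+1})$. Given $V\in W^{1,\infty}(\mathbb T^d)$ real-valued and $0\le m\le N$, define on $C^\infty_c(\mathbb D^{m+1})$ the linearized Vlasov operator $L_{m+1}=\sum_{j=0}^mL_{m+1}^{(j)}$ by $$iL_{m+1}^{(j)}G=v_j\cdot\nabla_{x_j}G+\mathbf 1_{j\ne0}\tfrac{N+1-m}N\,\beta v_j\cdot\int_{\mathbb D}\nabla V(x_j-x_*)\,G(z_0,\ldots,z_{j-1},z_*,z_{j+1},\ldots,z_m)\,M_\beta(v_*)\,dz_*,$$ and denote its closure on $\operatorname{L}^2_\beta(\mathbb D^{m+1})$ by the same symbol. **Lemma (weak bounds on linearized Vlasov evolution).** For all $d\ge1$, $\beta\in(0,\infty)$, $m\ge0$, $s\ge0$ and $K\in\mathbb R$ there is a constant $C\in(0,\infty)$ such that the following holds. Let $V\in W^{1,\infty}(\mathbb T^d)$ be real-valued with $\widehat V\ge0$ (all Fourier coefficients real and nonnegative) and with $|V|\le K$ and $|\partial_iV|\le K$ almost everywhere for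 $1\le i\le d$, and let $N\ge m$. Then $iL_{m+1}$ generates a $C_0$-group $\{e^{iL_{m+1}t}\}_{t\in\mathbb R}$ of bounded operators on $\operatorname{L}^2_\beta(\mathbb D^{m+1})$, and for all $t\in\mathbb R$ and $G\in C^\infty_c(\mathbb D^{m+1})$, $$\|e^{iL_{m+1}t}G\|_{H^{-s}_\beta(\mathbb D^{m+1})}\,\le\,C\,\langle t\rangle^s\,\|G\|_{H^{-s}_\beta(\mathbb D^{m+1})},\qquad\langle t\rangle:=(1+t^2)^{1/2}.$$ In particular, $C$ does not depend on $N$, $t$ and $G$, and depends on $V$ only through $K$. -/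

import Mathlib

open MeasureTheory Filter Topology
open scoped ENNReal ContDiff ComplexConjugate

noncomputable section

namespace LinVlasov

/-! ### Phase space and Maxwellian weight -/

/-- One-particle phase space `𝔻 = 𝕋^d × ℝ^d`, with `𝕋 = ℝ/ℤ`. No norm is used on `Fin d → ℝ`:
the Euclidean structure enters below through explicit coordinate sums only. -/
abbrev Phase (d : ℕ) : Type := UnitAddTorus (Fin d) × (Fin d → ℝ)

/-- The phase space `𝔻^(m+1)` of the tagged particle (label `0`) and `m` background particles. -/
abbrev PhaseN (d m : ℕ) : Type := Fin (m + 1) → Phase d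

/-- The Maxwellian `M_β(v) = (β/2π)^(d/2) exp(-β|v|²/2)`. -/
def maxwellian (d : ℕ) (β : ℝ) (v : Fin d → ℝ) : ℝ :=
  (β / (2 * Real.pi)) ^ ((d : ℝ) / 2) * Real.exp (-(β / 2) * ∑ i, v i ^ 2)

/-- The measure `M_β(v) dx dv` on `𝔻`. -/
def phaseMeasure (d : ℕ) (β : ℝ) : Measure (Phase d) :=
  (volume : Measure (UnitAddTorus (Fin d))).prod
    ((volume : Measure (Fin d → ℝ)).withDensity fun v => ENNReal.ofReal (maxwellian d β v))

/-- The measure `M_β^{⊗(m+1)} dx dv` on `𝔻^(m+1)`. -/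
def phaseMeasureN (d m : ℕ) (β : ℝ) : Measure (PhaseN d m) :=
  Measure.pi fun _ => phaseMeasure d β

/-- The complex Hilbert space `L²(𝔻^(m+1), M_β^{⊗(m+1)} dx dv)`. -/
abbrev L2 (d m : ℕ) (β : ℝ) : Type := Lp ℂ 2 (phaseMeasureN d m β)

/-! ### Smooth functions and derivatives on the torus and on phase space -/

/-- The covering map `ℝ^d → 𝕋^d`. -/
def torusCover (d : ℕ) (y : Fin d → ℝ) : UnitAddTorus (Fin d) := fun i => (y i : UnitAddCircle)

/-- `φ ∈ C^∞(𝕋^d)`: the periodic lift of `φ` to `ℝ^d` is smooth. -/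
def IsSmoothTorus {d : ℕ} (φ : UnitAddTorus (Fin d) → ℂ) : Prop :=
  ContDiff ℝ ∞ (fun y : Fin d → ℝ => φ (torusCover d y))

/-- The partial derivative `∂_i φ` on `𝕋^d`. -/
def torusDeriv {d : ℕ} (i : Fin d) (φ : UnitAddTorus (Fin d) → ℂ) (x : UnitAddTorus (Fin d)) : ℂ :=
  deriv (fun h : ℝ => φ (x + Pi.single i (h : UnitAddCircle))) 0

/-- The covering map `(ℝ^d × ℝ^d)^(m+1) → 𝔻^(m+1)`. -/
def phaseCover (d m : ℕ) (y : Fin (m + 1) → (Fin d → ℝ) × (Fin d → ℝ)) : PhaseN d m :=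
  fun j => (torusCover d (y j).1, (y j).2)

/-- `g ∈ C_c^∞(𝔻^(m+1))`: smooth (after lifting to the covering space) with compact support. -/
def IsTestFunction {d m : ℕ} (g : PhaseN d m → ℂ) : Prop :=
  ContDiff ℝ ∞ (fun y => g (phaseCover d m y)) ∧ HasCompactSupport g

/-- The partial derivative of `g` with respect to the `i`-th coordinate of `x_j`. -/
def derivX {d m : ℕ} (j : Fin (m + 1)) (i : Fin d) (g : PhaseN d m → ℂ) (z : PhaseN d m) : ℂ :=
  deriv (fun h : ℝ => g (z + Pi.single j (Pi.single i (h : UnitAddCircle), 0))) 0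

/-! ### The interaction potential -/

/-- `V ∈ W^{1,∞}(𝕋^d)` with weak gradient `gradV`, where `V` and the components of `gradV` are
bounded by `K` almost everywhere. -/
structure IsW1Infty {d : ℕ} (V : UnitAddTorus (Fin d) → ℝ)
    (gradV : UnitAddTorus (Fin d) → Fin d → ℝ) (K : ℝ) : Prop where
  aesm : AEStronglyMeasurable V volume
  aesm_grad : AEStronglyMeasurable gradV volume
  bound : ∀ᵐ x, |V x| ≤ K
  bound_grad : ∀ᵐ x, ∀ i, |gradV x i| ≤ K
  weak_grad : ∀ φ : UnitAddTorus (Fin d) → ℂ, IsSmoothTorus φ → ∀ i,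
    ∫ x, (V x : ℂ) * torusDeriv i φ x = -∫ x, (gradV x i : ℂ) * φ x

/-- The Fourier coefficient `V̂(2πk) = ∫_{𝕋^d} e^{-2πi k·x} V(x) dx`, for `k ∈ ℤ^d`. -/
def fourierCoeffV {d : ℕ} (V : UnitAddTorus (Fin d) → ℝ) (k : Fin d → ℤ) : ℂ :=
  ∫ x, conj (UnitAddTorus.mFourier k x) * (V x : ℂ)

/-- `V̂ ≥ 0`: all Fourier coefficients of `V` are real and nonnegative. -/
def FourierNonneg {d : ℕ} (V : UnitAddTorus (Fin d) → ℝ) : Prop :=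
  ∀ k : Fin d → ℤ, 0 ≤ (fourierCoeffV V k).re ∧ (fourierCoeffV V k).im = 0

/-! ### The linearized Vlasov operator -/

/-- The operator `i L_{m+1}^{(j)}` on test functions:
`v_j·∇_{x_j} g + 1_{j≠0} (N+1-m)/N β v_j · ∫_𝔻 ∇V(x_j - x_*) g(…, z_*, …) M_β(v_*) dz_*`,
where `z_*` stands in the `j`-th slot. -/
def iLj {d m : ℕ} (N : ℕ) (β : ℝ) (gradV : UnitAddTorus (Fin d) → Fin d → ℝ) (j : Fin (m + 1))
    (g : PhaseN d m → ℂ) (z : PhaseN d m) : ℂ :=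
  (∑ i, ((z j).2 i : ℂ) * derivX j i g z) +
    if j = 0 then 0 else
      ((((N : ℝ) + 1 - m) / N * β : ℝ) : ℂ) *
        ∑ i, ((z j).2 i : ℂ) *
          ∫ w, (gradV ((z j).1 - w.1) i : ℂ) * g (Function.update z j w) ∂(phaseMeasure d β)

/-- The operator `i L_{m+1} = ∑_{j=0}^m i L_{m+1}^{(j)}` on test functions. -/
def iL {d m : ℕ} (N : ℕ) (β : ℝ) (gradV : UnitAddTorus (Fin d) → Fin d → ℝ)
    (g : PhaseN d m → ℂ) (z : PhaseN d m) : ℂ :=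
  ∑ j, iLj N β gradV j g z

/-- The graph of the closed operator `i L_{m+1}` on `L²_β(𝔻^(m+1))`: the closure of the graph of
the above operator on `C_c^∞(𝔻^(m+1))`. -/
def iLGraph {d m : ℕ} (N : ℕ) (β : ℝ) (gradV : UnitAddTorus (Fin d) → Fin d → ℝ) :
    Set (L2 d m β × L2 d m β) :=
  closure {p | ∃ g : PhaseN d m → ℂ, IsTestFunction g ∧
    p.1 =ᵐ[phaseMeasureN d m β] g ∧ p.2 =ᵐ[phaseMeasureN d m β] iL N β gradV g}

/-- `U` is a `C_0`-group of bounded operators on `E`, and its infinitesimal generator is the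
operator with graph `A`. -/
structure IsC0GroupGeneratedBy {E : Type*} [NormedAddCommGroup E] [NormedSpace ℂ E]
    (U : ℝ → E →L[ℂ] E) (A : Set (E × E)) : Prop where
  map_zero : U 0 = ContinuousLinearMap.id ℂ E
  map_add : ∀ t t' : ℝ, U (t + t') = (U t).comp (U t')
  strongly_continuous : ∀ x : E, Continuous fun t => U t x
  generator : ∀ x y : E, HasDerivAt (fun t => U t x) y 0 ↔ (x, y) ∈ A

/-! ### Weighted Sobolev norms -/

/-- The normalized Hermite polynomial `He_n(√β v)/√(n!)`; these form an orthonormal basis of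
`L²(ℝ, M_β(v) dv)`, and they are the eigenfunctions of `-(∂_v - βv) ∂_v`, with eigenvalues `βn`. -/
def hermiteFun (β : ℝ) (n : ℕ) (v : ℝ) : ℝ :=
  Polynomial.aeval (Real.sqrt β * v) (Polynomial.hermite n) / Real.sqrt (n.factorial : ℝ)

/-- Indices of the Fourier–Hermite basis of `L²_β(𝔻^(m+1))`. -/
abbrev FHIndex (d m : ℕ) : Type := (Fin (m + 1) → Fin d → ℤ) × (Fin (m + 1) → Fin d → ℕ)

/-- The Fourier–Hermite orthonormal basis of `L²_β(𝔻^(m+1))`. -/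
def fhBasis {d m : ℕ} (β : ℝ) (p : FHIndex d m) (z : PhaseN d m) : ℂ :=
  ∏ j, (UnitAddTorus.mFourier (p.1 j) (z j).1 * ∏ i, (hermiteFun β (p.2 j i) ((z j).2 i) : ℂ))

/-- The eigenvalue of `⟨(∇_x,∇_v)⟩² = 1 - Δ_x - (∇_v - βv)·∇_v = 1 + ∇_x^*∇_x + ∇_v^*∇_v` (adjoints
in `L²_β(𝔻^(m+1))`) at the basis function `fhBasis β p`. -/
def fhWeight {d m : ℕ} (β : ℝ) (p : FHIndex d m) : ℝ :=
  1 + ∑ j, ∑ i, ((2 * Real.pi * (p.1 j i : ℝ)) ^ 2 + β * (p.2 j i : ℝ))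

/-- The coefficient of `G` along `fhBasis β p`. -/
def fhCoeff {d m : ℕ} {β : ℝ} (G : L2 d m β) (p : FHIndex d m) : ℂ :=
  ∫ z, conj (fhBasis β p z) * G z ∂(phaseMeasureN d m β)

/-- The norm `‖G‖_{H^s_β} = ‖⟨(∇_x,∇_v)⟩^s G‖_{L²_β}`, in the spectral resolution of
`⟨(∇_x,∇_v)⟩`; it is finite exactly when `G` belongs to `H^s_β(𝔻^(m+1))`. -/
def sobolevNorm {d m : ℕ} {β : ℝ} (s : ℝ) (G : L2 d m β) : ℝ≥0∞ :=
  (∑' p : FHIndex d m, ENNReal.ofReal (fhWeight β p ^ s) * ‖fhCoeff G p‖ₑ ^ 2) ^ (1 / 2 : ℝ)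

/-- The norm of `H^{-s}_β(𝔻^(m+1))`, the dual of `H^s_β(𝔻^(m+1))` with respect to the scalar
product of `L²_β(𝔻^(m+1))`. -/
def dualSobolevNorm {d m : ℕ} {β : ℝ} (s : ℝ) (G : L2 d m β) : ℝ≥0∞ :=
  ⨆ (H : L2 d m β) (_ : sobolevNorm s H ≤ 1), ‖inner ℂ H G‖ₑ

/-- The bracket `⟨t⟩ = (1 + t²)^{1/2}`. -/
def bracket (t : ℝ) : ℝ := Real.sqrt (1 + t ^ 2)

end LinVlasov

end

open LinVlasov

set_option linter.unusedSectionVars false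
noncomputable section
namespace LinVlasov

/-! In the Fourier–Hermite basis the operator becomes a matrix that fixes every position frequency
`k` and changes one Hermite degree by one. Free transport contributes the entry `iξ√(n+1)/√β` in
both directions along the edge between `n` and `n+e`. The mean-field term maps only the Hermite
ground state of a block (the velocities of one particle) to degree one. On the edges leaving that
ground state it therefore multiplies the upward entry by `1 + a`, where `a` is the coupling strength
times the Fourier coefficient of `V` at `k_j`. Since these coefficients are nonnegative, `0 ≤ a ≤
βK`, and conjugation by the diagonal matrix `symmetrizer`, bounded above and below uniformly in `N`,
turns the matrix into `i` times a real symmetric one (`jacobi_symmetrizer`). The evolution is thus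
similar to a unitary group, which is the case `s = 0`.

For `s > 0`, duality reduces the claim to a bound for the adjoint on `H^s`, and the adjoint is again
similar, through diagonal matrices, to the unitary group at time `-t`. A velocity derivative `D` is
a lowering operator, and `derivOp_mul_trOp` gives `D X = X' D + M`: here `X'` is an operator of the
same kind with one coupling switched off, and `M` is multiplication by `iξ` times a factor at most
`√(1+A)`. By Duhamel's formula a derivative grows by at most a multiple of `|tξ|` times a norm of
lower order. The weight `l²(1+|ξ|²) + β|n|` with `l ≥ max(1,|t|)` absorbs this growth, so that
induction on the order gives constants independent of time (`wsum_expGroup_le`). Returning to `l =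
1`, where the weight is the eigenvalue of `⟨(∇_x,∇_v)⟩²`, costs `⟨t⟩^(2s)` for squared norms.
Non-integer orders follow by quadratic interpolation (`wsum_rpow_le_of_wsum_le`).

The computations are made for bounded truncations of the matrix. The weighted bounds make the
truncated unitary groups a Cauchy sequence and pass to the limit. The generator of the limit is at
once the closure of the matrix on finitely supported vectors and the maximal operator of the matrix
(`exists_transport_group`). The closure of `iL` on test functions lies between these two: velocity
cutoffs put the basis functions into its domain (`exists_mem_iLGraph`), and every pair in its graph
obeys the matrix identity (`coeffMap_of_mem_iLGraph`). Hence all three coincide after the change of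
coordinates. -/

section

/-! ### Weighted square sums -/

/-- The Hilbert space `ℓ²(ι)`. -/
abbrev Ell2 (ι : Type*) : Type _ := lp (fun _ : ι => ℂ) 2

/-- The weighted square sum `∑ W_p |f_p|²`. -/
def wsum {ι : Type*} (W : ι → ℝ) (f : ι → ℂ) : ℝ≥0∞ :=
  ∑' p, ENNReal.ofReal (W p) * ‖f p‖ₑ ^ 2

section WeightedSums

variable {ι : Type*}

lemma enorm_sq_eq_ofReal (z : ℂ) : ‖z‖ₑ ^ 2 = ENNReal.ofReal (‖z‖ ^ 2) := by
  rw [← ofReal_norm, ENNReal.ofReal_pow (norm_nonneg _)]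

lemma enorm_add_sq_le (a b : ℂ) : ‖a + b‖ₑ ^ 2 ≤ 2 * (‖a‖ₑ ^ 2 + ‖b‖ₑ ^ 2) := by
  have h2 : (2 : ℝ≥0∞) = ENNReal.ofReal 2 := by simp
  rw [enorm_sq_eq_ofReal, enorm_sq_eq_ofReal, enorm_sq_eq_ofReal, h2,
    ← ENNReal.ofReal_add (by positivity) (by positivity), ← ENNReal.ofReal_mul (by positivity)]
  apply ENNReal.ofReal_le_ofReal
  have := norm_add_le a b
  nlinarith [sq_nonneg (‖a‖ - ‖b‖), norm_nonneg (a + b), norm_nonneg a, norm_nonneg b]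

lemma wsum_mono_weight {W W' : ι → ℝ} (h : ∀ p, W p ≤ W' p) (f : ι → ℂ) :
    wsum W f ≤ wsum W' f :=
  ENNReal.tsum_le_tsum fun p => by gcongr; exact h p

lemma wsum_mono {W : ι → ℝ} {f g : ι → ℂ} (h : ∀ p, ‖f p‖ ≤ ‖g p‖) : wsum W f ≤ wsum W g :=
  ENNReal.tsum_le_tsum fun p => by
    gcongr; exact enorm_le_iff_norm_le.2 (h p)

lemma wsum_const_mul (W : ι → ℝ) {c : ℝ} (hc : 0 ≤ c) (f : ι → ℂ) :
    wsum (fun p => c * W p) f = ENNReal.ofReal c * wsum W f := by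
  simp only [wsum, ENNReal.ofReal_mul hc, mul_assoc, ENNReal.tsum_mul_left]

lemma wsum_smul (W : ι → ℝ) (c : ℂ) (f : ι → ℂ) :
    wsum W (fun p => c * f p) = ‖c‖ₑ ^ 2 * wsum W f := by
  simp only [wsum, enorm_mul, mul_pow, ← ENNReal.tsum_mul_left]
  congr 1; ext p; ring

lemma wsum_mul_le (W : ι → ℝ) {c : ι → ℂ} {f : ι → ℂ} {M : ℝ}
    (h : ∀ p, W p ≠ 0 → ‖c p‖ ^ 2 ≤ M) :
    wsum W (fun p => c p * f p) ≤ ENNReal.ofReal M * wsum W f := by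
  simp only [wsum, ← ENNReal.tsum_mul_left]
  refine ENNReal.tsum_le_tsum fun p => ?_
  by_cases hp : W p = 0
  · simp [hp]
  rw [enorm_mul, mul_pow, enorm_sq_eq_ofReal (c p), mul_left_comm]
  gcongr
  exact h p hp

lemma wsum_add_le (W : ι → ℝ) (f g : ι → ℂ) :
    wsum W (fun p => f p + g p) ≤ 2 * (wsum W f + wsum W g) := by
  simp only [wsum]
  rw [← ENNReal.tsum_add, ← ENNReal.tsum_mul_left]
  refine ENNReal.tsum_le_tsum fun p => ?_
  calc _ ≤ ENNReal.ofReal (W p) * (2 * (‖f p‖ₑ ^ 2 + ‖g p‖ₑ ^ 2)) := by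
        gcongr; exact enorm_add_sq_le _ _
    _ = _ := by ring

lemma wsum_add_weight {W W' : ι → ℝ} (h : ∀ p, 0 ≤ W p) (h' : ∀ p, 0 ≤ W' p) (f : ι → ℂ) :
    wsum (fun p => W p + W' p) f = wsum W f + wsum W' f := by
  simp only [wsum]
  rw [← ENNReal.tsum_add]
  congr 1; ext p
  rw [ENNReal.ofReal_add (h p) (h' p)]; ring

lemma wsum_one_eq (f : Ell2 ι) : wsum (fun _ => 1) f = ‖f‖ₑ ^ 2 := by
  have hs : Summable fun p => ‖f p‖ ^ 2 := by
    have := (lp.memℓp f).summable (by norm_num)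
    simpa using this
  have h := lp.norm_rpow_eq_tsum (p := 2) (by norm_num) f
  simp only [ENNReal.toReal_ofNat, Real.rpow_ofNat] at h
  rw [← ofReal_norm, ← ENNReal.ofReal_pow (norm_nonneg _), h,
    ENNReal.ofReal_tsum_of_nonneg (fun _ => by positivity) hs]
  refine tsum_congr fun p => ?_
  rw [enorm_sq_eq_ofReal, ENNReal.ofReal_one, one_mul]

lemma memℓp_of_wsum {f : ι → ℂ} (h : wsum (fun _ => 1) f ≠ ⊤) :
    Memℓp (E := fun _ : ι => ℂ) f 2 := by
  apply memℓp_gen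
  simp only [wsum, ENNReal.ofReal_one, one_mul, enorm_sq_eq_ofReal] at h
  have := ENNReal.summable_toReal h
  simpa [ENNReal.toReal_ofReal] using this

/-- Evaluation of finitely many weighted coordinates. -/
def weightedEval (W : ι → ℝ) (F : Finset ι) : Ell2 ι →L[ℂ] EuclideanSpace ℂ F :=
  (EuclideanSpace.equiv F ℂ).symm.toContinuousLinearMap.comp
    (ContinuousLinearMap.pi fun p : F => ((√(W p) : ℝ) : ℂ) • lp.evalCLM ℂ (fun _ : ι => ℂ) 2 (p : ι))

lemma norm_weightedEval_sq {W : ι → ℝ} (hW : ∀ p, 0 ≤ W p) (F : Finset ι) (f : Ell2 ι) :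
    ENNReal.ofReal (‖weightedEval W F f‖ ^ 2) = ∑ p ∈ F, ENNReal.ofReal (W p) * ‖f p‖ₑ ^ 2 := by
  have h : ∀ p : F, weightedEval W F f p = (√(W p) : ℝ) * f p := fun p => rfl
  rw [EuclideanSpace.norm_sq_eq, ENNReal.ofReal_sum_of_nonneg (fun _ _ => by positivity),
    ← Finset.sum_coe_sort F]
  refine Finset.sum_congr rfl fun p _ => ?_
  rw [h, norm_mul, mul_pow, enorm_sq_eq_ofReal, ← ENNReal.ofReal_mul (hW _)]
  simp [Real.sq_sqrt (hW _)]

/-- A possibly infinite weighted sum is thereby controlled through norms of continuous linear maps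
into finite-dimensional spaces. This makes it accessible to the mean value inequality and to limits.
-/
lemma wsum_le_iff {W : ι → ℝ} (hW : ∀ p, 0 ≤ W p) (f : Ell2 ι) (M : ℝ≥0∞) :
    wsum W f ≤ M ↔ ∀ F : Finset ι, ENNReal.ofReal (‖weightedEval W F f‖ ^ 2) ≤ M := by
  simp only [norm_weightedEval_sq hW, wsum]
  rw [ENNReal.tsum_eq_iSup_sum]
  exact iSup_le_iff

/-- The mean value inequality for a weighted square sum. -/
lemma wsum_sub_le_of_hasDerivAt {W : ι → ℝ} (hW : ∀ p, 0 ≤ W p) {z z' : ℝ → Ell2 ι}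
    (hz : ∀ τ, HasDerivAt z (z' τ) τ) (t : ℝ) {M : ℝ≥0∞}
    (h : ∀ τ, |τ| ≤ |t| → wsum W (z' τ) ≤ M) :
    wsum W (z t - z 0 : Ell2 ι) ≤ ENNReal.ofReal (t ^ 2) * M := by
  -- The case `t = 0` is split off because `0 * ⊤ = 0`: an infinite `M` makes the claim empty only
  -- when `t ≠ 0`.
  rcases eq_or_ne t 0 with rfl | ht
  · simp [wsum]
  rcases eq_or_ne M ⊤ with rfl | hM
  · rw [ENNReal.mul_top (by simpa using ht)]; exact le_top
  rw [wsum_le_iff hW]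
  intro F
  have hd : ∀ τ, HasDerivAt (fun τ => weightedEval W F (z τ)) (weightedEval W F (z' τ)) τ :=
    fun τ => ((weightedEval W F).restrictScalars ℝ).hasFDerivAt.comp_hasDerivAt τ (hz τ)
  have hb : ∀ τ ∈ Set.uIcc 0 t, ‖weightedEval W F (z' τ)‖ ≤ √M.toReal := by
    intro τ hτ
    have h1 := (wsum_le_iff hW _ M).1 (h τ (by
      have := Set.abs_sub_left_of_mem_uIcc hτ; simpa using this)) F
    apply Real.le_sqrt_of_sq_le
    rw [← ENNReal.ofReal_le_iff_le_toReal hM]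
    exact h1
  have := (convex_uIcc (0 : ℝ) t).norm_image_sub_le_of_norm_hasDerivWithin_le
    (fun τ _ => (hd τ).hasDerivWithinAt) hb Set.left_mem_uIcc Set.right_mem_uIcc
  rw [← map_sub, sub_zero] at this
  calc ENNReal.ofReal (‖weightedEval W F (z t - z 0)‖ ^ 2)
      ≤ ENNReal.ofReal ((√M.toReal * ‖t‖) ^ 2) := by
        apply ENNReal.ofReal_le_ofReal; gcongr
    _ = _ := by
        rw [mul_pow, Real.sq_sqrt ENNReal.toReal_nonneg, mul_comm, Real.norm_eq_abs, sq_abs,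
          ENNReal.ofReal_mul (sq_nonneg _), ENNReal.ofReal_toReal hM]

/-- Lower semicontinuity of weighted square sums. -/
lemma wsum_le_of_tendsto {W : ι → ℝ} (hW : ∀ p, 0 ≤ W p) {u : ℕ → Ell2 ι} {f : Ell2 ι}
    (hu : Tendsto u atTop (𝓝 f)) {M : ℝ≥0∞} (h : ∀ n, wsum W (u n) ≤ M) : wsum W f ≤ M := by
  rw [wsum_le_iff hW]
  intro F
  refine le_of_tendsto (f := fun n => ENNReal.ofReal (‖weightedEval W F (u n)‖ ^ 2))
    (ENNReal.tendsto_ofReal ((((weightedEval W F).continuous.tendsto f).comp hu).norm.pow 2))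
    (Eventually.of_forall fun n => (wsum_le_iff hW _ M).1 (h n) F)

/-- The truncation of a vector of `ℓ²` to a set of indices. -/
def restrictTo (A : Set ι) (f : Ell2 ι) : Ell2 ι :=
  ⟨A.indicator f, memℓp_of_wsum (ne_top_of_le_ne_top (by rw [wsum_one_eq f]; simp)
    (wsum_mono (g := f) fun p => by
      by_cases hp : p ∈ A <;> simp [hp]))⟩

@[simp] lemma restrictTo_apply (A : Set ι) (f : Ell2 ι) (p : ι) :
    restrictTo A f p = A.indicator f p := rfl

lemma norm_le_of_wsum_le {f g : Ell2 ι} {M : ℝ} (hM : 0 ≤ M)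
    (h : wsum (fun _ => 1) f ≤ ENNReal.ofReal (M ^ 2) * wsum (fun _ => 1) g) :
    ‖f‖ ≤ M * ‖g‖ := by
  rw [wsum_one_eq, wsum_one_eq, ← ofReal_norm, ← ofReal_norm, ← ENNReal.ofReal_pow (norm_nonneg _),
    ← ENNReal.ofReal_pow (norm_nonneg _), ← ENNReal.ofReal_mul (sq_nonneg M),
    ENNReal.ofReal_le_ofReal_iff (by positivity), ← mul_pow] at h
  exact (pow_le_pow_iff_left₀ (norm_nonneg _) (by positivity) two_ne_zero).1 h

/-- The bounded operator on `ℓ²` given by a linear map on sequences that is bounded for the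
`ℓ²` norm. -/
def boundedOp (T : (ι → ℂ) →ₗ[ℂ] (ι → ℂ)) (M : ℝ) (hM : 0 ≤ M)
    (h : ∀ f, wsum (fun _ => 1) (T f) ≤ ENNReal.ofReal (M ^ 2) * wsum (fun _ => 1) f) :
    Ell2 ι →L[ℂ] Ell2 ι :=
  LinearMap.mkContinuous
    { toFun := fun f => ⟨T f, memℓp_of_wsum (ne_top_of_le_ne_top
        (ENNReal.mul_ne_top ENNReal.ofReal_ne_top (by rw [wsum_one_eq f]; simp)) (h f))⟩
      map_add' := fun f g => Subtype.ext (by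
        change T (⇑(f + g)) = T f + T g
        rw [lp.coeFn_add, map_add])
      map_smul' := fun a f => Subtype.ext (by
        change T (⇑(a • f)) = a • T f
        rw [lp.coeFn_smul, map_smul]) }
    M fun f => norm_le_of_wsum_le hM (h f)

/-- Multiplication by a bounded sequence. -/
def multOp (c : ι → ℂ) (M : ℝ) (hM : 0 ≤ M) (hc : ∀ p, ‖c p‖ ≤ M) : Ell2 ι →L[ℂ] Ell2 ι :=
  boundedOp
    { toFun := fun f p => c p * f p
      map_add' := fun f g => by funext p; simp [mul_add]
      map_smul' := fun a f => by funext p; simp; ring }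
    M hM fun f => wsum_mul_le _ fun p _ => pow_le_pow_left₀ (norm_nonneg _) (hc p) 2

lemma multOp_apply (c : ι → ℂ) (M : ℝ) (hM : 0 ≤ M) (hc : ∀ p, ‖c p‖ ≤ M) (f : Ell2 ι) :
    ⇑(multOp c M hM hc f) = fun p => c p * f p := rfl

end WeightedSums

end

section

/-! ### Jacobi operators on `ℓ²(κ × ℕ^J)` -/

section Jacobi

variable {κ J : Type*} [DecidableEq J]

/-- Raise the occupation number in direction `e` by one. -/
def up (e : J) (p : κ × (J → ℕ)) : κ × (J → ℕ) := (p.1, p.2 + Pi.single e 1)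

@[simp] lemma up_fst (e : J) (p : κ × (J → ℕ)) : (up e p).1 = p.1 := rfl

lemma up_snd_self (e : J) (p : κ × (J → ℕ)) : (up e p).2 e = p.2 e + 1 := by simp [up]

lemma up_snd_ne {e e' : J} (h : e' ≠ e) (p : κ × (J → ℕ)) : (up e p).2 e' = p.2 e' := by
  simp [up, h]

lemma sum_up_snd [Fintype J] (e : J) (p : κ × (J → ℕ)) : ∑ e', (up e p).2 e' = ∑ e', p.2 e' + 1 := by
  simp [up, Finset.sum_add_distrib]

lemma up_injective (e : J) : Function.Injective (up e : κ × (J → ℕ) → κ × (J → ℕ)) := by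
  rintro ⟨k, n⟩ ⟨k', n'⟩ h
  simpa [up] using h

lemma up_comm (e e' : J) (p : κ × (J → ℕ)) : up e (up e' p) = up e' (up e p) := by
  simp [up, add_right_comm]

lemma exists_up_eq {e : J} {p : κ × (J → ℕ)} (h : p.2 e ≠ 0) : ∃ r, up e r = p := by
  refine ⟨(p.1, p.2 - Pi.single e 1), Prod.ext rfl ?_⟩
  funext e'
  by_cases h' : e' = e
  · subst h'; simp [up]; omega
  · simp [up, h']

lemma up_ne_of_eq_zero {e : J} {p : κ × (J → ℕ)} (h : p.2 e = 0) (r : κ × (J → ℕ)) :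
    up e r ≠ p := by
  rintro rfl
  simp [up] at h

/-- The weighted lowering operation `f ↦ c_p f_{p+e}`. -/
def lower (e : J) (c : κ × (J → ℕ) → ℝ) (f : κ × (J → ℕ) → ℂ) (p : κ × (J → ℕ)) : ℂ :=
  c p * f (up e p)

/-- The weighted raising operation `f ↦ c_{p-e} f_{p-e}`. -/
def raise (e : J) (c : κ × (J → ℕ) → ℝ) (f : κ × (J → ℕ) → ℂ) : κ × (J → ℕ) → ℂ :=
  Function.extend (up e) (fun q => c q * f q) 0

lemma raise_up (e : J) (c : κ × (J → ℕ) → ℝ) (f : κ × (J → ℕ) → ℂ) (p : κ × (J → ℕ)) :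
    raise e c f (up e p) = c p * f p :=
  (up_injective e).extend_apply _ _ _

lemma raise_of_eq_zero {e : J} {p : κ × (J → ℕ)} (h : p.2 e = 0) (c : κ × (J → ℕ) → ℝ)
    (f : κ × (J → ℕ) → ℂ) : raise e c f p = 0 :=
  Function.extend_apply' _ _ _ fun ⟨r, hr⟩ => up_ne_of_eq_zero h r hr

/-- The symmetric Jacobi matrix with weights `c` on the edges `p — p + e`, multiplied by `i`. -/
def jacobi [Fintype J] (c : J → κ × (J → ℕ) → ℝ) (f : κ × (J → ℕ) → ℂ) (p : κ × (J → ℕ)) : ℂ :=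
  Complex.I * ∑ e, (lower e (c e) f p + raise e (c e) f p)

lemma wsum_lower_le {W W' : κ × (J → ℕ) → ℝ} (e : J) {c : κ × (J → ℕ) → ℝ}
    (h : ∀ p, W p * c p ^ 2 ≤ W' (up e p)) (f : κ × (J → ℕ) → ℂ) :
    wsum W (lower e c f) ≤ wsum W' f := by
  calc wsum W (lower e c f) ≤ ∑' p, ENNReal.ofReal (W' (up e p)) * ‖f (up e p)‖ₑ ^ 2 := by
        refine ENNReal.tsum_le_tsum fun p => ?_
        rw [lower, enorm_mul, mul_pow, ← mul_assoc, enorm_sq_eq_ofReal (c p : ℂ),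
          ← ENNReal.ofReal_mul' (by positivity)]
        gcongr
        simpa using h p
    _ ≤ _ := ENNReal.tsum_comp_le_tsum_of_injective (up_injective e)
        (fun p => ENNReal.ofReal (W' p) * ‖f p‖ₑ ^ 2)

lemma wsum_raise_le {W W' : κ × (J → ℕ) → ℝ} (e : J) {c : κ × (J → ℕ) → ℝ}
    (h : ∀ p, W (up e p) * c p ^ 2 ≤ W' p) (f : κ × (J → ℕ) → ℂ) :
    wsum W (raise e c f) ≤ wsum W' f := by
  have : (fun p => ENNReal.ofReal (W p) * ‖raise e c f p‖ₑ ^ 2) =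
      Function.extend (up e)
        (fun q => ENNReal.ofReal (W (up e q)) * ‖(c q : ℂ) * f q‖ₑ ^ 2) 0 := by
    funext p
    by_cases hp : p.2 e = 0
    · rw [raise_of_eq_zero hp, Function.extend_apply' _ _ _
        (fun ⟨r, hr⟩ => up_ne_of_eq_zero hp r hr)]
      simp
    · obtain ⟨r, rfl⟩ := exists_up_eq hp
      rw [raise_up, (up_injective e).extend_apply]
  rw [wsum, this, tsum_extend_zero (up_injective e)]
  refine ENNReal.tsum_le_tsum fun p => ?_
  rw [enorm_mul, mul_pow, ← mul_assoc, enorm_sq_eq_ofReal (c p : ℂ),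
    ← ENNReal.ofReal_mul' (by positivity)]
  gcongr
  simpa using h p

lemma enorm_sum_add_sq_le {J : Type*} [Fintype J] (a b : J → ℂ) :
    ‖∑ e, (a e + b e)‖ₑ ^ 2 ≤
      2 * (Fintype.card J : ℝ≥0∞) * ∑ e, (‖a e‖ₑ ^ 2 + ‖b e‖ₑ ^ 2) := by
  have h1 : ‖∑ e, (a e + b e)‖ ^ 2 ≤ (Fintype.card J : ℝ) * ∑ e, ‖a e + b e‖ ^ 2 := by
    calc _ ≤ (∑ e, ‖a e + b e‖) ^ 2 := by gcongr; exact norm_sum_le _ _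
      _ ≤ _ := sq_sum_le_card_mul_sum_sq
  calc ‖∑ e, (a e + b e)‖ₑ ^ 2
      ≤ ENNReal.ofReal ((Fintype.card J : ℝ) * ∑ e, ‖a e + b e‖ ^ 2) := by
        rw [enorm_sq_eq_ofReal]; exact ENNReal.ofReal_le_ofReal h1
    _ = (Fintype.card J : ℝ≥0∞) * ∑ e, ‖a e + b e‖ₑ ^ 2 := by
        rw [ENNReal.ofReal_mul (by positivity), ENNReal.ofReal_natCast,
          ENNReal.ofReal_sum_of_nonneg (fun _ _ => by positivity)]
        simp only [enorm_sq_eq_ofReal]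
    _ ≤ (Fintype.card J : ℝ≥0∞) * ∑ e, 2 * (‖a e‖ₑ ^ 2 + ‖b e‖ₑ ^ 2) := by
        gcongr with e; exact enorm_add_sq_le _ _
    _ = _ := by rw [← Finset.mul_sum]; ring

lemma wsum_jacobi_le [Fintype J] {W : κ × (J → ℕ) → ℝ} {c : J → κ × (J → ℕ) → ℝ}
    (h : ∀ e p, c e p ^ 2 ≤ W p) (hW : ∀ e p, W p ≤ W (up e p)) (f : κ × (J → ℕ) → ℂ) :
    wsum (fun _ => 1) (jacobi c f) ≤ (2 * (Fintype.card J : ℝ≥0∞)) ^ 2 * wsum W f := by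
  calc wsum (fun _ => 1) (jacobi c f)
      ≤ ∑' p, 2 * (Fintype.card J : ℝ≥0∞) *
          ∑ e, (‖lower e (c e) f p‖ₑ ^ 2 + ‖raise e (c e) f p‖ₑ ^ 2) := by
        refine ENNReal.tsum_le_tsum fun p => ?_
        rw [jacobi, enorm_mul]
        rw [show ‖Complex.I‖ₑ = 1 by simp [← ofReal_norm], one_mul, ENNReal.ofReal_one, one_mul]
        exact enorm_sum_add_sq_le (fun e => lower e (c e) f p) (fun e => raise e (c e) f p)
    _ = 2 * (Fintype.card J : ℝ≥0∞) *
          ∑ e, (wsum (fun _ => 1) (lower e (c e) f) + wsum (fun _ => 1) (raise e (c e) f)) := by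
        rw [ENNReal.tsum_mul_left, Summable.tsum_finsetSum fun _ _ => ENNReal.summable]
        simp only [wsum, ENNReal.ofReal_one, one_mul, ENNReal.tsum_add]
    _ ≤ 2 * (Fintype.card J : ℝ≥0∞) * ∑ _e : J, (wsum W f + wsum W f) := by
        gcongr with e
        · exact wsum_lower_le e (fun p => by rw [one_mul]; exact (h e p).trans (hW e p)) f
        · exact wsum_raise_le e (fun p => by rw [one_mul]; exact h e p) f
    _ = _ := by
        rw [Finset.sum_const, Finset.card_univ, nsmul_eq_mul]; ring

/-- The bounded weighted lowering operator on `ℓ²`. -/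
def lowerOp (e : J) (c : κ × (J → ℕ) → ℝ) (M : ℝ) (hM : 0 ≤ M) (hc : ∀ p, |c p| ≤ M) :
    Ell2 (κ × (J → ℕ)) →L[ℂ] Ell2 (κ × (J → ℕ)) :=
  boundedOp
    { toFun := lower e c
      map_add' := fun f g => by funext p; simp [lower, mul_add]
      map_smul' := fun a f => by funext p; simp [lower]; ring }
    M hM fun f => by
      rw [← wsum_const_mul _ (sq_nonneg M)]
      refine wsum_lower_le e (fun p => ?_) _
      rw [one_mul, mul_one, ← sq_abs]
      gcongr; exact hc p

lemma lowerOp_apply (e : J) (c : κ × (J → ℕ) → ℝ) (M : ℝ) (hM : 0 ≤ M) (hc : ∀ p, |c p| ≤ M)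
    (f : Ell2 (κ × (J → ℕ))) : ⇑(lowerOp e c M hM hc f) = lower e c f := rfl

/-- Tested on unit vectors: lowering sends the unit vector at `r + e` to `c r` times the one at `r`,
and kills the unit vector at `p` if `p.2 e = 0`. -/
lemma adjoint_lowerOp_apply (e : J) (c : κ × (J → ℕ) → ℝ) (M : ℝ) (hM : 0 ≤ M)
    (hc : ∀ p, |c p| ≤ M) (f : Ell2 (κ × (J → ℕ))) :
    ⇑((lowerOp e c M hM hc).adjoint f) = raise e c f := by
  classical
  funext p
  have h : ∀ g : Ell2 (κ × (J → ℕ)), g p = inner ℂ (lp.single 2 p (1 : ℂ)) g := fun g => by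
    rw [lp.inner_single_left]; simp
  rw [h, ContinuousLinearMap.adjoint_inner_right]
  by_cases hp : p.2 e = 0
  · have : lowerOp e c M hM hc (lp.single 2 p (1 : ℂ)) = 0 := by
      ext q
      rw [lowerOp_apply, lower, lp.single_apply, Pi.single_eq_of_ne (up_ne_of_eq_zero hp q)]
      simp
    rw [this, inner_zero_left, raise_of_eq_zero hp]
  · obtain ⟨r, rfl⟩ := exists_up_eq hp
    have : lowerOp e c M hM hc (lp.single 2 (up e r) (1 : ℂ)) = lp.single 2 r (c r : ℂ) := by
      ext q
      rw [lowerOp_apply, lower, lp.single_apply, lp.single_apply]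
      by_cases hq : q = r
      · subst hq; simp
      · rw [Pi.single_eq_of_ne hq, Pi.single_eq_of_ne fun h => hq (up_injective e h), mul_zero]
    rw [this, lp.inner_single_left, raise_up]
    simp [mul_comm]

variable [Fintype J]

/-- The bounded skew-adjoint Jacobi operator on `ℓ²`. -/
def jacobiOp (c : J → κ × (J → ℕ) → ℝ) (M : ℝ) (hM : 0 ≤ M) (hc : ∀ e p, |c e p| ≤ M) :
    Ell2 (κ × (J → ℕ)) →L[ℂ] Ell2 (κ × (J → ℕ)) :=
  Complex.I • ∑ e, (lowerOp e (c e) M hM (hc e) + (lowerOp e (c e) M hM (hc e)).adjoint)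

lemma jacobiOp_apply (c : J → κ × (J → ℕ) → ℝ) (M : ℝ) (hM : 0 ≤ M) (hc : ∀ e p, |c e p| ≤ M)
    (f : Ell2 (κ × (J → ℕ))) : ⇑(jacobiOp c M hM hc f) = jacobi c f := by
  funext p
  simp only [jacobiOp, jacobi, smul_apply, sum_apply,
    add_apply, lp.coeFn_smul, lp.coeFn_sum, lp.coeFn_add, Pi.smul_apply,
    Finset.sum_apply, Pi.add_apply, smul_eq_mul, lowerOp_apply, adjoint_lowerOp_apply]

lemma jacobiOp_mem_skewAdjoint (c : J → κ × (J → ℕ) → ℝ) (M : ℝ) (hM : 0 ≤ M)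
    (hc : ∀ e p, |c e p| ≤ M) : jacobiOp c M hM hc ∈ skewAdjoint (Ell2 (κ × (J → ℕ)) →L[ℂ] _) := by
  rw [skewAdjoint.mem_iff, jacobiOp, star_smul, star_sum]
  simp only [star_add, ContinuousLinearMap.star_eq_adjoint, ContinuousLinearMap.adjoint_adjoint]
  simp [add_comm]

end Jacobi

end

section

/-! ### Exponentials of bounded skew-adjoint operators -/

section ExpGroup

variable {E : Type*} [NormedAddCommGroup E] [InnerProductSpace ℂ E] [CompleteSpace E]

/-- The uniformly continuous group generated by a bounded operator. -/
def expGroup (X : E →L[ℂ] E) (t : ℝ) : E →L[ℂ] E := NormedSpace.exp (t • X)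

@[simp] lemma expGroup_zero (X : E →L[ℂ] E) : expGroup X 0 = 1 := by simp [expGroup]

lemma expGroup_add (X : E →L[ℂ] E) (s t : ℝ) :
    expGroup X (s + t) = expGroup X s * expGroup X t := by
  let _ : NormedAlgebra ℚ (E →L[ℂ] E) := NormedAlgebra.restrictScalars ℚ ℝ _
  rw [expGroup, add_smul, NormedSpace.exp_add_of_commute]
  · rfl
  · exact ((Commute.refl X).smul_left s).smul_right t

lemma expGroup_add_apply (X : E →L[ℂ] E) (s t : ℝ) (f : E) :
    expGroup X (s + t) f = expGroup X s (expGroup X t f) := by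
  rw [expGroup_add]; rfl

lemma expGroup_neg_apply (X : E →L[ℂ] E) (t : ℝ) (f : E) :
    expGroup X t (expGroup X (-t) f) = f := by
  rw [← expGroup_add_apply]; simp

lemma hasDerivAt_expGroup (X : E →L[ℂ] E) (t : ℝ) :
    HasDerivAt (expGroup X) (expGroup X t * X) t :=
  hasDerivAt_exp_smul_const X t

lemma hasDerivAt_expGroup' (X : E →L[ℂ] E) (t : ℝ) :
    HasDerivAt (expGroup X) (X * expGroup X t) t :=
  hasDerivAt_exp_smul_const' X t

lemma hasDerivAt_expGroup_apply (X : E →L[ℂ] E) (f : E) (t : ℝ) :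
    HasDerivAt (fun t => expGroup X t f) (expGroup X t (X f)) t :=
  ((ContinuousLinearMap.apply ℂ E f).restrictScalars ℝ).hasFDerivAt.comp_hasDerivAt t
    (hasDerivAt_expGroup X t)

lemma expGroup_comm {X Q : E →L[ℂ] E} (h : Commute Q X) (t : ℝ) : Commute Q (expGroup X t) := by
  let _ : NormedAlgebra ℚ (E →L[ℂ] E) := NormedAlgebra.restrictScalars ℚ ℝ _
  exact (h.smul_right t).exp_right

lemma expGroup_apply_comm (X : E →L[ℂ] E) (t : ℝ) (f : E) :
    X (expGroup X t f) = expGroup X t (X f) :=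
  congrArg (fun T : E →L[ℂ] E => T f) (expGroup_comm (Commute.refl X) t).eq

variable {X : E →L[ℂ] E}

lemma expGroup_mem_unitary (hX : X ∈ skewAdjoint (E →L[ℂ] E)) (t : ℝ) :
    expGroup X t ∈ unitary (E →L[ℂ] E) := by
  let _ : NormedAlgebra ℚ (E →L[ℂ] E) := NormedAlgebra.restrictScalars ℚ ℝ _
  exact NormedSpace.exp_mem_unitary_of_mem_skewAdjoint (skewAdjoint.smul_mem t hX)

lemma norm_expGroup_apply (hX : X ∈ skewAdjoint (E →L[ℂ] E)) (t : ℝ) (f : E) :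
    ‖expGroup X t f‖ = ‖f‖ :=
  ContinuousLinearMap.norm_map_of_mem_unitary (expGroup_mem_unitary hX t) f

lemma inner_expGroup_left (hX : X ∈ skewAdjoint (E →L[ℂ] E)) (t : ℝ) (f g : E) :
    inner ℂ (expGroup X t f) g = inner ℂ f (expGroup X (-t) g) := by
  nth_rw 1 [← expGroup_neg_apply X t g]
  exact ContinuousLinearMap.inner_map_map_of_mem_unitary (expGroup_mem_unitary hX t) _ _

/-- Duhamel's formula in differential form, for `D X = X' D + M`. -/
lemma hasDerivAt_intertwine {X X' D M : E →L[ℂ] E} (h : D * X = X' * D + M) (f : E) (τ : ℝ) :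
    HasDerivAt (fun τ => expGroup X' (-τ) (D (expGroup X τ f)))
      (expGroup X' (-τ) (M (expGroup X τ f))) τ := by
  have h1 : HasDerivAt (fun τ => expGroup X' (-τ)) (-(expGroup X' (-τ) * X')) τ := by
    refine ((hasDerivAt_expGroup X' (-τ)).scomp τ (hasDerivAt_neg τ)).congr_deriv ?_
    rw [neg_smul, one_smul]
  have h2 : HasDerivAt (fun τ => D * expGroup X τ) (D * (X * expGroup X τ)) τ :=
    (hasDerivAt_expGroup' X τ).const_mul D
  have h3 := h1.mul h2
  have h4 := ((ContinuousLinearMap.apply ℂ E f).restrictScalars ℝ).hasFDerivAt.comp_hasDerivAt τ h3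
  refine h4.congr_deriv ?_
  have : D * (X * expGroup X τ) = X' * D * expGroup X τ + M * expGroup X τ := by
    rw [← mul_assoc, h, add_mul]
  rw [this]
  simp [mul_add, mul_assoc]

end ExpGroup

end

section

/-! ### Uniform weighted bounds for truncated transport -/

section Truncated

variable {κ J B : Type*} [Fintype J] [DecidableEq J]

open Classical in
/-- The factor `√(1 + a)` on the edges which leave the ground state of a block. -/
def blockFactor (π : J → B) (a : κ → B → ℝ) (e : J) (p : κ × (J → ℕ)) : ℝ :=
  if ∀ e', π e' = π e → p.2 e' = 0 then √(1 + a p.1 (π e)) else 1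

/-- The symmetrized edge weight of the transport operator. -/
def edge (β : ℝ) (ξ : κ → J → ℝ) (π : J → B) (a : κ → B → ℝ) (e : J) (p : κ × (J → ℕ)) : ℝ :=
  ξ p.1 e * √(p.2 e + 1) / √β * blockFactor π a e p

/-- The edge weight truncated to occupation numbers of total size at most `N`. -/
def edgeTr (β : ℝ) (ξ : κ → J → ℝ) (π : J → B) (a : κ → B → ℝ) (N : ℕ) (e : J)
    (p : κ × (J → ℕ)) : ℝ :=
  if ∑ e', p.2 e' + 1 ≤ N then edge β ξ π a e p else 0

lemma blockFactor_sq_le {π : J → B} {a : κ → B → ℝ} {A : ℝ} (ha : ∀ k b, 0 ≤ a k b ∧ a k b ≤ A)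
    (e : J) (p : κ × (J → ℕ)) : blockFactor π a e p ^ 2 ≤ 1 + A := by
  have := ha p.1 (π e)
  rw [blockFactor]
  split_ifs
  · rw [Real.sq_sqrt (by linarith)]; linarith
  · linarith

lemma edge_sq_le {β : ℝ} (hβ : 0 < β) (ξ : κ → J → ℝ) {π : J → B} {a : κ → B → ℝ} {A : ℝ}
    (ha : ∀ k b, 0 ≤ a k b ∧ a k b ≤ A) (e : J) (p : κ × (J → ℕ)) :
    edge β ξ π a e p ^ 2 ≤ ξ p.1 e ^ 2 * (p.2 e + 1) / β * (1 + A) := by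
  rw [edge, mul_pow, div_pow, mul_pow, Real.sq_sqrt (by positivity), Real.sq_sqrt hβ.le]
  gcongr
  exact blockFactor_sq_le ha e p

/-- A uniform bound for the truncated edge weights. -/
def edgeBound (β Ξ A : ℝ) (N : ℕ) : ℝ := √(Ξ ^ 2 * N / β * (1 + A))

lemma abs_edgeTr_le {β : ℝ} (hβ : 0 < β) {ξ : κ → J → ℝ} {Ξ : ℝ} (hξ : ∀ k e, |ξ k e| ≤ Ξ)
    (π : J → B) {a : κ → B → ℝ} {A : ℝ} (ha : ∀ k b, 0 ≤ a k b ∧ a k b ≤ A) (N : ℕ) (e : J)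
    (p : κ × (J → ℕ)) : |edgeTr β ξ π a N e p| ≤ edgeBound β Ξ A N := by
  rw [edgeTr]
  split_ifs with h
  · apply Real.abs_le_sqrt
    refine (edge_sq_le hβ ξ ha e p).trans ?_
    have h1 : 0 ≤ 1 + A := by have := ha p.1 (π e); linarith
    have h2 : (p.2 e : ℝ) + 1 ≤ N := by
      have := Finset.single_le_sum (f := p.2) (fun _ _ => Nat.zero_le _) (Finset.mem_univ e)
      exact_mod_cast (by omega : p.2 e + 1 ≤ N)
    have h3 : ξ p.1 e ^ 2 ≤ Ξ ^ 2 := by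
      rw [← sq_abs]; exact pow_le_pow_left₀ (abs_nonneg _) (hξ _ _) 2
    gcongr
  · rw [abs_zero]; exact Real.sqrt_nonneg _

/-- The truncated symmetrized transport operator. -/
def trOp {β : ℝ} (hβ : 0 < β) {ξ : κ → J → ℝ} {Ξ : ℝ} (hξ : ∀ k e, |ξ k e| ≤ Ξ)
    (π : J → B) {a : κ → B → ℝ} {A : ℝ} (ha : ∀ k b, 0 ≤ a k b ∧ a k b ≤ A) (N : ℕ) :
    Ell2 (κ × (J → ℕ)) →L[ℂ] Ell2 (κ × (J → ℕ)) :=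
  jacobiOp (edgeTr β ξ π a N) (edgeBound β Ξ A N) (Real.sqrt_nonneg _)
    (abs_edgeTr_le hβ hξ π ha N)

variable {β : ℝ} (hβ : 0 < β) {ξ : κ → J → ℝ} {Ξ : ℝ} (hξ : ∀ k e, |ξ k e| ≤ Ξ)
    (π : J → B) {a : κ → B → ℝ} {A : ℝ} (ha : ∀ k b, 0 ≤ a k b ∧ a k b ≤ A) (N : ℕ)

lemma trOp_apply (f : Ell2 (κ × (J → ℕ))) :
    ⇑(trOp hβ hξ π ha N f) = jacobi (edgeTr β ξ π a N) f := jacobiOp_apply _ _ _ _ f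

lemma trOp_mem_skewAdjoint : trOp hβ hξ π ha N ∈ skewAdjoint (Ell2 (κ × (J → ℕ)) →L[ℂ] _) :=
  jacobiOp_mem_skewAdjoint _ _ _ _

/-- An edge is kept only if both of its ends have total degree at most `N`. The alternative `N = 0`
is needed for operators truncated at `N - 1`, where natural subtraction stops at zero. -/
lemma raise_edgeTr_eq_zero {p : κ × (J → ℕ)} (hp : N = 0 ∨ N < ∑ e', p.2 e') (e : J)
    (f : κ × (J → ℕ) → ℂ) : raise e (edgeTr β ξ π a N e) f p = 0 := by
  by_cases h : p.2 e = 0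
  · exact raise_of_eq_zero h _ _
  · obtain ⟨r, rfl⟩ := exists_up_eq h
    rw [raise_up, edgeTr, if_neg (by rw [sum_up_snd] at hp; omega)]
    simp

lemma jacobi_edgeTr_eq_zero {p : κ × (J → ℕ)} (hp : N = 0 ∨ N < ∑ e', p.2 e') (f : κ × (J → ℕ) → ℂ) :
    jacobi (edgeTr β ξ π a N) f p = 0 := by
  rw [jacobi, Finset.sum_eq_zero fun e _ => ?_, mul_zero]
  rw [raise_edgeTr_eq_zero π N hp, lower, edgeTr, if_neg (by omega)]
  simp

/-- No edge of the truncated matrix reaches such an index, so this coordinate has zero time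
derivative. -/
lemma expGroup_trOp_apply_of_lt {p : κ × (J → ℕ)} (hp : N < ∑ e', p.2 e') (t : ℝ)
    (f : Ell2 (κ × (J → ℕ))) : expGroup (trOp hβ hξ π ha N) t f p = f p := by
  have hd : ∀ τ, HasDerivAt (fun τ => expGroup (trOp hβ hξ π ha N) τ f p) 0 τ := fun τ => by
    have h := ((lp.evalCLM ℂ (fun _ : κ × (J → ℕ) => ℂ) 2 p).restrictScalars
      ℝ).hasFDerivAt.comp_hasDerivAt τ (hasDerivAt_expGroup_apply (trOp hβ hξ π ha N) f τ)
    refine h.congr_deriv ?_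
    rw [← expGroup_apply_comm]
    change (trOp hβ hξ π ha N (expGroup (trOp hβ hξ π ha N) τ f)) p = 0
    rw [trOp_apply, jacobi_edgeTr_eq_zero π N (Or.inr hp)]
  have := is_const_of_deriv_eq_zero (fun τ => (hd τ).differentiableAt) (fun τ => (hd τ).deriv) t 0
  simpa using this

/-- The projection to the indices with a given first component. -/
def sliceOp (k : κ) : Ell2 (κ × (J → ℕ)) →L[ℂ] Ell2 (κ × (J → ℕ)) :=
  boundedOp
    { toFun := fun f => {p : κ × (J → ℕ) | p.1 = k}.indicator f
      map_add' := fun f g => Set.indicator_add _ f g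
      map_smul' := fun c f => Set.indicator_const_smul _ c f }
    1 zero_le_one fun f => by
      rw [one_pow, ENNReal.ofReal_one, one_mul]
      exact wsum_mono fun p => norm_indicator_le_norm_self f p

lemma sliceOp_apply (k : κ) (f : Ell2 (κ × (J → ℕ))) :
    ⇑(sliceOp k f) = {p : κ × (J → ℕ) | p.1 = k}.indicator f := rfl

/-- Edges change only the Hermite degrees, so the frequency is conserved. -/
lemma commute_sliceOp_trOp (k : κ) : Commute (sliceOp k) (trOp hβ hξ π ha N) := by
  refine ContinuousLinearMap.ext fun f => lp.ext (funext fun p => ?_)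
  change sliceOp k (trOp hβ hξ π ha N f) p = trOp hβ hξ π ha N (sliceOp k f) p
  rw [sliceOp_apply, trOp_apply, trOp_apply, sliceOp_apply]
  by_cases hp : p.1 = k
  · rw [Set.indicator_of_mem (show p ∈ {p : κ × (J → ℕ) | p.1 = k} from hp), jacobi, jacobi]
    congr 1
    refine Finset.sum_congr rfl fun e _ => ?_
    congr 1
    · rw [lower, lower, Set.indicator_of_mem
        (show up e p ∈ {p : κ × (J → ℕ) | p.1 = k} from hp)]
    · by_cases h : p.2 e = 0
      · rw [raise_of_eq_zero h, raise_of_eq_zero h]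
      · obtain ⟨r, rfl⟩ := exists_up_eq h
        rw [raise_up, raise_up, Set.indicator_of_mem
          (show r ∈ {p : κ × (J → ℕ) | p.1 = k} from hp)]
  · rw [Set.indicator_of_notMem (show p ∉ {p : κ × (J → ℕ) | p.1 = k} from hp), jacobi]
    rw [Finset.sum_eq_zero fun e _ => ?_, mul_zero]
    rw [lower, Set.indicator_of_notMem
      (show up e p ∉ {p : κ × (J → ℕ) | p.1 = k} from hp), mul_zero, zero_add]
    by_cases h : p.2 e = 0
    · rw [raise_of_eq_zero h]
    · obtain ⟨r, rfl⟩ := exists_up_eq h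
      rw [raise_up, Set.indicator_of_notMem
        (show r ∉ {p : κ × (J → ℕ) | p.1 = k} from hp), mul_zero]

open Classical in
/-- The weight `(ρ² + β|n|)^s` on the slice `k`. -/
def sliceWeight (β ρ : ℝ) (k : κ) (s : ℕ) (p : κ × (J → ℕ)) : ℝ :=
  if p.1 = k then (ρ ^ 2 + β * ∑ e, (p.2 e : ℝ)) ^ s else 0

lemma sliceWeight_nonneg {β : ℝ} (hβ : 0 < β) (ρ : ℝ) (k : κ) (s : ℕ) (p : κ × (J → ℕ)) :
    0 ≤ sliceWeight β ρ k s p := by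
  rw [sliceWeight]; split_ifs <;> positivity

lemma sliceWeight_succ (β ρ : ℝ) (k : κ) (s : ℕ) (p : κ × (J → ℕ)) :
    sliceWeight β ρ k (s + 1) p =
      ρ ^ 2 * sliceWeight β ρ k s p + β * (∑ e, (p.2 e : ℝ)) * sliceWeight β ρ k s p := by
  rw [sliceWeight, sliceWeight]; split_ifs <;> ring

lemma cast_sum_up (e : J) (p : κ × (J → ℕ)) :
    ∑ e', ((up e p).2 e' : ℝ) = ∑ e', (p.2 e' : ℝ) + 1 := by
  exact_mod_cast sum_up_snd e p

lemma sliceWeight_le_up {β : ℝ} (hβ : 0 < β) (ρ : ℝ) (k : κ) (s : ℕ) (e : J)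
    (p : κ × (J → ℕ)) : sliceWeight β ρ k s p ≤ sliceWeight β ρ k s (up e p) := by
  rw [sliceWeight, sliceWeight, cast_sum_up, up_fst]
  split_ifs
  · gcongr; linarith
  · rfl

/-- One step up adds `β` to the base of the power, and `ρ ≥ 1` makes this at most `β` times the
base. -/
lemma sliceWeight_up_le {β : ℝ} (hβ : 0 < β) {ρ : ℝ} (hρ : 1 ≤ ρ) (k : κ) (s : ℕ) (e : J)
    (p : κ × (J → ℕ)) :
    sliceWeight β ρ k s (up e p) ≤ (1 + β) ^ s * sliceWeight β ρ k s p := by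
  rw [sliceWeight, sliceWeight, cast_sum_up, up_fst]
  split_ifs
  · rw [← mul_pow]
    gcongr
    have : 0 ≤ ∑ e', (p.2 e' : ℝ) := by positivity
    nlinarith [mul_nonneg hβ.le this, mul_nonneg hβ.le (mul_nonneg hβ.le this),
      mul_nonneg hβ.le (by nlinarith : 0 ≤ ρ ^ 2 - 1)]
  · simp

lemma wsum_sliceWeight_zero (k : κ) (β ρ : ℝ) (f : Ell2 (κ × (J → ℕ))) :
    wsum (sliceWeight β ρ k 0) f = ‖sliceOp k f‖ₑ ^ 2 := by
  rw [← wsum_one_eq, sliceOp_apply]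
  refine tsum_congr fun p => ?_
  by_cases hp : p.1 = k
  · rw [Set.indicator_of_mem (show p ∈ {p : κ × (J → ℕ) | p.1 = k} from hp)]
    simp [sliceWeight, hp]
  · rw [Set.indicator_of_notMem (show p ∉ {p : κ × (J → ℕ) | p.1 = k} from hp)]
    simp [sliceWeight, hp]

/-- The coefficient of the truncated velocity derivative in direction `e`. -/
def derivCoeff (β : ℝ) (N : ℕ) (e : J) (p : κ × (J → ℕ)) : ℝ :=
  if ∑ e', p.2 e' + 1 ≤ N then √(β * (p.2 e + 1)) else 0

lemma derivCoeff_sq {β : ℝ} (hβ : 0 < β) (N : ℕ) (e : J) (p : κ × (J → ℕ)) :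
    derivCoeff β N e p ^ 2 = if ∑ e', p.2 e' + 1 ≤ N then β * (p.2 e + 1) else 0 := by
  rw [derivCoeff]
  split_ifs
  · rw [Real.sq_sqrt (by positivity)]
  · simp

lemma abs_derivCoeff_le {β : ℝ} (hβ : 0 < β) (N : ℕ) (e : J) (p : κ × (J → ℕ)) :
    |derivCoeff β N e p| ≤ √(β * N) := by
  apply Real.abs_le_sqrt
  rw [derivCoeff_sq hβ]
  split_ifs with h
  · have h2 : (p.2 e : ℝ) + 1 ≤ N := by
      have := Finset.single_le_sum (f := p.2) (fun _ _ => Nat.zero_le _) (Finset.mem_univ e)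
      exact_mod_cast (by omega : p.2 e + 1 ≤ N)
    gcongr
  · positivity

/-- The truncated velocity derivative in direction `e`. -/
def derivOp {β : ℝ} (hβ : 0 < β) (N : ℕ) (e : J) :
    Ell2 (κ × (J → ℕ)) →L[ℂ] Ell2 (κ × (J → ℕ)) :=
  lowerOp e (derivCoeff β N e) (√(β * N)) (Real.sqrt_nonneg _) (abs_derivCoeff_le hβ N e)

/-- Below the truncation, `D_e^* D_e` is multiplication by `β n_e`, and these sum to `β|n|`.
Lowering does not increase the slice weight. -/
lemma sum_wsum_derivOp_le (ρ : ℝ) (k : κ) (s : ℕ) (f : Ell2 (κ × (J → ℕ))) :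
    ∑ e, wsum (sliceWeight β ρ k s) (derivOp hβ N e f) ≤
      wsum (fun p => β * (∑ e, (p.2 e : ℝ)) * sliceWeight β ρ k s p) f := by
  calc ∑ e, wsum (sliceWeight β ρ k s) (derivOp hβ N e f)
      ≤ ∑ e, wsum (fun p => β * (p.2 e : ℝ) * sliceWeight β ρ k s p) f := by
        refine Finset.sum_le_sum fun e _ => wsum_lower_le e (fun p => ?_) f
        rw [derivCoeff_sq hβ, up_snd_self, mul_comm]
        have := sliceWeight_le_up hβ ρ k s e p
        have h0 := sliceWeight_nonneg hβ ρ k s p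
        have h1 := sliceWeight_nonneg hβ ρ k s (up e p)
        push_cast
        split_ifs
        · gcongr
        · rw [zero_mul]; positivity
    _ = _ := by
        simp only [wsum]
        rw [← Summable.tsum_finsetSum fun _ _ => ENNReal.summable]
        refine tsum_congr fun p => ?_
        rw [← Finset.sum_mul, ← ENNReal.ofReal_sum_of_nonneg, ← Finset.sum_mul, ← Finset.mul_sum]
        intro e _
        have h0 := sliceWeight_nonneg hβ ρ k s p
        positivity

/-- The converse bound: shifting `D_e f` back up by `e` recovers `√(β n_e) f`. The shift changes the
weight by at most `(1 + β)^s`, and degrees above `N` are invisible because `derivOp` is truncated.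
-/
lemma wsum_number_le {ρ : ℝ} (hρ : 1 ≤ ρ) (k : κ) (s : ℕ) (f : Ell2 (κ × (J → ℕ))) :
    wsum (fun p => if ∑ e, p.2 e ≤ N then β * (∑ e, (p.2 e : ℝ)) * sliceWeight β ρ k s p else 0) f
      ≤ ENNReal.ofReal ((1 + β) ^ s) * ∑ e, wsum (sliceWeight β ρ k s) (derivOp hβ N e f) := by
  calc _ = ∑ e, wsum (sliceWeight β ρ k s) (raise e (fun _ => 1) (derivOp hβ N e f)) := by
        simp only [wsum]
        rw [← Summable.tsum_finsetSum fun _ _ => ENNReal.summable]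
        refine tsum_congr fun p => ?_
        rw [← Finset.mul_sum]
        have hE : ∀ e, ‖raise e (fun _ => 1) (derivOp hβ N e f) p‖ₑ ^ 2 =
            ENNReal.ofReal (if ∑ e, p.2 e ≤ N then β * p.2 e else 0) * ‖f p‖ₑ ^ 2 := by
          intro e
          by_cases h : p.2 e = 0
          · rw [raise_of_eq_zero h]; simp [h]
          · obtain ⟨r, rfl⟩ := exists_up_eq h
            rw [raise_up, sum_up_snd, up_snd_self, derivOp, lowerOp_apply, lower]
            push_cast
            rw [one_mul, enorm_mul, mul_pow, enorm_sq_eq_ofReal (derivCoeff β N e r : ℂ)]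
            simp [derivCoeff_sq hβ]
        have h0 := sliceWeight_nonneg hβ ρ k s p
        simp only [hE]
        rw [← Finset.sum_mul, ← ENNReal.ofReal_sum_of_nonneg, ← mul_assoc,
          ← ENNReal.ofReal_mul h0]
        · congr 2
          split_ifs
          · rw [← Finset.mul_sum]; ring
          · simp
        · intro e _
          split_ifs <;> positivity
    _ ≤ ∑ e, wsum (fun p => (1 + β) ^ s * sliceWeight β ρ k s p) (derivOp hβ N e f) := by
        refine Finset.sum_le_sum fun e _ => wsum_raise_le e (fun p => ?_) _
        rw [one_pow, mul_one]
        exact sliceWeight_up_le hβ hρ k s e p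
    _ = _ := by
        rw [Finset.mul_sum]
        exact Finset.sum_congr rfl fun e _ => wsum_const_mul _ (by positivity) _

end Truncated

end

/-! ### Commutation with velocity derivatives and the induction on the Sobolev order. -/

section

section SliceBound

variable {κ J B : Type*} [Fintype J] [DecidableEq J]

open Classical in
/-- Switch off the coupling in one block. -/
def kill (a : κ → B → ℝ) (b₀ : B) (k : κ) (b : B) : ℝ := if b = b₀ then 0 else a k b

lemma kill_bound {a : κ → B → ℝ} {A : ℝ} (ha : ∀ k b, 0 ≤ a k b ∧ a k b ≤ A) (b₀ : B) :
    ∀ k b, 0 ≤ kill a b₀ k b ∧ kill a b₀ k b ≤ A := fun k b => by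
  have := ha k b
  rw [kill]
  split_ifs
  · exact ⟨le_rfl, this.1.trans this.2⟩
  · exact this

/-- After a step in direction `e'` the block of `e'` is out of its ground state, so its coupling no
longer matters. This is how `kill` enters the commutator. -/
lemma blockFactor_up (π : J → B) (a : κ → B → ℝ) (e e' : J) (p : κ × (J → ℕ)) :
    blockFactor π a e (up e' p) = blockFactor π (kill a (π e')) e p := by
  by_cases h : π e' = π e
  · have h1 : ¬ ∀ e'', π e'' = π e → (up e' p).2 e'' = 0 := fun h' => by
      have := h' e' h
      rw [up_snd_self] at this
      omega
    rw [blockFactor, if_neg h1, blockFactor, kill, if_pos h.symm]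
    simp
  · have h1 : (∀ e'', π e'' = π e → (up e' p).2 e'' = 0) ↔
        ∀ e'', π e'' = π e → p.2 e'' = 0 := by
      refine forall_congr' fun e'' => ?_
      by_cases he : π e'' = π e
      · rw [up_snd_ne (by rintro rfl; exact h he)]
      · simp [he]
    rw [blockFactor, blockFactor]
    by_cases hz : ∀ e'', π e'' = π e → p.2 e'' = 0
    · rw [if_pos (h1.2 hz), if_pos hz, kill, if_neg (fun h' => h h'.symm), up_fst]
    · rw [if_neg (fun h => hz (h1.1 h)), if_neg hz]

lemma blockFactor_up_self (π : J → B) (a : κ → B → ℝ) (e : J) (p : κ × (J → ℕ)) :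
    blockFactor π a e (up e p) = 1 := by
  rw [blockFactor, if_neg]
  intro h
  have := h e rfl
  rw [up_snd_self] at this
  omega

lemma edgeTr_up_of_ne (β : ℝ) (ξ : κ → J → ℝ) (π : J → B) (a : κ → B → ℝ) (N : ℕ) {e e' : J}
    (h : e ≠ e') (p : κ × (J → ℕ)) :
    edgeTr β ξ π a N e (up e' p) = edgeTr β ξ π (kill a (π e')) (N - 1) e p := by
  rw [edgeTr, edgeTr, sum_up_snd, edge, edge, blockFactor_up, up_snd_ne h, up_fst]
  congr 1
  rw [eq_iff_iff]; omega

variable {β : ℝ} (hβ : 0 < β) {ξ : κ → J → ℝ} {Ξ : ℝ} (hξ : ∀ k e, |ξ k e| ≤ Ξ)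
    (π : J → B) {a : κ → B → ℝ} {A : ℝ} (ha : ∀ k b, 0 ≤ a k b ∧ a k b ≤ A) (N : ℕ)

/-- The multiplier in the commutator of transport and velocity derivative. -/
def commCoeff (ξ : κ → J → ℝ) (π : J → B) (a : κ → B → ℝ) (N : ℕ) (e : J)
    (p : κ × (J → ℕ)) : ℂ :=
  if ∑ e', p.2 e' + 1 ≤ N then Complex.I * ((ξ p.1 e * blockFactor π a e p : ℝ) : ℂ) else 0

lemma norm_commCoeff_sq_le {a : κ → B → ℝ} {A : ℝ} (ha : ∀ k b, 0 ≤ a k b ∧ a k b ≤ A)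
    (ξ : κ → J → ℝ) (e : J) (p : κ × (J → ℕ)) :
    ‖commCoeff ξ π a N e p‖ ^ 2 ≤ ξ p.1 e ^ 2 * (1 + A) := by
  have h0 : 0 ≤ 1 + A := by have := ha p.1 (π e); linarith
  rw [commCoeff]
  split_ifs
  · rw [norm_mul, Complex.norm_I, one_mul, Complex.norm_real, Real.norm_eq_abs, sq_abs, mul_pow]
    gcongr
    exact blockFactor_sq_le ha e p
  · rw [norm_zero, zero_pow two_ne_zero]; exact mul_nonneg (sq_nonneg _) h0

lemma norm_commCoeff_le {ξ : κ → J → ℝ} {Ξ : ℝ} (hξ : ∀ k e, |ξ k e| ≤ Ξ) {a : κ → B → ℝ} {A : ℝ}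
    (ha : ∀ k b, 0 ≤ a k b ∧ a k b ≤ A)
    (e : J) (p : κ × (J → ℕ)) : ‖commCoeff ξ π a N e p‖ ≤ √(Ξ ^ 2 * (1 + A)) := by
  apply Real.le_sqrt_of_sq_le
  refine (norm_commCoeff_sq_le π N ha ξ e p).trans ?_
  have h0 : 0 ≤ 1 + A := by have := ha p.1 (π e); linarith
  refine mul_le_mul_of_nonneg_right ?_ h0
  rw [← sq_abs]; exact pow_le_pow_left₀ (abs_nonneg _) (hξ _ _) 2

/-- The analogue of `[∂_v, v·∇_x] = ∇_x`. Seen from the lowered index, every edge starts one degree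
higher: this lowers the truncation level to `N - 1` and removes the coupling in the block of `e`.
Only the edge in direction `e` itself leaves a remainder, and it is diagonal. -/
lemma derivOp_mul_trOp (e : J) :
    derivOp hβ N e * trOp hβ hξ π ha N =
      trOp hβ hξ π (kill_bound ha (π e)) (N - 1) * derivOp hβ N e +
        multOp (commCoeff ξ π a N e) _ (Real.sqrt_nonneg _) (norm_commCoeff_le π N hξ ha e) := by
  refine ContinuousLinearMap.ext fun f => lp.ext (funext fun p => ?_)
  change derivOp hβ N e (trOp hβ hξ π ha N f) p =
    trOp hβ hξ π (kill_bound ha (π e)) (N - 1) (derivOp hβ N e f) p +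
      commCoeff ξ π a N e p * f p
  rw [derivOp, lowerOp_apply, trOp_apply, trOp_apply, lowerOp_apply, commCoeff]
  have hsβ : √β ≠ 0 := (Real.sqrt_pos.2 hβ).ne'
  by_cases hp : ∑ e', p.2 e' + 1 ≤ N
  swap
  · rw [if_neg hp, lower, derivCoeff, if_neg hp, jacobi_edgeTr_eq_zero π (N - 1) (by omega)]
    simp
  rw [if_pos hp]
  rw [lower, jacobi, jacobi]
  have hδ : ∀ q : κ × (J → ℕ), ∑ e', q.2 e' + 1 ≤ N →
      derivCoeff β N e q = √β * √(q.2 e + 1) := fun q hq => by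
    rw [derivCoeff, if_pos hq, Real.sqrt_mul hβ.le]
  -- The identity holds edge by edge. For `e' ≠ e` the entries commute exactly. For `e' = e` the two
  -- raising contributions at `p` are `ξ(n_e + 1)` times the block factor and `ξ n_e`. If `n_e > 0`
  -- the block factor is one and the difference is `ξ`; if `n_e = 0` only the first contribution is
  -- present.
  have key : ∀ e', (derivCoeff β N e p : ℂ) * (lower e' (edgeTr β ξ π a N e') f (up e p) +
      raise e' (edgeTr β ξ π a N e') f (up e p)) =
      lower e' (edgeTr β ξ π (kill a (π e)) (N - 1) e') (lower e (derivCoeff β N e) f) p +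
      raise e' (edgeTr β ξ π (kill a (π e)) (N - 1) e') (lower e (derivCoeff β N e) f) p +
      if e' = e then ((ξ p.1 e * blockFactor π a e p : ℝ) : ℂ) * f p else 0 := by
    intro e'
    by_cases hee : e' = e
    · subst hee
      rw [if_pos rfl, mul_add, add_assoc]
      congr 1
      · rw [lower, lower, lower, ← mul_assoc, ← mul_assoc, ← Complex.ofReal_mul,
          ← Complex.ofReal_mul]
        congr 2
        rw [hδ p hp, edgeTr, edgeTr, sum_up_snd]
        by_cases h2 : ∑ e', p.2 e' + 1 + 1 ≤ N
        · rw [if_pos h2, if_pos (by omega), hδ _ (by rw [sum_up_snd]; exact h2), edge, edge,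
            blockFactor_up, up_snd_self, up_fst]
          push_cast
          ring
        · rw [if_neg h2, if_neg (by omega)]
          simp
      · rw [raise_up, hδ p hp, edgeTr, if_pos hp, edge]
        by_cases h0 : p.2 e' = 0
        · rw [raise_of_eq_zero h0, zero_add, ← mul_assoc, ← Complex.ofReal_mul]
          congr 2
          rw [h0]
          simp
          field_simp
        · obtain ⟨r, rfl⟩ := exists_up_eq h0
          rw [sum_up_snd] at hp
          rw [raise_up, lower, edgeTr, if_pos (by omega), hδ r (by omega), edge,
            ← blockFactor_up, blockFactor_up_self, up_snd_self, up_fst, ← mul_assoc, ← mul_assoc,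
            ← Complex.ofReal_mul, ← Complex.ofReal_mul, ← add_mul, ← Complex.ofReal_add]
          congr 2
          have h1 : √((r.2 e' : ℝ) + 1) * √((r.2 e' : ℝ) + 1) = r.2 e' + 1 :=
            Real.mul_self_sqrt (by positivity)
          have h2 : √(((r.2 e' + 1 : ℕ) : ℝ) + 1) * √(((r.2 e' + 1 : ℕ) : ℝ) + 1) =
              r.2 e' + 1 + 1 := by
            rw [Real.mul_self_sqrt (by positivity)]; push_cast; ring
          field_simp
          linear_combination ξ r.1 e' * h2 - ξ r.1 e' * h1
    · rw [if_neg hee, add_zero, mul_add]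
      congr 1
      · rw [lower, lower, lower, edgeTr_up_of_ne β ξ π a N hee, up_comm]
        by_cases h2 : ∑ e', p.2 e' + 1 + 1 ≤ N
        · rw [hδ p hp, hδ _ (by rw [sum_up_snd]; exact h2), up_snd_ne (Ne.symm hee)]
          ring
        · rw [edgeTr, if_neg (by omega)]
          simp
      · by_cases h0 : p.2 e' = 0
        · rw [raise_of_eq_zero h0, raise_of_eq_zero (by rw [up_snd_ne hee, h0]), mul_zero]
        · obtain ⟨r, rfl⟩ := exists_up_eq h0
          have hp' := hp
          rw [sum_up_snd] at hp'
          rw [up_comm, raise_up, raise_up, edgeTr_up_of_ne β ξ π a N hee, lower, hδ _ hp,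
            hδ r (by omega), up_snd_ne (Ne.symm hee)]
          ring
  rw [mul_left_comm, Finset.mul_sum, Finset.sum_congr rfl fun e' _ => key e',
    Finset.sum_add_distrib, Finset.sum_ite_eq' Finset.univ e, if_pos (Finset.mem_univ _)]
  ring

/-- The base case of the induction: the group is unitary and preserves each frequency slice. -/
lemma wsum_expGroup_zero_weight (k : κ) (ρ t : ℝ) (f : Ell2 (κ × (J → ℕ))) :
    wsum (sliceWeight β ρ k 0) (expGroup (trOp hβ hξ π ha N) t f) =
      wsum (sliceWeight β ρ k 0) f := by
  have h := congrArg (fun T : Ell2 (κ × (J → ℕ)) →L[ℂ] _ => T f)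
    (expGroup_comm (commute_sliceOp_trOp hβ hξ π ha N k) t).eq
  simp only [mul_apply_eq_comp] at h
  rw [wsum_sliceWeight_zero, wsum_sliceWeight_zero, h, ← ofReal_norm, ← ofReal_norm,
    norm_expGroup_apply (trOp_mem_skewAdjoint hβ hξ π ha N)]

lemma wsum_commCoeff_le {k : κ} {ρ : ℝ} {e : J} (s : ℕ) (f : Ell2 (κ × (J → ℕ))) :
    wsum (sliceWeight β ρ k s) (multOp (commCoeff ξ π a N e) _ (Real.sqrt_nonneg _)
      (norm_commCoeff_le π N hξ ha e) f) ≤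
      ENNReal.ofReal (ξ k e ^ 2 * (1 + A)) * wsum (sliceWeight β ρ k s) f := by
  rw [multOp_apply]
  refine wsum_mul_le _ fun p hp => ?_
  have : p.1 = k := by
    by_contra h
    exact hp (by rw [sliceWeight, if_neg h])
  subst this
  exact norm_commCoeff_sq_le π N ha ξ e p

/-- Uniform weighted bounds on a slice for the truncated transport groups. -/
theorem wsum_expGroup_le {β : ℝ} (hβ : 0 < β) (π : J → B) {A : ℝ} (s : ℕ) :
    ∃ C : ℝ≥0∞, C ≠ ⊤ ∧ ∀ (ξ : κ → J → ℝ) (Ξ : ℝ) (hξ : ∀ k e, |ξ k e| ≤ Ξ) (a : κ → B → ℝ)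
      (ha : ∀ k b, 0 ≤ a k b ∧ a k b ≤ A) (N : ℕ) (k : κ) (ρ : ℝ), 1 ≤ ρ → ∀ t : ℝ,
      (∀ e, |t * ξ k e| ≤ ρ) → ∀ f : Ell2 (κ × (J → ℕ)),
      wsum (sliceWeight β ρ k s) (expGroup (trOp hβ hξ π ha N) t f) ≤
        C * wsum (sliceWeight β ρ k s) f := by
  -- The constant must serve all frequencies, couplings and truncation levels at once: the inductive
  -- step applies the bound also to the operator with one coupling killed and level `N - 1`.
  induction s with
  | zero =>
    refine ⟨1, ENNReal.one_ne_top, fun ξ Ξ hξ a ha N k ρ _ t _ f => ?_⟩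
    rw [wsum_expGroup_zero_weight, one_mul]
  | succ s ih =>
    obtain ⟨C, hC, ih⟩ := ih
    set A' : ℝ≥0∞ := ENNReal.ofReal (1 + A)
    set b : ℝ≥0∞ := ENNReal.ofReal ((1 + β) ^ s)
    set c : ℝ≥0∞ := (Fintype.card J : ℝ≥0∞)
    refine ⟨C + (b * (2 * C * (c * (A' * C ^ 2) + 1)) + 1), ?_,
      fun ξ Ξ hξ a ha N k ρ hρ t ht f => ?_⟩
    · have h2 : (2 : ℝ≥0∞) ≠ ⊤ := by simp
      have hb : b ≠ ⊤ := ENNReal.ofReal_ne_top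
      have hA : A' ≠ ⊤ := ENNReal.ofReal_ne_top
      have hc : c ≠ ⊤ := by simp [c]
      finiteness
    set X := trOp hβ hξ π ha N with hX
    set W := sliceWeight (J := J) β ρ k s with hW
    set W₂ : κ × (J → ℕ) → ℝ := fun p => β * (∑ e, (p.2 e : ℝ)) * W p with hW₂
    have hW0 : ∀ p, 0 ≤ W p := sliceWeight_nonneg hβ ρ k s
    have hW₂0 : ∀ p, 0 ≤ W₂ p := fun p => by have := hW0 p; positivity
    -- The weight of order `s + 1` consists of `ρ²` times the weight of order `s`, which the
    -- inductive hypothesis propagates directly, and of the number part `β|n|` times it, which is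
    -- reached through velocity derivatives.
    have hsplit : ∀ g : κ × (J → ℕ) → ℂ, wsum (sliceWeight β ρ k (s + 1)) g =
        ENNReal.ofReal (ρ ^ 2) * wsum W g + wsum W₂ g := fun g => by
      rw [← wsum_const_mul _ (sq_nonneg ρ), ← wsum_add_weight
        (fun p => mul_nonneg (sq_nonneg ρ) (hW0 p)) hW₂0]
      congr 1
      funext p
      exact sliceWeight_succ β ρ k s p
    set F := wsum (sliceWeight β ρ k (s + 1)) f with hF
    have hF1 : ENNReal.ofReal (ρ ^ 2) * wsum W f ≤ F := by rw [hF, hsplit]; exact le_self_add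
    have hF2 : wsum W₂ f ≤ F := by rw [hF, hsplit]; exact le_add_self
    -- the velocity derivatives
    have hD : ∀ e, wsum W (derivOp hβ N e (expGroup X t f)) ≤
        2 * C * (A' * C ^ 2 * F + wsum W (derivOp hβ N e f)) := by
      intro e
      set X' := trOp hβ hξ π (kill_bound ha (π e)) (N - 1) with hX'
      set z : ℝ → Ell2 (κ × (J → ℕ)) :=
        fun τ => expGroup X' (-τ) (derivOp hβ N e (expGroup X τ f)) with hz
      have hz1 := fun τ => hasDerivAt_intertwine (derivOp_mul_trOp hβ hξ π ha N e) f τ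
      have hτ : ∀ τ, |τ| ≤ |t| → ∀ e, |τ * ξ k e| ≤ ρ := fun τ h e => by
        refine le_trans ?_ (ht e)
        rw [abs_mul, abs_mul]
        gcongr
      -- In Duhamel's formula only the multiplier survives under the time derivative. Integration
      -- over a time `|t|` then produces the square factor `t² ξ_e² ≤ ρ²`, which is paid for by the
      -- `ρ²` part of the weight of order `s + 1`.
      have h1 := wsum_sub_le_of_hasDerivAt hW0 hz1 t
        (M := C * (ENNReal.ofReal (ξ k e ^ 2 * (1 + A)) * (C * wsum W f))) (fun τ h => by
          refine (ih ξ Ξ hξ _ (kill_bound ha (π e)) (N - 1) k ρ hρ (-τ)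
            (fun e => by rw [neg_mul, abs_neg]; exact hτ τ h e) _).trans ?_
          gcongr
          refine (wsum_commCoeff_le hξ π ha N s _).trans ?_
          gcongr
          exact ih ξ Ξ hξ a ha N k ρ hρ τ (hτ τ h) f)
      have h2 : ENNReal.ofReal (t ^ 2) *
          (C * (ENNReal.ofReal (ξ k e ^ 2 * (1 + A)) * (C * wsum W f))) ≤ A' * C ^ 2 * F := by
        calc _ = ENNReal.ofReal (t ^ 2 * ξ k e ^ 2) * (A' * C ^ 2 * wsum W f) := by
              rw [ENNReal.ofReal_mul (sq_nonneg _), ENNReal.ofReal_mul (sq_nonneg _)]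
              ring
          _ ≤ ENNReal.ofReal (ρ ^ 2) * (A' * C ^ 2 * wsum W f) := by
              gcongr
              rw [← mul_pow, ← sq_abs]
              exact pow_le_pow_left₀ (abs_nonneg _) (ht e) 2
          _ = A' * C ^ 2 * (ENNReal.ofReal (ρ ^ 2) * wsum W f) := by ring
          _ ≤ _ := by gcongr
      have hz0 : z 0 = derivOp hβ N e f := by simp [hz]
      have h3 : wsum W (z t) ≤ 2 * (A' * C ^ 2 * F + wsum W (derivOp hβ N e f)) := by
        have h4 : (z t : κ × (J → ℕ) → ℂ) = fun p => (z t - z 0 : Ell2 _) p + z 0 p := by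
          funext p; rw [lp.coeFn_sub]; simp
        rw [h4]
        refine (wsum_add_le _ _ _).trans ?_
        rw [← hz0]
        gcongr
        exact h1.trans h2
      have h5 : derivOp hβ N e (expGroup X t f) = expGroup X' t (z t) :=
        (expGroup_neg_apply X' t _).symm
      rw [h5]
      refine (ih ξ Ξ hξ _ (kill_bound ha (π e)) (N - 1) k ρ hρ t ht _).trans ?_
      calc C * wsum W (z t) ≤ C * (2 * (A' * C ^ 2 * F + wsum W (derivOp hβ N e f))) := by gcongr
        _ = _ := by ring
    have hlow : wsum (fun p => if ∑ e, p.2 e ≤ N then W₂ p else 0) (expGroup X t f) ≤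
        b * (2 * C * (c * (A' * C ^ 2) + 1)) * F := by
      refine (wsum_number_le hβ N hρ k s _).trans ?_
      calc b * ∑ e, wsum W (derivOp hβ N e (expGroup X t f))
          ≤ b * ∑ e, 2 * C * (A' * C ^ 2 * F + wsum W (derivOp hβ N e f)) := by
            gcongr with e; exact hD e
        _ = b * (2 * C * (c * (A' * C ^ 2 * F) + ∑ e, wsum W (derivOp hβ N e f))) := by
            rw [← Finset.mul_sum, Finset.sum_add_distrib, Finset.sum_const, Finset.card_univ,
              nsmul_eq_mul]
        _ ≤ b * (2 * C * (c * (A' * C ^ 2 * F) + F)) := by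
            gcongr
            exact (sum_wsum_derivOp_le hβ N ρ k s f).trans hF2
        _ = _ := by ring
    -- Above the truncation level the group acts as the identity, so the part that the truncated
    -- derivatives do not see is unchanged.
    have hhigh : wsum (fun p => if ∑ e, p.2 e ≤ N then 0 else W₂ p) (expGroup X t f) ≤ F := by
      refine le_trans (ENNReal.tsum_le_tsum fun p => ?_) hF2
      dsimp only
      split_ifs with h
      · simp
      · rw [hX, expGroup_trOp_apply_of_lt hβ hξ π ha N (by omega)]
    have hW₂split : wsum W₂ (expGroup X t f) =
        wsum (fun p => if ∑ e, p.2 e ≤ N then W₂ p else 0) (expGroup X t f) +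
        wsum (fun p => if ∑ e, p.2 e ≤ N then 0 else W₂ p) (expGroup X t f) := by
      rw [← wsum_add_weight]
      · congr 1; funext p; split_ifs <;> simp
      · intro p; split_ifs; exacts [hW₂0 p, le_rfl]
      · intro p; split_ifs; exacts [le_rfl, hW₂0 p]
    rw [hsplit, hW₂split]
    have h0 : ENNReal.ofReal (ρ ^ 2) * wsum W (expGroup X t f) ≤ C * F := by
      calc _ ≤ ENNReal.ofReal (ρ ^ 2) * (C * wsum W f) := by
            gcongr; exact ih ξ Ξ hξ a ha N k ρ hρ t ht f
        _ = C * (ENNReal.ofReal (ρ ^ 2) * wsum W f) := by ring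
        _ ≤ _ := by gcongr
    calc _ ≤ C * F + (b * (2 * C * (c * (A' * C ^ 2) + 1)) * F + F) := by gcongr
      _ = _ := by ring

end SliceBound

end

section

/-! ### Limits of unitary groups -/

section LimitGroup

variable {E : Type*} [NormedAddCommGroup E] [InnerProductSpace ℂ E] [CompleteSpace E]

/-- All the groups are isometric, so approximating the initial vector costs the same error for every
`n` and `t`. -/
lemma uniformCauchySeqOn_expGroup_of_dense {X : ℕ → E →L[ℂ] E}
    (hX : ∀ n, X n ∈ skewAdjoint (E →L[ℂ] E)) {D : Set E} (hD : Dense D) (S : Set ℝ)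
    (h : ∀ f ∈ D, UniformCauchySeqOn (fun n t => expGroup (X n) t f) atTop S) (f : E) :
    UniformCauchySeqOn (fun n t => expGroup (X n) t f) atTop S := by
  rw [Metric.uniformCauchySeqOn_iff]
  intro ε hε
  obtain ⟨g, hg, hfg⟩ := Metric.mem_closure_iff.1 (hD f) (ε / 3) (by positivity)
  obtain ⟨N, hN⟩ := Metric.uniformCauchySeqOn_iff.1 (h g hg) (ε / 3) (by positivity)
  refine ⟨N, fun m hm n hn t ht => ?_⟩
  have hd : ∀ n, dist (expGroup (X n) t f) (expGroup (X n) t g) = dist f g := fun n => by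
    rw [dist_eq_norm, ← map_sub, norm_expGroup_apply (hX n), dist_eq_norm]
  calc dist (expGroup (X m) t f) (expGroup (X n) t f)
      ≤ dist (expGroup (X m) t f) (expGroup (X m) t g) +
        dist (expGroup (X m) t g) (expGroup (X n) t g) +
        dist (expGroup (X n) t g) (expGroup (X n) t f) := dist_triangle4 _ _ _ _
    _ < ε / 3 + ε / 3 + ε / 3 := by
        rw [dist_comm (expGroup (X n) t g), hd, hd]
        gcongr
        exact hN m hm n hn t ht
    _ = ε := by ring

/-- If the groups generated by bounded skew-adjoint operators form a Cauchy sequence on a dense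
set, locally uniformly in time, they converge strongly to a strongly continuous unitary group. -/
theorem exists_limit_group {X : ℕ → E →L[ℂ] E} (hX : ∀ n, X n ∈ skewAdjoint (E →L[ℂ] E))
    {D : Set E} (hD : Dense D)
    (h : ∀ f ∈ D, ∀ T : ℝ,
      UniformCauchySeqOn (fun n t => expGroup (X n) t f) atTop (Set.Icc (-T) T)) :
    ∃ V : ℝ → E →L[ℂ] E, V 0 = 1 ∧ (∀ s t f, V (s + t) f = V s (V t f)) ∧
      (∀ t f g, inner ℂ (V t f) g = inner ℂ f (V (-t) g)) ∧
      (∀ f T, TendstoUniformlyOn (fun n t => expGroup (X n) t f) (fun t => V t f) atTop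
        (Set.Icc (-T) T)) ∧
      (∀ f, Continuous fun t => V t f) := by
  have hC := fun (T : ℝ) => uniformCauchySeqOn_expGroup_of_dense hX hD (Set.Icc (-T) T)
    (fun f hf => h f hf T)
  have hlim : ∀ t : ℝ, ∀ f, ∃ g, Tendsto (fun n => expGroup (X n) t f) atTop (𝓝 g) := fun t f =>
    cauchySeq_tendsto_of_complete ((hC |t| f).cauchySeq (abs_le.1 le_rfl))
  choose v hv using hlim
  let V : ℝ → E →L[ℂ] E := fun t => continuousLinearMapOfTendsto (fun n => expGroup (X n) t)
    (tendsto_pi_nhds.2 (hv t))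
  have hV : ∀ t f, Tendsto (fun n => expGroup (X n) t f) atTop (𝓝 (V t f)) := hv
  have hnorm : ∀ t f, ‖V t f‖ = ‖f‖ := fun t f =>
    tendsto_nhds_unique (hV t f).norm (by simp [norm_expGroup_apply (hX _)])
  have hunif : ∀ f T, TendstoUniformlyOn (fun n t => expGroup (X n) t f) (fun t => V t f) atTop
      (Set.Icc (-T) T) := fun f T =>
    (hC T f).tendstoUniformlyOn_of_tendsto fun t _ => hV t f
  refine ⟨V, ?_, ?_, ?_, hunif, ?_⟩
  · ext f
    exact tendsto_nhds_unique (hV 0 f) (by simp)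
  · intro s t f
    refine tendsto_nhds_unique (hV (s + t) f) ?_
    -- A product of strongly convergent isometries converges: the outer isometry does not enlarge
    -- the error of the inner limit.
    have h1 : Tendsto (fun n => expGroup (X n) s (expGroup (X n) t f) -
        expGroup (X n) s (V t f)) atTop (𝓝 0) := by
      rw [tendsto_zero_iff_norm_tendsto_zero]
      simp_rw [← map_sub, norm_expGroup_apply (hX _)]
      rw [← tendsto_zero_iff_norm_tendsto_zero, ← sub_self (V t f)]
      exact (hV t f).sub_const _
    have h2 := h1.add (hV s (V t f))
    simp only [sub_add_cancel, zero_add] at h2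
    simpa only [expGroup_add_apply] using h2
  · intro t f g
    refine tendsto_nhds_unique ((hV t f).inner tendsto_const_nhds) ?_
    simp_rw [inner_expGroup_left (hX _)]
    exact tendsto_const_nhds.inner (hV (-t) g)
  · intro f
    have hcn : ∀ n, Continuous fun t => expGroup (X n) t f := fun n =>
      continuous_iff_continuousAt.2 fun t => (hasDerivAt_expGroup_apply (X n) f t).continuousAt
    rw [continuous_iff_continuousAt]
    intro t
    have hc : ContinuousOn (fun t => V t f) (Set.Icc (-(|t| + 1)) (|t| + 1)) :=
      (hunif f _).continuousOn (Eventually.of_forall fun n => (hcn n).continuousOn).frequently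
    refine hc.continuousAt (Icc_mem_nhds ?_ ?_)
    · linarith [neg_abs_le t]
    · linarith [le_abs_self t]

/-- The derivatives of the approximating orbits are eventually the orbits of the fixed vector `g`.
These converge locally uniformly, so differentiation passes to the limit. -/
lemma hasDerivAt_limit_group {X : ℕ → E →L[ℂ] E} {V : ℝ → E →L[ℂ] E}
    (hV : ∀ f T, TendstoUniformlyOn (fun n t => expGroup (X n) t f) (fun t => V t f) atTop
        (Set.Icc (-T) T)) {f g : E} (hfg : ∀ᶠ n in atTop, X n f = g) (t : ℝ) :
    HasDerivAt (fun t => V t f) (V t g) t := by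
  have ht : t ∈ Set.Ioo (-(|t| + 1)) (|t| + 1) :=
    ⟨by linarith [neg_abs_le t], by linarith [le_abs_self t]⟩
  refine hasDerivAt_of_tendstoLocallyUniformlyOn (s := Set.Ioo (-(|t| + 1)) (|t| + 1))
    (f := fun n t => expGroup (X n) t f)
    (f' := fun n t => expGroup (X n) t g) (l := atTop) isOpen_Ioo
    ((hV g _).mono Set.Ioo_subset_Icc_self).tendstoLocallyUniformlyOn ?_ ?_ ht
  · filter_upwards [hfg] with n hn x _
    rw [← hn]
    exact hasDerivAt_expGroup_apply (X n) f x
  · intro x hx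
    exact (hV f _).tendsto_at (Set.Ioo_subset_Icc_self hx)

end LimitGroup

end

section

/-! ### The transport group on `ℓ²` -/

section TransportGroup

variable {κ J B : Type*} [Fintype J] [DecidableEq J]

/-- Frequencies truncated to a ball. -/
def truncFreq (ξ : κ → J → ℝ) (n : ℕ) (k : κ) (e : J) : ℝ :=
  if ∑ e', ξ k e' ^ 2 ≤ n then ξ k e else 0

lemma abs_truncFreq_le (ξ : κ → J → ℝ) (n : ℕ) (k : κ) (e : J) : |truncFreq ξ n k e| ≤ √n := by
  rw [truncFreq]
  split_ifs with h
  · exact Real.abs_le_sqrt (le_trans (Finset.single_le_sum (f := fun e => ξ k e ^ 2)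
      (fun _ _ => sq_nonneg _) (Finset.mem_univ e)) h)
  · rw [abs_zero]; exact Real.sqrt_nonneg _

lemma abs_truncFreq_le_abs (ξ : κ → J → ℝ) (n : ℕ) (k : κ) (e : J) :
    |truncFreq ξ n k e| ≤ |ξ k e| := by
  rw [truncFreq]
  split_ifs
  · rfl
  · simp

/-- The weight `l²(1 + |ξ|²) + β|n|`. -/
def totalWeight (β : ℝ) (ξ : κ → J → ℝ) (l : ℝ) (p : κ × (J → ℕ)) : ℝ :=
  l ^ 2 * (1 + ∑ e, ξ p.1 e ^ 2) + β * ∑ e, (p.2 e : ℝ)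

lemma one_le_totalWeight {β : ℝ} (hβ : 0 < β) (ξ : κ → J → ℝ) {l : ℝ} (hl : 1 ≤ l)
    (p : κ × (J → ℕ)) : 1 ≤ totalWeight β ξ l p := by
  have h1 : 0 ≤ ∑ e, ξ p.1 e ^ 2 := by positivity
  have h2 : 0 ≤ β * ∑ e, (p.2 e : ℝ) := by positivity
  have h3 : 1 ≤ l ^ 2 := one_le_pow₀ hl
  rw [totalWeight]
  nlinarith

lemma totalWeight_le_up {β : ℝ} (hβ : 0 < β) (ξ : κ → J → ℝ) (l : ℝ) (e : J)
    (p : κ × (J → ℕ)) : totalWeight β ξ l p ≤ totalWeight β ξ l (up e p) := by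
  rw [totalWeight, totalWeight, cast_sum_up, up_fst]
  linarith

lemma totalWeight_one_le {β : ℝ} (ξ : κ → J → ℝ) {l : ℝ} (hl : 1 ≤ l)
    (p : κ × (J → ℕ)) : totalWeight β ξ 1 p ≤ totalWeight β ξ l p := by
  rw [totalWeight, totalWeight]
  have h1 : 0 ≤ ∑ e, ξ p.1 e ^ 2 := by positivity
  gcongr

lemma totalWeight_le_sq_mul {β : ℝ} (hβ : 0 < β) (ξ : κ → J → ℝ) {l : ℝ} (hl : 1 ≤ l)
    (p : κ × (J → ℕ)) : totalWeight β ξ l p ≤ l ^ 2 * totalWeight β ξ 1 p := by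
  rw [totalWeight, totalWeight]
  have h1 : 0 ≤ β * ∑ e, (p.2 e : ℝ) := by positivity
  have h2 : 1 ≤ l ^ 2 := one_le_pow₀ hl
  nlinarith

/-- On the slice at `k` the frequency part of the weight is a constant, and its square root plays
the role of `ρ`. -/
lemma wsum_totalWeight_eq_tsum {β : ℝ} (ξ : κ → J → ℝ) (l : ℝ) (s : ℕ)
    (f : κ × (J → ℕ) → ℂ) :
    wsum (fun p => totalWeight β ξ l p ^ s) f =
      ∑' k, wsum (sliceWeight β (√(l ^ 2 * (1 + ∑ e, ξ k e ^ 2))) k s) f := by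
  simp only [wsum]
  rw [ENNReal.tsum_comm]
  refine tsum_congr fun p => ?_
  rw [tsum_eq_single p.1]
  · rw [sliceWeight, if_pos rfl, Real.sq_sqrt (by positivity), totalWeight]
  · intro k hk
    rw [sliceWeight, if_neg hk.symm]
    simp

variable {β : ℝ} (hβ : 0 < β) (ξ : κ → J → ℝ)
    (π : J → B) {a : κ → B → ℝ} {A : ℝ} (ha : ∀ k b, 0 ≤ a k b ∧ a k b ≤ A)

/-- The truncated transport operators. -/
def truncOp (n : ℕ) : Ell2 (κ × (J → ℕ)) →L[ℂ] Ell2 (κ × (J → ℕ)) :=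
  trOp hβ (abs_truncFreq_le ξ n) π ha n

lemma truncOp_apply (n : ℕ) (f : Ell2 (κ × (J → ℕ))) :
    ⇑(truncOp hβ ξ π ha n f) = jacobi (edgeTr β (truncFreq ξ n) π a n) f :=
  trOp_apply hβ (abs_truncFreq_le ξ n) π ha n f

lemma truncOp_mem_skewAdjoint (n : ℕ) :
    truncOp hβ ξ π ha n ∈ skewAdjoint (Ell2 (κ × (J → ℕ)) →L[ℂ] _) :=
  trOp_mem_skewAdjoint hβ (abs_truncFreq_le ξ n) π ha n

/-- With `ρ = l√(1 + |ξ_k|²)` the requirements `ρ ≥ 1` and `|t ξ_k e| ≤ ρ` hold on every slice as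
soon as `|t| ≤ l`. The slice bounds have a common constant and can be summed. Truncating the
frequencies only decreases `|ξ|`. -/
theorem wsum_expGroup_truncOp_le {β : ℝ} (hβ : 0 < β) (π : J → B) {A : ℝ} (s : ℕ) :
    ∃ C : ℝ≥0∞, C ≠ ⊤ ∧ ∀ (ξ : κ → J → ℝ) (a : κ → B → ℝ)
      (ha : ∀ k b, 0 ≤ a k b ∧ a k b ≤ A) (n : ℕ) (l : ℝ), 1 ≤ l → ∀ t : ℝ, |t| ≤ l →
      ∀ f : Ell2 (κ × (J → ℕ)),
      wsum (fun p => totalWeight β ξ l p ^ s) (expGroup (truncOp hβ ξ π ha n) t f) ≤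
        C * wsum (fun p => totalWeight β ξ l p ^ s) f := by
  obtain ⟨C, hC, h⟩ := wsum_expGroup_le (κ := κ) hβ π (A := A) s
  refine ⟨C, hC, fun ξ a ha n l hl t ht f => ?_⟩
  rw [wsum_totalWeight_eq_tsum, wsum_totalWeight_eq_tsum, ← ENNReal.tsum_mul_left]
  refine ENNReal.tsum_le_tsum fun k => ?_
  have h1 : 0 ≤ ∑ e, ξ k e ^ 2 := by positivity
  refine h _ _ (abs_truncFreq_le ξ n) a ha n k _ ?_ t (fun e => ?_) f
  · rw [Real.one_le_sqrt]
    have : 1 ≤ l ^ 2 := one_le_pow₀ hl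
    nlinarith
  · apply Real.abs_le_sqrt
    have h2 : ξ k e ^ 2 ≤ ∑ e, ξ k e ^ 2 := Finset.single_le_sum (f := fun e => ξ k e ^ 2)
      (fun _ _ => sq_nonneg _) (Finset.mem_univ e)
    have h3 : truncFreq ξ n k e ^ 2 ≤ ξ k e ^ 2 := sq_le_sq.2 (abs_truncFreq_le_abs ξ n k e)
    have h4 : t ^ 2 ≤ l ^ 2 := by
      rw [← sq_abs]; exact pow_le_pow_left₀ (abs_nonneg _) ht 2
    calc (t * truncFreq ξ n k e) ^ 2 = t ^ 2 * truncFreq ξ n k e ^ 2 := by ring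
      _ ≤ l ^ 2 * (1 + ∑ e, ξ k e ^ 2) := by
          gcongr
          linarith

lemma edge_truncFreq (n : ℕ) (e : J) (p : κ × (J → ℕ)) :
    edgeTr β (truncFreq ξ n) π a n e p =
      if ∑ e', p.2 e' + 1 ≤ n ∧ ∑ e', ξ p.1 e' ^ 2 ≤ n then edge β ξ π a e p else 0 := by
  rw [edgeTr, edge, edge, truncFreq]
  by_cases h1 : ∑ e', p.2 e' + 1 ≤ n <;> by_cases h2 : ∑ e', ξ p.1 e' ^ 2 ≤ n <;> simp [h1, h2]

/-- The constant in the bound of the edge weights by the total weight. -/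
def edgeConst (β A : ℝ) : ℝ := (1 + 1 / β) * (1 + A) / β

lemma edge_sq_le_totalWeight (hβ : 0 < β) {a : κ → B → ℝ} {A : ℝ}
    (ha : ∀ k b, 0 ≤ a k b ∧ a k b ≤ A) (e : J) (p : κ × (J → ℕ)) :
    edge β ξ π a e p ^ 2 ≤ edgeConst β A * totalWeight β ξ 1 p ^ 2 := by
  refine (edge_sq_le hβ ξ ha e p).trans ?_
  have h0 : 0 ≤ 1 + A := by have := ha p.1 (π e); linarith
  have h1 : 0 ≤ β * ∑ e, (p.2 e : ℝ) := by positivity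
  have h2 : ξ p.1 e ^ 2 ≤ ∑ e, ξ p.1 e ^ 2 := Finset.single_le_sum (f := fun e => ξ p.1 e ^ 2)
      (fun _ _ => sq_nonneg _) (Finset.mem_univ e)
  have h3 : (p.2 e : ℝ) ≤ ∑ e, (p.2 e : ℝ) := Finset.single_le_sum (f := fun e => (p.2 e : ℝ))
      (fun _ _ => Nat.cast_nonneg _) (Finset.mem_univ e)
  have hw : 1 ≤ totalWeight β ξ 1 p := one_le_totalWeight hβ ξ le_rfl p
  have h4 : ξ p.1 e ^ 2 ≤ totalWeight β ξ 1 p := by rw [totalWeight]; linarith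
  have h5 : (p.2 e : ℝ) + 1 ≤ (1 + 1 / β) * totalWeight β ξ 1 p := by
    have h6 : β * (p.2 e : ℝ) ≤ totalWeight β ξ 1 p := by
      rw [totalWeight]; nlinarith [sq_nonneg (ξ p.1 e)]
    have h7 : (p.2 e : ℝ) ≤ 1 / β * totalWeight β ξ 1 p := by
      rw [one_div, inv_mul_eq_div, le_div_iff₀ hβ]; linarith
    linarith
  calc ξ p.1 e ^ 2 * (p.2 e + 1) / β * (1 + A)
      ≤ totalWeight β ξ 1 p * ((1 + 1 / β) * totalWeight β ξ 1 p) / β * (1 + A) := by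
        gcongr
    _ = _ := by rw [edgeConst]; ring

lemma edgeConst_nonneg (hβ : 0 < β) (hA : 0 ≤ 1 + A) : 0 ≤ edgeConst β A := by
  rw [edgeConst]; positivity

/-- Edges removed by the truncation carry a large weight. -/
lemma le_totalWeight_of_truncated (hβ : 0 < β) {n : ℕ} {p : κ × (J → ℕ)}
    (h : ¬ (∑ e', p.2 e' + 1 ≤ n ∧ ∑ e', ξ p.1 e' ^ 2 ≤ n)) :
    min 1 β * n ≤ totalWeight β ξ 1 p := by
  have h1 : 0 ≤ β * ∑ e, (p.2 e : ℝ) := by positivity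
  have h2 : 0 ≤ ∑ e, ξ p.1 e ^ 2 := by positivity
  have hn : (0 : ℝ) ≤ n := Nat.cast_nonneg n
  rw [totalWeight]
  by_cases h3 : ∑ e', p.2 e' + 1 ≤ n
  · have h4 : (n : ℝ) < ∑ e', ξ p.1 e' ^ 2 := not_le.1 fun h' => h ⟨h3, h'⟩
    nlinarith [min_le_left 1 β]
  · have h4 : (n : ℝ) ≤ ∑ e, (p.2 e : ℝ) := by exact_mod_cast (by omega : n ≤ ∑ e', p.2 e')
    have h5 : min 1 β * n ≤ β * n := by gcongr; exact min_le_right _ _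
    nlinarith

/-- Squared edge weights are of order two in the total weight. An edge that is cut at level `n` sits
at weight at least `min 1 β * n`, so a third power of the weight buys the factor `1/n`. -/
lemma sq_sub_edgeTr_le (hβ : 0 < β) {a : κ → B → ℝ} {A : ℝ}
    (ha : ∀ k b, 0 ≤ a k b ∧ a k b ≤ A) {n n' : ℕ} (hn : 0 < n) (hnn' : n ≤ n') (e : J)
    (p : κ × (J → ℕ)) :
    (edgeTr β (truncFreq ξ n') π a n' e p - edgeTr β (truncFreq ξ n) π a n e p) ^ 2 ≤
      edgeConst β A / (min 1 β * n) * totalWeight β ξ 1 p ^ 3 := by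
  have hA : 0 ≤ 1 + A := by have := ha p.1 (π e); linarith
  have hB := edgeConst_nonneg hβ hA
  have hm : 0 < min 1 β := lt_min one_pos hβ
  have hw : 1 ≤ totalWeight β ξ 1 p := one_le_totalWeight hβ ξ le_rfl p
  have hn' : (0 : ℝ) < n := by exact_mod_cast hn
  rw [edge_truncFreq, edge_truncFreq]
  by_cases h : ∑ e', p.2 e' + 1 ≤ n ∧ ∑ e', ξ p.1 e' ^ 2 ≤ n
  · rw [if_pos h, if_pos ⟨h.1.trans hnn', h.2.trans (by exact_mod_cast hnn')⟩, sub_self]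
    have : 0 ≤ edgeConst β A / (min 1 β * n) * totalWeight β ξ 1 p ^ 3 := by positivity
    simpa using this
  · rw [if_neg h, sub_zero]
    have h1 := le_totalWeight_of_truncated ξ hβ h
    have h2 : edgeConst β A * totalWeight β ξ 1 p ^ 2 ≤
        edgeConst β A / (min 1 β * n) * totalWeight β ξ 1 p ^ 3 := by
      rw [div_mul_eq_mul_div, le_div_iff₀ (by positivity)]
      calc edgeConst β A * totalWeight β ξ 1 p ^ 2 * (min 1 β * n)
          ≤ edgeConst β A * totalWeight β ξ 1 p ^ 2 * totalWeight β ξ 1 p :=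
            mul_le_mul_of_nonneg_left h1 (by positivity)
        _ = _ := by ring
    refine le_trans ?_ h2
    split_ifs
    · exact edge_sq_le_totalWeight ξ π hβ ha e p
    · rw [zero_pow two_ne_zero]; positivity

lemma jacobi_sub (c c' : J → κ × (J → ℕ) → ℝ) (f : κ × (J → ℕ) → ℂ) (p : κ × (J → ℕ)) :
    jacobi c f p - jacobi c' f p = jacobi (fun e q => c e q - c' e q) f p := by
  rw [jacobi, jacobi, jacobi, ← mul_sub, ← Finset.sum_sub_distrib]
  congr 1
  refine Finset.sum_congr rfl fun e _ => ?_
  by_cases h : p.2 e = 0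
  · simp only [lower, raise_of_eq_zero h]
    push_cast; ring
  · obtain ⟨r, rfl⟩ := exists_up_eq h
    simp only [lower, raise_up]
    push_cast; ring

lemma jacobi_sub_right (c : J → κ × (J → ℕ) → ℝ) (f g : κ × (J → ℕ) → ℂ) (p : κ × (J → ℕ)) :
    jacobi c f p - jacobi c g p = jacobi c (fun q => f q - g q) p := by
  rw [jacobi, jacobi, jacobi, ← mul_sub, ← Finset.sum_sub_distrib]
  congr 1
  refine Finset.sum_congr rfl fun e _ => ?_
  by_cases h : p.2 e = 0
  · simp only [lower, raise_of_eq_zero h]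
    ring
  · obtain ⟨r, rfl⟩ := exists_up_eq h
    simp only [lower, raise_up]
    ring

/-- Duhamel's formula compares the two groups. The difference of their generators is small in `ℓ²`
on vectors with finite weight of order three, and the group at level `n'` propagates this weight. -/
lemma enorm_expGroup_sub_le {n n' : ℕ} (hn : 0 < n) (hnn' : n ≤ n') {C : ℝ≥0∞} {l t : ℝ}
    (hl : 1 ≤ l) (ht : |t| ≤ l) (f : Ell2 (κ × (J → ℕ)))
    (hC : ∀ τ : ℝ, |τ| ≤ l →
      wsum (fun p => totalWeight β ξ l p ^ 3) (expGroup (truncOp hβ ξ π ha n') τ f) ≤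
        C * wsum (fun p => totalWeight β ξ l p ^ 3) f) (hA : 0 ≤ 1 + A) :
    ‖expGroup (truncOp hβ ξ π ha n') t f - expGroup (truncOp hβ ξ π ha n) t f‖ₑ ^ 2 ≤
      ENNReal.ofReal (l ^ 2) * ((2 * (Fintype.card J : ℝ≥0∞)) ^ 2 *
        (ENNReal.ofReal (edgeConst β A / (min 1 β * n)) *
          (C * wsum (fun p => totalWeight β ξ l p ^ 3) f))) := by
  set X := truncOp hβ ξ π ha n with hX
  set X' := truncOp hβ ξ π ha n' with hX'
  have hsk := truncOp_mem_skewAdjoint hβ ξ π ha n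
  rw [← hX] at hsk
  have hm : 0 < min 1 β := lt_min one_pos hβ
  have hB := edgeConst_nonneg hβ hA
  -- Duhamel's formula is the intertwining relation with `D = 1` and `M = X' - X`.
  have hcomm : (1 : Ell2 (κ × (J → ℕ)) →L[ℂ] _) * X' = X * 1 + (X' - X) := by
    rw [one_mul, mul_one]; abel
  have hnrm : ∀ s (g : Ell2 (κ × (J → ℕ))), ‖expGroup X s g‖ₑ = ‖g‖ₑ := fun s g => by
    rw [← ofReal_norm, ← ofReal_norm, norm_expGroup_apply hsk]
  have hd := fun τ => hasDerivAt_intertwine hcomm f τ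
  have h1 := wsum_sub_le_of_hasDerivAt (W := fun _ => 1) (fun _ => zero_le_one) hd t
    (M := (2 * (Fintype.card J : ℝ≥0∞)) ^ 2 * (ENNReal.ofReal (edgeConst β A / (min 1 β * n)) *
          (C * wsum (fun p => totalWeight β ξ l p ^ 3) f))) (fun τ hτ => by
      rw [wsum_one_eq, hnrm, ← wsum_one_eq]
      set g := expGroup X' τ f with hg
      have h2 : ((X' - X) g : κ × (J → ℕ) → ℂ) =
          jacobi (fun e q => edgeTr β (truncFreq ξ n') π a n' e q -
            edgeTr β (truncFreq ξ n) π a n e q) g := by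
        funext p
        rw [← jacobi_sub, ← truncOp_apply hβ ξ π ha n', ← truncOp_apply hβ ξ π ha n]
        rfl
      rw [h2]
      refine (wsum_jacobi_le (W := fun p => edgeConst β A / (min 1 β * n) *
        totalWeight β ξ 1 p ^ 3) (fun e p => sq_sub_edgeTr_le ξ π hβ ha hn hnn' e p)
        (fun e p => ?_) _).trans ?_
      · have := one_le_totalWeight hβ ξ le_rfl p
        have := totalWeight_le_up hβ ξ 1 e p
        gcongr
      · rw [wsum_const_mul _ (by positivity)]
        gcongr
        refine le_trans (wsum_mono_weight (fun p => ?_) _) (hC τ (hτ.trans ht))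
        have := one_le_totalWeight hβ ξ le_rfl p
        have := totalWeight_one_le (β := β) ξ hl p
        gcongr)
  have h3 : ‖expGroup X' t f - expGroup X t f‖ₑ =
      ‖expGroup X (-t) ((1 : Ell2 (κ × (J → ℕ)) →L[ℂ] _) (expGroup X' t f)) -
        expGroup X (-0) ((1 : Ell2 (κ × (J → ℕ)) →L[ℂ] _) (expGroup X' 0 f))‖ₑ := by
    have : expGroup X (-t) (expGroup X' t f - expGroup X t f) =
        expGroup X (-t) ((1 : Ell2 (κ × (J → ℕ)) →L[ℂ] _) (expGroup X' t f)) -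
        expGroup X (-0) ((1 : Ell2 (κ × (J → ℕ)) →L[ℂ] _) (expGroup X' 0 f)) := by
      have h := expGroup_neg_apply X (-t) f
      rw [neg_neg] at h
      rw [map_sub, h]
      simp
    rw [← this, hnrm]
  rw [h3, ← wsum_one_eq]
  refine h1.trans (mul_le_mul' (ENNReal.ofReal_le_ofReal (sq_le_sq.2 ?_)) le_rfl)
  rwa [abs_of_nonneg (by linarith : 0 ≤ l)]

end TransportGroup

end

/-! ### Finitely supported vectors, convergence of the truncations, and the core graph. -/

section

section FiniteSupport

variable {ι : Type*} [DecidableEq ι]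

/-- The standard unit vectors of `ℓ²`. -/
def unitVec (p : ι) : Ell2 ι := lp.single 2 p (1 : ℂ)

lemma unitVec_self (p : ι) : unitVec p p = 1 := lp.single_apply_self _ _ _

lemma unitVec_ne {p q : ι} (h : q ≠ p) : unitVec p q = 0 := lp.single_apply_ne _ _ _ h

lemma inner_unitVec_left (p : ι) (f : Ell2 ι) : inner ℂ (unitVec p) f = f p := by
  rw [unitVec, lp.inner_single_left]; simp

lemma hasSum_smul_unitVec (f : Ell2 ι) : HasSum (fun p => f p • unitVec p) f := by
  have h := lp.hasSum_single (E := fun _ : ι => ℂ) (p := 2) (by norm_num) f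
  convert h using 2 with p
  rw [unitVec, ← lp.single_smul, smul_eq_mul, mul_one]

lemma wsum_ne_top_of_finite (W : ι → ℝ) {f : ι → ℂ} {F : Finset ι} (h : ∀ p ∉ F, f p = 0) :
    wsum W f ≠ ⊤ := by
  rw [wsum, tsum_eq_sum (s := F) fun p hp => by simp [h p hp]]
  exact ENNReal.sum_ne_top.2 fun p _ => by finiteness

lemma wsum_unitVec_ne_top (W : ι → ℝ) (p : ι) : wsum W (unitVec p : Ell2 ι) ≠ ⊤ :=
  wsum_ne_top_of_finite W (F := {p}) fun q hq => unitVec_ne (by simpa using hq)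

lemma dense_wsum_ne_top (W : ι → ℝ) : Dense {f : Ell2 ι | wsum W f ≠ ⊤} := by
  intro f
  refine mem_closure_of_tendsto (hasSum_smul_unitVec f) (Eventually.of_forall fun F => ?_)
  refine wsum_ne_top_of_finite W (F := F) fun q hq => ?_
  rw [lp.coeFn_sum, Finset.sum_apply]
  refine Finset.sum_eq_zero fun p hp => ?_
  rw [lp.coeFn_smul, Pi.smul_apply, unitVec_ne (by rintro rfl; exact hq hp), smul_zero]

end FiniteSupport

section TransportGroup

variable {κ J B : Type*} [Fintype J] [DecidableEq J] [DecidableEq κ]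

variable {β : ℝ} (hβ : 0 < β) (ξ : κ → J → ℝ)
    (π : J → B) {a : κ → B → ℝ} {A : ℝ} (hA : 0 ≤ A) (ha : ∀ k b, 0 ≤ a k b ∧ a k b ≤ A)

lemma uniformCauchySeqOn_truncOp (hA : 0 ≤ A) {f : Ell2 (κ × (J → ℕ))}
    (hf : wsum (fun p => totalWeight β ξ 1 p ^ 3) f ≠ ⊤) (T : ℝ) :
    UniformCauchySeqOn (fun n t => expGroup (truncOp hβ ξ π ha n) t f) atTop (Set.Icc (-T) T) := by
  obtain ⟨C, hC, hb⟩ := wsum_expGroup_truncOp_le (κ := κ) hβ π (A := A) 3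
  set l := max 1 |T| with hl
  have hl1 : 1 ≤ l := le_max_left _ _
  have hf' : wsum (fun p => totalWeight β ξ l p ^ 3) f ≠ ⊤ := by
    refine ne_top_of_le_ne_top (ENNReal.mul_ne_top (ENNReal.ofReal_ne_top (r := (l ^ 2) ^ 3)) hf) ?_
    rw [← wsum_const_mul _ (by positivity)]
    refine wsum_mono_weight (fun p => ?_) _
    rw [← mul_pow]
    have := one_le_totalWeight hβ ξ hl1 p
    have := totalWeight_le_sq_mul hβ ξ hl1 p
    gcongr
  set bound : ℕ → ℝ≥0∞ := fun n => ENNReal.ofReal (l ^ 2) * ((2 * (Fintype.card J : ℝ≥0∞)) ^ 2 *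
        (ENNReal.ofReal (edgeConst β A / (min 1 β * n)) *
          (C * wsum (fun p => totalWeight β ξ l p ^ 3) f))) with hbound
  have hm : 0 < min 1 β := lt_min one_pos hβ
  have hlim : Tendsto bound atTop (𝓝 0) := by
    have h0 : Tendsto (fun n : ℕ => ENNReal.ofReal (edgeConst β A / (min 1 β * n))) atTop
        (𝓝 0) := by
      rw [← ENNReal.ofReal_zero]
      refine ENNReal.tendsto_ofReal (Tendsto.const_div_atTop ?_ _)
      exact tendsto_natCast_atTop_atTop.const_mul_atTop hm
    have h1 := ENNReal.Tendsto.mul_const (b := C * wsum (fun p => totalWeight β ξ l p ^ 3) f) h0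
      (Or.inr (ENNReal.mul_ne_top hC hf'))
    have h2 := ENNReal.Tendsto.const_mul (a := (2 * (Fintype.card J : ℝ≥0∞)) ^ 2) h1
      (Or.inr (by finiteness))
    have h3 := ENNReal.Tendsto.const_mul (a := ENNReal.ofReal (l ^ 2)) h2 (Or.inr (by finiteness))
    simpa using h3
  rw [Metric.uniformCauchySeqOn_iff]
  intro ε hε
  have hε' : (0 : ℝ≥0∞) < ENNReal.ofReal ε ^ 2 := by positivity
  obtain ⟨N, hN⟩ := eventually_atTop.1 ((hlim.eventually_lt_const hε').and (eventually_gt_atTop 0))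
  have main : ∀ n n', N ≤ n → n ≤ n' → ∀ t ∈ Set.Icc (-T) T,
      dist (expGroup (truncOp hβ ξ π ha n') t f) (expGroup (truncOp hβ ξ π ha n) t f) < ε := by
    intro n n' hn hnn' t ht
    have h := enorm_expGroup_sub_le hβ ξ π ha (hN n hn).2 hnn' hl1
      ((abs_le.2 ht).trans ((le_abs_self T).trans (le_max_right _ _))) f
      (fun τ hτ => hb ξ a ha n' l hl1 τ hτ f) (by linarith)
    have h2 := h.trans_lt (hN n hn).1
    rw [dist_eq_norm]
    by_contra hlt
    rw [not_lt] at hlt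
    refine absurd h2 (not_lt.2 ?_)
    rw [← ofReal_norm]
    gcongr
  refine ⟨N, fun n hn n' hn' t ht => ?_⟩
  rcases le_total n n' with h | h
  · rw [dist_comm]; exact main n n' hn h t ht
  · exact main n' n hn' h t ht

lemma eventually_edgeTr_eq (e : J) (p : κ × (J → ℕ)) :
    ∀ᶠ n : ℕ in atTop, edgeTr β (truncFreq ξ n) π a n e p = edge β ξ π a e p := by
  filter_upwards [eventually_ge_atTop (∑ e', p.2 e' + 1),
    eventually_ge_atTop ⌈∑ e', ξ p.1 e' ^ 2⌉₊] with n h1 h2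
  rw [edge_truncFreq, if_pos ⟨h1, (Nat.le_ceil _).trans (by exact_mod_cast h2)⟩]

/-- Each coordinate of the matrix product involves finitely many edges, and each of these is
eventually untruncated. -/
lemma tendsto_jacobi_edgeTr {u : ℕ → Ell2 (κ × (J → ℕ))} {f : Ell2 (κ × (J → ℕ))}
    (hu : Tendsto u atTop (𝓝 f)) (p : κ × (J → ℕ)) :
    Tendsto (fun n => jacobi (edgeTr β (truncFreq ξ n) π a n) (u n) p) atTop
      (𝓝 (jacobi (edge β ξ π a) f p)) := by
  have hcoord : ∀ q, Tendsto (fun n => u n q) atTop (𝓝 (f q)) := fun q =>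
    ((lp.evalCLM ℂ (fun _ : κ × (J → ℕ) => ℂ) 2 q).continuous.tendsto f).comp hu
  have hedge : ∀ e q, Tendsto (fun n : ℕ => ((edgeTr β (truncFreq ξ n) π a n e q : ℝ) : ℂ)) atTop
      (𝓝 ((edge β ξ π a e q : ℝ) : ℂ)) := fun e q =>
    tendsto_const_nhds.congr' ((eventually_edgeTr_eq (β := β) (a := a) ξ π e q).mono fun n h => by
      dsimp only; rw [h])
  unfold jacobi
  refine (tendsto_finsetSum _ fun e _ => ?_).const_mul _
  refine ((hedge e p).mul (hcoord (up e p))).add ?_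
  by_cases h : p.2 e = 0
  · simp only [raise_of_eq_zero h]; exact tendsto_const_nhds
  · obtain ⟨r, rfl⟩ := exists_up_eq h
    simp only [raise_up]
    exact (hedge e r).mul (hcoord r)

/-- The transport generator applied to finitely supported or rapidly decaying vectors. -/
lemma wsum_jacobi_edge_le {β : ℝ} (hβ : 0 < β) (ξ : κ → J → ℝ) (π : J → B) {a : κ → B → ℝ}
    {A : ℝ} (hA : 0 ≤ A) (ha : ∀ k b, 0 ≤ a k b ∧ a k b ≤ A) (f : κ × (J → ℕ) → ℂ) :
    wsum (fun _ => 1) (jacobi (edge β ξ π a) f) ≤ (2 * (Fintype.card J : ℝ≥0∞)) ^ 2 *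
      wsum (fun p => edgeConst β A * totalWeight β ξ 1 p ^ 2) f := by
  refine wsum_jacobi_le (fun e p => edge_sq_le_totalWeight ξ π hβ ha e p) (fun e p => ?_) f
  have := one_le_totalWeight hβ ξ le_rfl p
  have := totalWeight_le_up hβ ξ 1 e p
  have := edgeConst_nonneg hβ (by linarith : 0 ≤ 1 + A)
  gcongr

/-- The transport generator applied to a unit vector. -/
def jacobiUnit {β : ℝ} (hβ : 0 < β) (ξ : κ → J → ℝ) (π : J → B) {a : κ → B → ℝ}
    {A : ℝ} (hA : 0 ≤ A) (ha : ∀ k b, 0 ≤ a k b ∧ a k b ≤ A) (p : κ × (J → ℕ)) :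
    Ell2 (κ × (J → ℕ)) :=
  ⟨jacobi (edge β ξ π a) (unitVec p), memℓp_of_wsum (ne_top_of_le_ne_top
    (ENNReal.mul_ne_top (by finiteness) (wsum_unitVec_ne_top _ p))
    (wsum_jacobi_edge_le hβ ξ π hA ha _))⟩

lemma jacobiUnit_apply (p : κ × (J → ℕ)) :
    ⇑(jacobiUnit hβ ξ π hA ha p) = jacobi (edge β ξ π a) (unitVec p) := rfl

/-- A unit vector meets finitely many edges. The eventual equality, stronger than convergence, is
the form required by `hasDerivAt_limit_group`. -/
lemma eventually_truncOp_unitVec (p : κ × (J → ℕ)) :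
    ∀ᶠ n : ℕ in atTop, truncOp hβ ξ π ha n (unitVec p) = jacobiUnit hβ ξ π hA ha p := by
  have h1 : ∀ᶠ n : ℕ in atTop, ∀ e, edgeTr β (truncFreq ξ n) π a n e p = edge β ξ π a e p :=
    eventually_all.2 fun e => eventually_edgeTr_eq ξ π e p
  filter_upwards [h1, eventually_ge_atTop (∑ e', p.2 e' + 1),
    eventually_ge_atTop ⌈∑ e', ξ p.1 e' ^ 2⌉₊] with n h1 h2 h3
  refine lp.ext (funext fun q => ?_)
  rw [truncOp_apply, jacobiUnit_apply, jacobi, jacobi]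
  congr 1
  refine Finset.sum_congr rfl fun e _ => ?_
  congr 1
  · rw [lower, lower]
    by_cases hq : up e q = p
    · congr 2
      rw [edge_truncFreq, if_pos]
      subst hq
      rw [sum_up_snd] at h2
      exact ⟨by omega, (Nat.le_ceil _).trans (by exact_mod_cast h3)⟩
    · rw [unitVec_ne hq]; simp
  · by_cases h : q.2 e = 0
    · rw [raise_of_eq_zero h, raise_of_eq_zero h]
    · obtain ⟨r, rfl⟩ := exists_up_eq h
      rw [raise_up, raise_up]
      by_cases hr : r = p
      · subst hr; rw [h1]
      · rw [unitVec_ne hr]; simp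

/-- The closure of the transport generator on finitely supported vectors. -/
def coreGraph {β : ℝ} (hβ : 0 < β) (ξ : κ → J → ℝ) (π : J → B) {a : κ → B → ℝ}
    {A : ℝ} (hA : 0 ≤ A) (ha : ∀ k b, 0 ≤ a k b ∧ a k b ≤ A) :
    Submodule ℂ (Ell2 (κ × (J → ℕ)) × Ell2 (κ × (J → ℕ))) :=
  (Submodule.span ℂ (Set.range fun p => (unitVec p, jacobiUnit hβ ξ π hA ha p))).topologicalClosure

lemma mem_coreGraph_unitVec (p : κ × (J → ℕ)) :
    (unitVec p, jacobiUnit hβ ξ π hA ha p) ∈ coreGraph hβ ξ π hA ha :=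
  Submodule.le_topologicalClosure _ (Submodule.subset_span ⟨p, rfl⟩)

lemma jacobi_sum_smul_unitVec (c : J → κ × (J → ℕ) → ℝ) (f : κ × (J → ℕ) → ℂ)
    (F : Finset (κ × (J → ℕ))) (q : κ × (J → ℕ)) :
    ∑ p ∈ F, f p * jacobi c (unitVec p) q =
      jacobi c (fun q' => ∑ p ∈ F, f p * unitVec p q') q := by
  simp only [jacobi, Finset.mul_sum]
  rw [Finset.sum_comm]
  refine Finset.sum_congr rfl fun e _ => ?_
  by_cases h : q.2 e = 0
  · simp only [lower, raise_of_eq_zero h, add_zero, Finset.mul_sum]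
    exact Finset.sum_congr rfl fun p _ => by ring
  · obtain ⟨r, rfl⟩ := exists_up_eq h
    simp only [lower, raise_up, Finset.mul_sum, ← Finset.sum_add_distrib]
    exact Finset.sum_congr rfl fun p _ => by ring

/-- Rapidly decaying vectors belong to the closure of the generator on finitely supported
vectors. -/
lemma mem_coreGraph_of_wsum_ne_top {f g : Ell2 (κ × (J → ℕ))}
    (hf : wsum (fun p => edgeConst β A * totalWeight β ξ 1 p ^ 2) f ≠ ⊤)
    (hg : ⇑g = jacobi (edge β ξ π a) f) : (f, g) ∈ coreGraph hβ ξ π hA ha := by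
  set W : κ × (J → ℕ) → ℝ := fun p => edgeConst β A * totalWeight β ξ 1 p ^ 2 with hW
  have hs : Tendsto (fun F : Finset (κ × (J → ℕ)) =>
      ∑ p ∈ F, f p • (unitVec p, jacobiUnit hβ ξ π hA ha p)) atTop (𝓝 (f, g)) := by
    have hsum : ∀ F : Finset (κ × (J → ℕ)),
        ∑ p ∈ F, f p • (unitVec p, jacobiUnit hβ ξ π hA ha p) =
          (∑ p ∈ F, f p • unitVec p, ∑ p ∈ F, f p • jacobiUnit hβ ξ π hA ha p) := fun F =>
      Prod.ext (by simp [Prod.fst_sum]) (by simp [Prod.snd_sum])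
    simp only [hsum]
    refine Tendsto.prodMk_nhds (hasSum_smul_unitVec f) ?_
    rw [tendsto_iff_norm_sub_tendsto_zero]
    -- The image of the truncated vector misses `g` by the image of the tail of `f`, whose norm is
    -- controlled by the tail of the convergent weighted sum.
    have htail := ENNReal.tendsto_tsum_compl_atTop_zero
      (f := fun p => ENNReal.ofReal (W p) * ‖f p‖ₑ ^ 2) hf
    have h2 := ENNReal.Tendsto.const_mul (a := (2 * (Fintype.card J : ℝ≥0∞)) ^ 2) htail
      (Or.inr (by finiteness))
    rw [mul_zero] at h2
    have h3 : ∀ F : Finset (κ × (J → ℕ)),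
        ‖∑ p ∈ F, f p • jacobiUnit hβ ξ π hA ha p - g‖ₑ ^ 2 ≤
        (2 * (Fintype.card J : ℝ≥0∞)) ^ 2 *
          ∑' p : { p // p ∉ F }, ENNReal.ofReal (W p) * ‖f p‖ₑ ^ 2 := by
      intro F
      have h4 : ((∑ p ∈ F, f p • jacobiUnit hβ ξ π hA ha p - g : Ell2 _) : κ × (J → ℕ) → ℂ) =
          jacobi (edge β ξ π a) (fun q => (∑ p ∈ F, f p * unitVec p q) - f q) := by
        funext q
        rw [lp.coeFn_sub, Pi.sub_apply, lp.coeFn_sum, Finset.sum_apply, hg, ← jacobi_sub_right,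
          ← jacobi_sum_smul_unitVec]
        rfl
      rw [← wsum_one_eq, h4]
      refine (wsum_jacobi_edge_le hβ ξ π hA ha _).trans ?_
      gcongr
      have h5 : ∀ q, (∑ p ∈ F, f p * unitVec p q) - f q = if q ∈ F then 0 else - f q := by
        intro q
        split_ifs with hq
        · rw [Finset.sum_eq_single q]
          · simp [unitVec_self]
          · intro p _ hpq
            rw [unitVec_ne hpq.symm, mul_zero]
          · exact fun h => absurd hq h
        · rw [Finset.sum_eq_zero, zero_sub]
          intro p hp
          rw [unitVec_ne (by rintro rfl; exact hq hp), mul_zero]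
      simp only [h5]
      rw [wsum, ← tsum_subtype_eq_of_support_subset (s := {p | p ∉ F})]
      · refine le_of_eq (tsum_congr fun p => ?_)
        rw [if_neg p.2, enorm_neg]
      · intro q hq hqF
        exact hq (by simp only [if_pos hqF]; simp)
    have h6 : Tendsto (fun F : Finset (κ × (J → ℕ)) =>
        ‖∑ p ∈ F, f p • jacobiUnit hβ ξ π hA ha p - g‖ₑ ^ 2) atTop (𝓝 0) :=
      tendsto_of_tendsto_of_tendsto_of_le_of_le tendsto_const_nhds h2 (fun _ => zero_le) h3
    have h7 := (ENNReal.tendsto_toReal ENNReal.zero_ne_top).comp h6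
    have h8 := h7.sqrt
    simpa [Function.comp_def] using h8
  exact mem_closure_of_tendsto hs (Eventually.of_forall fun F => Submodule.sum_mem _ fun p _ =>
    Submodule.smul_mem _ _ (Submodule.subset_span ⟨p, rfl⟩))

/-- Formal skew-symmetry against an arbitrary `ℓ²` vector, inherited from the bounded truncations.
It identifies the adjoint of the operator on finitely supported vectors with minus the maximal
matrix operator. -/
lemma inner_jacobiUnit (p : κ × (J → ℕ)) (f : Ell2 (κ × (J → ℕ))) :
    inner ℂ (jacobiUnit hβ ξ π hA ha p) f = - jacobi (edge β ξ π a) f p := by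
  have h1 : Tendsto (fun n => - (truncOp hβ ξ π ha n f) p) atTop
      (𝓝 (- jacobi (edge β ξ π a) f p)) := by
    simp only [truncOp_apply]
    exact (tendsto_jacobi_edgeTr ξ π tendsto_const_nhds p).neg
  refine tendsto_nhds_unique ?_ h1
  refine tendsto_const_nhds.congr' ?_
  filter_upwards [eventually_truncOp_unitVec hβ ξ π hA ha p] with n hn
  rw [← hn, ← inner_unitVec_left, ← ContinuousLinearMap.adjoint_inner_right]
  have h := skewAdjoint.mem_iff.1 (truncOp_mem_skewAdjoint hβ ξ π ha n)
  rw [ContinuousLinearMap.star_eq_adjoint] at h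
  rw [h, neg_apply, inner_neg_right]

end TransportGroup

end

/-! ### The limit group and the identification of its generator. -/

section

/-- A closed subspace is its own double orthogonal complement. The product `E × E` carries the sup
norm, so the argument is made in the Hilbert sum `WithLp 2 (E × E)`. -/
lemma mem_of_forall_inner_eq_zero {E : Type*} [NormedAddCommGroup E] [InnerProductSpace ℂ E]
    [CompleteSpace E] {K : Submodule ℂ (E × E)} (hK : IsClosed (K : Set (E × E))) {x y : E}
    (h : ∀ u v : E, (∀ q ∈ K, inner ℂ u q.1 + inner ℂ v q.2 = 0) →
      inner ℂ u x + inner ℂ v y = 0) : (x, y) ∈ K := by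
  let e := WithLp.prodContinuousLinearEquiv 2 ℂ E E
  let S : Submodule ℂ (WithLp 2 (E × E)) := K.comap e.toLinearEquiv.toLinearMap
  have hS : IsClosed (S : Set (WithLp 2 (E × E))) := hK.preimage e.continuous
  have : CompleteSpace S := hS.completeSpace_coe
  have hmem : WithLp.toLp 2 (x, y) ∈ Sᗮᗮ := by
    rw [Submodule.mem_orthogonal]
    intro w hw
    have := h w.fst w.snd fun q hq => by
      have h1 := (Submodule.mem_orthogonal' S w).1 hw (WithLp.toLp 2 q) hq
      rwa [WithLp.prod_inner_apply] at h1
    rwa [WithLp.prod_inner_apply]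
  rw [Submodule.orthogonal_orthogonal] at hmem
  exact hmem

section TransportGroup

variable {κ J B : Type*} [Fintype J] [DecidableEq J] [DecidableEq κ]

/-- The unitary transport group on `ℓ²`: its generator is given by the Jacobi matrix with edge
weights `edge β ξ π a`, it has the finitely supported vectors as a core, and it inherits the
weighted bounds of the truncated groups. -/
theorem exists_transport_group {β : ℝ} (hβ : 0 < β) (ξ : κ → J → ℝ)
    (π : J → B) {a : κ → B → ℝ} {A : ℝ} (hA : 0 ≤ A) (ha : ∀ k b, 0 ≤ a k b ∧ a k b ≤ A) :
    ∃ V : ℝ → Ell2 (κ × (J → ℕ)) →L[ℂ] Ell2 (κ × (J → ℕ)),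
      V 0 = 1 ∧ (∀ s t f, V (s + t) f = V s (V t f)) ∧
      (∀ t f g, inner ℂ (V t f) g = inner ℂ f (V (-t) g)) ∧
      (∀ f, Continuous fun t => V t f) ∧
      (∀ (W : κ × (J → ℕ) → ℝ) (t : ℝ) (C : ℝ≥0∞), (∀ p, 0 ≤ W p) →
        (∀ n f, wsum W (expGroup (truncOp hβ ξ π ha n) t f) ≤ C * wsum W f) →
        ∀ f, wsum W (V t f) ≤ C * wsum W f) ∧
      (∀ x y, HasDerivAt (fun t => V t x) y 0 → (x, y) ∈ coreGraph hβ ξ π hA ha) ∧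
      (∀ x y : Ell2 (κ × (J → ℕ)), (∀ p, y p = jacobi (edge β ξ π a) x p) → HasDerivAt (fun t => V t x) y 0) := by
  obtain ⟨V, hV0, hVadd, hVinner, hVunif, hVcont⟩ := exists_limit_group
    (truncOp_mem_skewAdjoint hβ ξ π ha)
    (dense_wsum_ne_top fun p : κ × (J → ℕ) => totalWeight β ξ 1 p ^ 3)
    (fun f hf T => uniformCauchySeqOn_truncOp hβ ξ π ha hA hf T)
  have hVt : ∀ t f, Tendsto (fun n => expGroup (truncOp hβ ξ π ha n) t f) atTop (𝓝 (V t f)) :=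
    fun t f => (hVunif f |t|).tendsto_at (abs_le.1 le_rfl)
  have hbound : ∀ (W : κ × (J → ℕ) → ℝ) (t : ℝ) (C : ℝ≥0∞), (∀ p, 0 ≤ W p) →
        (∀ n f, wsum W (expGroup (truncOp hβ ξ π ha n) t f) ≤ C * wsum W f) →
        ∀ f, wsum W (V t f) ≤ C * wsum W f := fun W t C hW h f =>
    wsum_le_of_tendsto hW (hVt t f) fun n => h n f
  have hderiv : ∀ p t, HasDerivAt (fun t => V t (unitVec p))
      (V t (jacobiUnit hβ ξ π hA ha p)) t := fun p t =>
    hasDerivAt_limit_group hVunif (eventually_truncOp_unitVec hβ ξ π hA ha p) t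
  -- The orbit of a unit vector keeps a finite weight of order two, and such vectors lie in the core
  -- domain. Their image is found as the coordinatewise limit of the truncated operators.
  have hcore : ∀ p t, (V t (unitVec p), V t (jacobiUnit hβ ξ π hA ha p)) ∈
      coreGraph hβ ξ π hA ha := by
    intro p t
    apply mem_coreGraph_of_wsum_ne_top
    · obtain ⟨C, hC, hb⟩ := wsum_expGroup_truncOp_le (κ := κ) hβ π (A := A) 2
      set l := max 1 |t|
      have hl : 1 ≤ l := le_max_left _ _
      have h1 := hbound (fun p => totalWeight β ξ l p ^ 2) t C (fun p => sq_nonneg _)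
        (fun n f => hb ξ a ha n l hl t (le_max_right _ _) f) (unitVec p)
      rw [wsum_const_mul _ (edgeConst_nonneg hβ (by linarith))]
      refine ENNReal.mul_ne_top ENNReal.ofReal_ne_top (ne_top_of_le_ne_top
        (ENNReal.mul_ne_top hC (wsum_unitVec_ne_top _ p))
        ((wsum_mono_weight (fun q => ?_) _).trans h1))
      have := one_le_totalWeight hβ ξ le_rfl q
      have := totalWeight_one_le (β := β) ξ hl q
      gcongr
    · funext q
      have h1 := tendsto_jacobi_edgeTr (β := β) (a := a) ξ π (hVt t (unitVec p)) q
      have h2 := ((lp.evalCLM ℂ (fun _ : κ × (J → ℕ) => ℂ) 2 q).continuous.tendsto _).comp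
        (hVt t (jacobiUnit hβ ξ π hA ha p))
      refine tendsto_nhds_unique h2 (h1.congr' ?_)
      filter_upwards [eventually_truncOp_unitVec hβ ξ π hA ha p] with n hn
      rw [← truncOp_apply hβ ξ π ha n, expGroup_apply_comm, hn]
      rfl
  have hmax : ∀ x y : Ell2 (κ × (J → ℕ)), (∀ p, y p = jacobi (edge β ξ π a) x p) →
      HasDerivAt (fun t => V t x) y 0 := by
    intro x y hxy
    -- The pair `(x, y)` is skew-adjoint to the generating pairs of the core graph; the relation is
    -- linear and closed, so it extends to the whole graph.
    have hweak : ∀ q ∈ coreGraph hβ ξ π hA ha, inner ℂ x q.2 + inner ℂ y q.1 = 0 := by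
      let Λ : Ell2 (κ × (J → ℕ)) × Ell2 (κ × (J → ℕ)) →L[ℂ] ℂ :=
        (innerSL ℂ x).comp (ContinuousLinearMap.snd ℂ _ _) +
          (innerSL ℂ y).comp (ContinuousLinearMap.fst ℂ _ _)
      have hΛ : coreGraph hβ ξ π hA ha ≤ Λ.ker := by
        refine Submodule.topologicalClosure_minimal _ (Submodule.span_le.2 ?_) Λ.isClosed_ker
        rintro _ ⟨p, rfl⟩
        change inner ℂ x (jacobiUnit hβ ξ π hA ha p) + inner ℂ y (unitVec p) = 0
        rw [← inner_conj_symm, inner_jacobiUnit, ← inner_conj_symm y, inner_unitVec_left, hxy]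
        simp
      exact fun q hq => hΛ hq
    -- The coordinate is the inner product of `V (-t) (unitVec p)` with `x`. Its time derivative
    -- falls on a pair in the core graph, and the weak identity moves it onto `y`.
    have hcoord : ∀ p t, HasDerivAt (fun t => V t x p) (V t y p) t := by
      intro p t
      have h1 : HasDerivAt (fun t => V (-t) (unitVec p)) (-V (-t) (jacobiUnit hβ ξ π hA ha p)) t := by
        refine ((hderiv p (-t)).scomp t (hasDerivAt_neg t)).congr_deriv ?_
        rw [neg_smul, one_smul]
      have h2 := h1.inner ℂ (hasDerivAt_const t x)
      have h3 : ∀ t z, inner ℂ (V (-t) (unitVec p)) z = V t z p := fun t z => by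
        rw [hVinner, inner_unitVec_left, neg_neg]
      simp only [h3] at h2
      refine h2.congr_deriv ?_
      have h4 := hweak _ (hcore p (-t))
      have h5 := congrArg conj h4
      rw [map_add, inner_conj_symm, inner_conj_symm, map_zero] at h5
      rw [map_zero, lp.coeFn_zero, Pi.zero_apply, zero_add, inner_neg_left, ← h3]
      dsimp only at h5
      linear_combination -h5
    have hint : ∀ t, HasDerivAt (fun t => ∫ τ in (0 : ℝ)..t, V τ y) (V t y) t := fun t =>
      intervalIntegral.integral_hasDerivAt_right ((hVcont y).intervalIntegrable _ _)
        ((hVcont y).stronglyMeasurableAtFilter _ _) (hVcont y).continuousAt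
    -- The coordinatewise derivatives are integrated to an identity in `ℓ²`. Its right-hand side is
    -- differentiable in norm because the orbit of `y` is continuous.
    have hconst : ∀ t, V t x = x + ∫ τ in (0 : ℝ)..t, V τ y := by
      intro t
      refine lp.ext (funext fun p => ?_)
      have hd : ∀ t, HasDerivAt (fun t => V t x p - (∫ τ in (0 : ℝ)..t, V τ y) p) 0 t := fun t => by
        have h1 := ((lp.evalCLM ℂ (fun _ : κ × (J → ℕ) => ℂ) 2 p).restrictScalars
          ℝ).hasFDerivAt.comp_hasDerivAt t (hint t)
        refine ((hcoord p t).sub h1).congr_deriv ?_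
        exact sub_self _
      have h2 := is_const_of_deriv_eq_zero (fun τ => (hd τ).differentiableAt)
        (fun τ => (hd τ).deriv) t 0
      simp only [hV0, intervalIntegral.integral_same] at h2
      rw [lp.coeFn_add, Pi.add_apply]
      simp only [one_apply_eq_self, lp.coeFn_zero, Pi.zero_apply, sub_zero] at h2
      rw [← h2]; ring
    have h0 := (hint 0).const_add x
    rw [hV0] at h0
    exact h0.congr_of_eventuallyEq (Eventually.of_forall hconst)
  refine ⟨V, hV0, hVadd, hVinner, hVcont, hbound, ?_, hmax⟩
  intro x y hxy
  -- If `(u, v)` annihilates the core graph, then `u` is the matrix image of `v`, so by maximality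
  -- the orbit of `v` has derivative `u`. Differentiating the constant inner product of the orbits
  -- of `v` and `x` shows that `(u, v)` annihilates `(x, y)` as well.
  refine mem_of_forall_inner_eq_zero (Submodule.isClosed_topologicalClosure _) fun u v huv => ?_
  have hvu : ∀ p, u p = jacobi (edge β ξ π a) v p := by
    intro p
    have h1 := congrArg conj (huv _ (mem_coreGraph_unitVec hβ ξ π hA ha p))
    rw [map_add, inner_conj_symm, inner_conj_symm, map_zero, inner_jacobiUnit,
      inner_unitVec_left] at h1
    linear_combination h1
  have hd := (hmax v u hvu).inner ℂ hxy
  have h1 : ∀ t, inner ℂ (V t v) (V t x) = inner ℂ v x := fun t => by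
    rw [hVinner, ← hVadd, neg_add_cancel, hV0]; rfl
  simp only [h1, hV0] at hd
  have h2 := hd.unique (hasDerivAt_const (0 : ℝ) (inner ℂ v x))
  rw [add_comm]
  exact h2

end TransportGroup

end

section

/-! ### Quadratic interpolation of weighted bounds -/

section Interpolation

/-- The integral representation of a power through truncated linear functions. -/
lemma lintegral_min_mul_rpow {θ : ℝ} (hθ : 0 < θ) (hθ' : θ < 1) {w : ℝ} (hw : 0 < w) :
    ∫⁻ r in Set.Ioi (0 : ℝ), ENNReal.ofReal (min 1 (r * w) * r ^ (-1 - θ)) =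
      ENNReal.ofReal (w ^ θ) * ENNReal.ofReal (1 / (1 - θ) + 1 / θ) := by
  -- The minimum changes branch at `r = 1 / w`.
  have hi : Set.Ioi (0 : ℝ) = Set.Ioc 0 (1 / w) ∪ Set.Ioi (1 / w) :=
    (Set.Ioc_union_Ioi_eq_Ioi (by positivity)).symm
  rw [hi, lintegral_union measurableSet_Ioi (Set.Ioc_disjoint_Ioi le_rfl)]
  have h1w : 0 < 1 / w := by positivity
  have h1 : ∫⁻ r in Set.Ioc (0 : ℝ) (1 / w), ENNReal.ofReal (min 1 (r * w) * r ^ (-1 - θ)) =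
      ENNReal.ofReal (w ^ θ * (1 / (1 - θ))) := by
    have h2 : ∀ r ∈ Set.Ioc (0 : ℝ) (1 / w), min 1 (r * w) * r ^ (-1 - θ) = w * r ^ (-θ) := by
      intro r hr
      have : r * w ≤ 1 := by rw [← le_div_iff₀ hw]; exact hr.2
      rw [min_eq_right this, show -θ = 1 + (-1 - θ) by ring, Real.rpow_add hr.1, Real.rpow_one]
      ring
    rw [setLIntegral_congr_fun measurableSet_Ioc fun r hr => by rw [h2 r hr],
      ← ofReal_integral_eq_lintegral_ofReal]
    · rw [integral_const_mul, ← intervalIntegral.integral_of_le h1w.le,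
        integral_rpow (Or.inl (by linarith)), Real.zero_rpow (by linarith), sub_zero]
      congr 1
      rw [Real.div_rpow zero_le_one hw.le, Real.one_rpow, show -θ + 1 = 1 - θ by ring,
        Real.rpow_sub hw, Real.rpow_one]
      field_simp
    · have := (intervalIntegral.intervalIntegrable_rpow' (a := 0) (b := 1 / w)
        (by linarith : -1 < -θ)).1
      exact this.const_mul w
    · filter_upwards [ae_restrict_mem measurableSet_Ioc] with r hr
      have := Real.rpow_nonneg hr.1.le (-θ)
      positivity
  have h3 : ∫⁻ r in Set.Ioi (1 / w), ENNReal.ofReal (min 1 (r * w) * r ^ (-1 - θ)) =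
      ENNReal.ofReal (w ^ θ * (1 / θ)) := by
    have h2 : ∀ r ∈ Set.Ioi (1 / w), min 1 (r * w) * r ^ (-1 - θ) = r ^ (-1 - θ) := by
      intro r hr
      have : 1 ≤ r * w := by rw [← div_le_iff₀ hw]; exact le_of_lt hr
      rw [min_eq_left this, one_mul]
    rw [setLIntegral_congr_fun measurableSet_Ioi fun r hr => by rw [h2 r hr],
      ← ofReal_integral_eq_lintegral_ofReal]
    · rw [integral_Ioi_rpow_of_lt (by linarith) h1w]
      congr 1
      rw [show -1 - θ + 1 = -θ by ring, Real.div_rpow zero_le_one hw.le, Real.one_rpow,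
        Real.rpow_neg hw.le]
      field_simp
    · exact integrableOn_Ioi_rpow_of_lt (by linarith) h1w
    · filter_upwards [ae_restrict_mem measurableSet_Ioi] with r hr
      exact Real.rpow_nonneg (h1w.le.trans (le_of_lt hr)) _
  rw [h1, h3, ← ENNReal.ofReal_mul (by positivity), ← ENNReal.ofReal_add, ← mul_add]
  · have : 0 < 1 - θ := by linarith
    positivity
  · positivity

variable {ι : Type*} [Countable ι]

/-- Bounds for the weights `1` and `W` imply a bound for the weight `W ^ θ`. -/
theorem wsum_rpow_le_of_wsum_le {W : ι → ℝ} (hW : ∀ p, 0 < W p) (T : Ell2 ι →L[ℂ] Ell2 ι)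
    {C : ℝ≥0∞} (h0 : ∀ f, wsum (fun _ => 1) (T f) ≤ C * wsum (fun _ => 1) f)
    (h1 : ∀ f, wsum W (T f) ≤ C * wsum W f) {θ : ℝ} (hθ : 0 < θ) (hθ' : θ < 1) (f : Ell2 ι) :
    wsum (fun p => W p ^ θ) (T f) ≤ 2 * C * wsum (fun p => W p ^ θ) f := by
  have key : ∀ r : ℝ, 0 < r → wsum (fun p => min 1 (r * W p)) (T f) ≤
      2 * C * wsum (fun p => min 1 (r * W p)) f := by
    intro r hr
    -- This splitting realizes the truncated weight exactly: `g` carries the weight `1` and `h` the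
    -- weight `r W`, and each piece is handled by one of the two endpoint bounds. The factor `2`
    -- comes from recombining the pieces after `T`.
    set S : Set ι := {p | 1 ≤ r * W p}
    set g := restrictTo S f
    set h := restrictTo Sᶜ f
    have hfgh : f = g + h := by
      refine lp.ext (funext fun p => ?_)
      rw [lp.coeFn_add, Pi.add_apply, restrictTo_apply, restrictTo_apply]
      exact (Set.indicator_self_add_compl_apply S f p).symm
    have hT : (T f : ι → ℂ) = fun p => T g p + T h p := by
      funext p
      rw [hfgh, map_add]; rfl
    have hsum : wsum (fun _ => 1) g + ENNReal.ofReal r * wsum W h =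
        wsum (fun p => min 1 (r * W p)) f := by
      rw [← wsum_const_mul _ hr.le]
      simp only [wsum]
      rw [← ENNReal.tsum_add]
      refine tsum_congr fun p => ?_
      by_cases hp : p ∈ S
      · rw [restrictTo_apply, restrictTo_apply, Set.indicator_of_mem hp,
          Set.indicator_of_notMem (by simpa using hp), min_eq_left hp]
        simp
      · rw [restrictTo_apply, restrictTo_apply, Set.indicator_of_notMem hp,
          Set.indicator_of_mem (by simpa using hp), min_eq_right (not_le.1 hp).le]
        simp
    calc wsum (fun p => min 1 (r * W p)) (T f)
        ≤ 2 * (wsum (fun p => min 1 (r * W p)) (T g) + wsum (fun p => min 1 (r * W p)) (T h)) := by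
          rw [hT]; exact wsum_add_le _ _ _
      _ ≤ 2 * (wsum (fun _ => 1) (T g) + wsum (fun p => r * W p) (T h)) := by
          gcongr
          · exact wsum_mono_weight (fun p => min_le_left _ _) _
          · exact wsum_mono_weight (fun p => min_le_right _ _) _
      _ ≤ 2 * (C * wsum (fun _ => 1) g + ENNReal.ofReal r * (C * wsum W h)) := by
          rw [wsum_const_mul _ hr.le]
          gcongr
          · exact h0 g
          · exact h1 h
      _ = 2 * C * (wsum (fun _ => 1) g + ENNReal.ofReal r * wsum W h) := by ring
      _ = _ := by rw [hsum]
  set c : ℝ≥0∞ := ENNReal.ofReal (1 / (1 - θ) + 1 / θ) with hc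
  have hc0 : c ≠ 0 := by
    have : 0 < 1 - θ := by linarith
    rw [hc, ne_eq, ENNReal.ofReal_eq_zero, not_le]; positivity
  -- Integration of the truncated weights against `r^(-1-θ) dr` reproduces `W^θ` up to the factor
  -- `c`, which is the same on both sides of the bound.
  have hrep : ∀ u : ι → ℂ, ∫⁻ r in Set.Ioi (0 : ℝ), ENNReal.ofReal (r ^ (-1 - θ)) *
      wsum (fun p => min 1 (r * W p)) u = c * wsum (fun p => W p ^ θ) u := by
    intro u
    simp only [wsum, ← ENNReal.tsum_mul_left]
    rw [lintegral_tsum]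
    · refine tsum_congr fun p => ?_
      rw [← mul_assoc, mul_comm c, ← lintegral_min_mul_rpow hθ hθ' (hW p),
        ← lintegral_mul_const' _ _ (by finiteness)]
      refine setLIntegral_congr_fun measurableSet_Ioi fun r hr => ?_
      rw [← mul_assoc, mul_comm (min 1 (r * W p)),
        ENNReal.ofReal_mul (Real.rpow_nonneg (le_of_lt hr) _)]
    · intro p
      fun_prop
  have hfin : c * wsum (fun p => W p ^ θ) (T f) ≤ c * (2 * C * wsum (fun p => W p ^ θ) f) := by
    rw [← hrep, mul_left_comm c, ← hrep, ← lintegral_const_mul]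
    · refine setLIntegral_mono' measurableSet_Ioi fun r hr => ?_
      rw [mul_left_comm]
      gcongr
      exact key r hr
    · refine Measurable.mul (by fun_prop) (Measurable.tsum fun p => ?_)
      fun_prop
  exact (ENNReal.mul_le_mul_iff_right hc0 ENNReal.ofReal_ne_top).1 hfin

end Interpolation

end

section

/-! ### The linearized Vlasov group in coordinates -/

lemma one_le_bracket (t : ℝ) : 1 ≤ bracket t := by
  rw [bracket, Real.one_le_sqrt]; linarith [sq_nonneg t]

lemma abs_le_bracket (t : ℝ) : |t| ≤ bracket t := by
  apply Real.abs_le_sqrt; linarith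

lemma inner_multOp {ι : Type*} (c : ι → ℝ) (M : ℝ) (hM : 0 ≤ M) (hc : ∀ p, ‖(c p : ℂ)‖ ≤ M)
    (f g : Ell2 ι) : inner ℂ (multOp (fun p => (c p : ℂ)) M hM hc f) g =
      inner ℂ f (multOp (fun p => (c p : ℂ)) M hM hc g) := by
  rw [lp.inner_eq_tsum, lp.inner_eq_tsum]
  refine tsum_congr fun p => ?_
  simp only [multOp_apply, RCLike.inner_apply, map_mul, Complex.conj_ofReal]
  ring

section Coordinates

variable {κ J B : Type*} [Fintype J] [DecidableEq J] [DecidableEq κ]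

/-- Weighted bounds for strong limits of the truncated groups, with the sharp growth in time. -/
theorem wsum_limit_le [Countable κ] {β : ℝ} (hβ : 0 < β) (π : J → B) {A : ℝ} {s : ℝ}
    (hs : 0 ≤ s) :
    ∃ C : ℝ≥0∞, C ≠ ⊤ ∧ ∀ (ξ : κ → J → ℝ) (a : κ → B → ℝ)
      (ha : ∀ k b, 0 ≤ a k b ∧ a k b ≤ A) (t : ℝ)
      (T : Ell2 (κ × (J → ℕ)) →L[ℂ] Ell2 (κ × (J → ℕ))),
      (∀ (W : κ × (J → ℕ) → ℝ) (C : ℝ≥0∞), (∀ p, 0 ≤ W p) →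
        (∀ n f, wsum W (expGroup (truncOp hβ ξ π ha n) t f) ≤ C * wsum W f) →
        ∀ f, wsum W (T f) ≤ C * wsum W f) → ∀ f,
      wsum (fun p => totalWeight β ξ 1 p ^ s) (T f) ≤
        C * ENNReal.ofReal (bracket t ^ (2 * s)) * wsum (fun p => totalWeight β ξ 1 p ^ s) f := by
  have hone : ∀ (ξ : κ → J → ℝ) (a : κ → B → ℝ) (ha : ∀ k b, 0 ≤ a k b ∧ a k b ≤ A) (t : ℝ) n f,
      wsum (fun _ => 1) (expGroup (truncOp hβ ξ π ha n) t f) ≤ 1 * wsum (fun _ => 1) f := by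
    intro ξ a ha t n f
    rw [wsum_one_eq, wsum_one_eq, ← ofReal_norm, ← ofReal_norm,
      norm_expGroup_apply (truncOp_mem_skewAdjoint hβ ξ π ha n), one_mul]
  rcases hs.eq_or_lt with rfl | hs
  · refine ⟨1, ENNReal.one_ne_top, fun ξ a ha t T hT f => ?_⟩
    simp only [Real.rpow_zero, mul_zero, ENNReal.ofReal_one, mul_one]
    exact hT _ _ (fun _ => zero_le_one) (hone ξ a ha t) f
  -- An integer order strictly above `s`, so that `s / N` is an interpolation exponent strictly
  -- between `0` and `1`; the case `s = 0` has been treated apart.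
  set N : ℕ := ⌈s⌉₊ + 1 with hN
  have hsN : s < N := by
    rw [hN]; push_cast
    linarith [Nat.le_ceil s]
  have hN0 : (0 : ℝ) < N := hs.trans hsN
  obtain ⟨C, hC, hb⟩ := wsum_expGroup_truncOp_le (κ := κ) hβ π (A := A) N
  refine ⟨2 * (C + 1), by finiteness, fun ξ a ha t T hT f => ?_⟩
  -- At the scale `l = ⟨t⟩` the constants do not depend on time. All growth comes from comparing the
  -- weights at the scales `l` and `1`, which differ at most by `l²`, hence by `l^(2s)` after taking
  -- powers.
  set l := bracket t with hl
  have hl1 : 1 ≤ l := one_le_bracket t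
  have hw : ∀ p, 1 ≤ totalWeight β ξ l p := one_le_totalWeight hβ ξ hl1
  have hw1 : ∀ p, 1 ≤ totalWeight β ξ 1 p := one_le_totalWeight hβ ξ le_rfl
  have h0 : ∀ f, wsum (fun _ => 1) (T f) ≤ (C + 1) * wsum (fun _ => 1) f := fun f =>
    (hT _ _ (fun _ => zero_le_one) (hone ξ a ha t) f).trans (by gcongr; exact le_add_self)
  have h1 : ∀ f, wsum (fun p => totalWeight β ξ l p ^ N) (T f) ≤
      (C + 1) * wsum (fun p => totalWeight β ξ l p ^ N) f := fun f =>
    (hT _ C (fun p => pow_nonneg (zero_le_one.trans (hw p)) _)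
      (fun n f => hb ξ a ha n l hl1 t (abs_le_bracket t) f) f).trans
      (by gcongr; exact le_self_add)
  have h2 := wsum_rpow_le_of_wsum_le (fun p => pow_pos (zero_lt_one.trans_le (hw p)) N) T h0 h1
    (div_pos hs hN0) ((div_lt_one hN0).2 hsN) f
  have h3 : ∀ p, (totalWeight β ξ l p ^ N) ^ (s / N) = totalWeight β ξ l p ^ s := fun p => by
    rw [← Real.rpow_natCast, ← Real.rpow_mul (zero_le_one.trans (hw p)), mul_div_cancel₀ _ hN0.ne']
  simp only [h3] at h2
  calc wsum (fun p => totalWeight β ξ 1 p ^ s) (T f)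
      ≤ wsum (fun p => totalWeight β ξ l p ^ s) (T f) := by
        refine wsum_mono_weight (fun p => ?_) _
        exact Real.rpow_le_rpow (zero_le_one.trans (hw1 p)) (totalWeight_one_le ξ hl1 p) hs.le
    _ ≤ 2 * (C + 1) * wsum (fun p => totalWeight β ξ l p ^ s) f := h2
    _ ≤ 2 * (C + 1) * wsum (fun p => l ^ (2 * s) * totalWeight β ξ 1 p ^ s) f := by
        gcongr
        refine wsum_mono_weight (fun p => ?_) _
        rw [Real.rpow_mul (by linarith), Real.rpow_ofNat, ← Real.mul_rpow (by positivity)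
          (zero_le_one.trans (hw1 p))]
        exact Real.rpow_le_rpow (zero_le_one.trans (hw p)) (totalWeight_le_sq_mul hβ ξ hl1 p) hs.le
    _ = _ := by
        rw [wsum_const_mul _ (by positivity)]; ring

variable [Fintype B]

open Classical in
/-- The diagonal symmetrizer `∏ √(1 + a_b)`, over the blocks in their ground state. -/
def symmetrizer (π : J → B) (a : κ → B → ℝ) (p : κ × (J → ℕ)) : ℝ :=
  ∏ b, if ∀ e, π e = b → p.2 e = 0 then √(1 + a p.1 b) else 1

lemma one_le_symmetrizer {π : J → B} {a : κ → B → ℝ} {A : ℝ}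
    (ha : ∀ k b, 0 ≤ a k b ∧ a k b ≤ A) (p : κ × (J → ℕ)) : 1 ≤ symmetrizer π a p := by
  refine Finset.one_le_prod fun b _ => ?_
  have := ha p.1 b
  split_ifs
  · exact Real.one_le_sqrt.2 (by linarith)
  · rfl

lemma symmetrizer_le {π : J → B} {a : κ → B → ℝ} {A : ℝ} (hA : 0 ≤ A)
    (ha : ∀ k b, 0 ≤ a k b ∧ a k b ≤ A) (p : κ × (J → ℕ)) :
    symmetrizer π a p ≤ √(1 + A) ^ Fintype.card B := by
  rw [← Finset.card_univ, ← Finset.prod_const]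
  refine Finset.prod_le_prod (fun b _ => ?_) fun b _ => ?_
  · split_ifs <;> positivity
  · have := ha p.1 b
    split_ifs
    · exact Real.sqrt_le_sqrt (by linarith)
    · exact Real.one_le_sqrt.2 (by linarith)

/-- A step in direction `e` takes only the block of `e` out of a possible ground state, so exactly
its factor is lost. -/
lemma symmetrizer_up (π : J → B) (a : κ → B → ℝ) (e : J) (p : κ × (J → ℕ)) :
    blockFactor π a e p * symmetrizer π a (up e p) = symmetrizer π a p := by
  classical
  rw [symmetrizer, symmetrizer, ← Finset.mul_prod_erase _ _ (Finset.mem_univ (π e)),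
    ← Finset.mul_prod_erase _ _ (Finset.mem_univ (π e))]
  rw [if_neg (fun h => by have := h e rfl; rw [up_snd_self] at this; omega), one_mul]
  congr 1
  refine Finset.prod_congr rfl fun b hb => ?_
  have hb' : b ≠ π e := Finset.ne_of_mem_erase hb
  have h1 : (∀ e', π e' = b → (up e p).2 e' = 0) ↔ ∀ e', π e' = b → p.2 e' = 0 := by
    refine forall_congr' fun e' => ?_
    by_cases he : π e' = b
    · rw [up_snd_ne (by rintro rfl; exact hb' he.symm)]
    · simp [he]
  by_cases hz : ∀ e', π e' = b → p.2 e' = 0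
  · rw [if_pos (h1.2 hz), if_pos hz, up_fst]
  · rw [if_neg (fun h => hz (h1.1 h)), if_neg hz]

/-- The matrix of the linearized Vlasov operator in the Fourier–Hermite basis. -/
def vlasovMatrix (β : ℝ) (ξ : κ → J → ℝ) (π : J → B) (a : κ → B → ℝ) (f : κ × (J → ℕ) → ℂ)
    (p : κ × (J → ℕ)) : ℂ :=
  Complex.I * ∑ e, (lower e (fun q => ξ q.1 e * √(q.2 e + 1) / √β) f p +
    raise e (fun q => ξ q.1 e * √(q.2 e + 1) / √β * blockFactor π a e q ^ 2) f p)

/-- By `symmetrizer_up`, the ratio of the symmetrizer across an edge is the block factor `b`.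
Conjugation therefore divides the downward entry by `b` and multiplies the upward one by `b`, which
turns the symmetric entry `c b` into `c` downwards and `c b²` upwards. -/
lemma jacobi_symmetrizer (β : ℝ) (ξ : κ → J → ℝ) (π : J → B) (a : κ → B → ℝ)
    (f : κ × (J → ℕ) → ℂ) (p : κ × (J → ℕ)) :
    jacobi (edge β ξ π a) (fun q => symmetrizer π a q * f q) p =
      symmetrizer π a p * vlasovMatrix β ξ π a f p := by
  rw [jacobi, vlasovMatrix]
  conv_rhs => rw [mul_left_comm, Finset.mul_sum]
  congr 1
  refine Finset.sum_congr rfl fun e _ => ?_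
  rw [mul_add]
  congr 1
  · rw [lower, lower, edge, ← symmetrizer_up π a e p]
    push_cast; ring
  · by_cases h : p.2 e = 0
    · rw [raise_of_eq_zero h, raise_of_eq_zero h, mul_zero]
    · obtain ⟨r, rfl⟩ := exists_up_eq h
      rw [raise_up, raise_up, edge, ← symmetrizer_up π a e r]
      push_cast; ring

lemma jacobi_const_mul (c : J → κ × (J → ℕ) → ℝ) (z : ℂ) (f : κ × (J → ℕ) → ℂ)
    (p : κ × (J → ℕ)) : jacobi c (fun q => z * f q) p = z * jacobi c f p := by
  rw [jacobi, jacobi]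
  conv_rhs => rw [mul_left_comm, Finset.mul_sum]
  congr 1
  refine Finset.sum_congr rfl fun e _ => ?_
  by_cases h : p.2 e = 0
  · simp only [lower, raise_of_eq_zero h]; ring
  · obtain ⟨r, rfl⟩ := exists_up_eq h
    simp only [lower, raise_up]; ring

/-- The linearized Vlasov group in Fourier–Hermite coordinates. -/
theorem exists_vlasov_group [Countable κ] {β : ℝ} (hβ : 0 < β) (π : J → B) {A : ℝ} (hA : 0 ≤ A)
    {s : ℝ} (hs : 0 ≤ s) :
    ∃ C : ℝ≥0∞, C ≠ ⊤ ∧ ∀ (ξ : κ → J → ℝ) (a : κ → B → ℝ), (∀ k b, 0 ≤ a k b ∧ a k b ≤ A) →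
      ∃ U : ℝ → Ell2 (κ × (J → ℕ)) →L[ℂ] Ell2 (κ × (J → ℕ)),
        U 0 = 1 ∧ (∀ t t' f, U (t + t') f = U t (U t' f)) ∧ (∀ f, Continuous fun t => U t f) ∧
        (∀ K : Submodule ℂ (Ell2 (κ × (J → ℕ)) × Ell2 (κ × (J → ℕ))),
          IsClosed (K : Set (Ell2 (κ × (J → ℕ)) × Ell2 (κ × (J → ℕ)))) →
          (∀ p, ∀ y : Ell2 (κ × (J → ℕ)), (∀ q, y q = vlasovMatrix β ξ π a (unitVec p) q) →
            (unitVec p, y) ∈ K) →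
          ∀ x y, HasDerivAt (fun t => U t x) y 0 → (x, y) ∈ K) ∧
        (∀ x y : Ell2 (κ × (J → ℕ)), (∀ p, y p = vlasovMatrix β ξ π a x p) →
          HasDerivAt (fun t => U t x) y 0) ∧
        ∀ t f, wsum (fun p => totalWeight β ξ 1 p ^ s) ((U t).adjoint f) ≤
          C * ENNReal.ofReal (bracket t ^ (2 * s)) *
            wsum (fun p => totalWeight β ξ 1 p ^ s) f := by
  obtain ⟨C, hC, hCb⟩ := wsum_limit_le (κ := κ) hβ π (A := A) hs
  set M : ℝ := √(1 + A) ^ Fintype.card B with hM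
  have hM0 : 0 ≤ M := by positivity
  refine ⟨ENNReal.ofReal (M ^ 2) * C, by finiteness, fun ξ a ha => ?_⟩
  obtain ⟨V, hV0, hVadd, hVinner, hVcont, hVb, hVcore, hVmax⟩ :=
    exists_transport_group hβ ξ π hA ha
  set σ : κ × (J → ℕ) → ℝ := symmetrizer π a with hσ
  have hσ1 : ∀ p, 1 ≤ σ p := one_le_symmetrizer ha
  have hσM : ∀ p, ‖(σ p : ℂ)‖ ≤ M := fun p => by
    rw [Complex.norm_real, Real.norm_eq_abs, abs_of_nonneg (zero_le_one.trans (hσ1 p))]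
    exact symmetrizer_le hA ha p
  have hσi : ∀ p, ‖(((σ p)⁻¹ : ℝ) : ℂ)‖ ≤ 1 := fun p => by
    rw [Complex.norm_real, Real.norm_eq_abs,
      abs_of_nonneg (inv_nonneg.2 (zero_le_one.trans (hσ1 p)))]
    exact inv_le_one_of_one_le₀ (hσ1 p)
  have hσ0 : ∀ p, (σ p : ℂ) ≠ 0 := fun p => by
    exact_mod_cast (zero_lt_one.trans_le (hσ1 p)).ne'
  set S := multOp (fun p => (σ p : ℂ)) M hM0 hσM with hS
  set S' := multOp (fun p => (((σ p)⁻¹ : ℝ) : ℂ)) 1 zero_le_one hσi with hS'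
  have hSS' : ∀ f, S (S' f) = f := fun f => lp.ext (funext fun p => by
    change (σ p : ℂ) * ((((σ p)⁻¹ : ℝ) : ℂ) * f p) = f p
    push_cast
    rw [mul_inv_cancel_left₀ (hσ0 p)])
  have hS'S : ∀ f, S' (S f) = f := fun f => lp.ext (funext fun p => by
    change (((σ p)⁻¹ : ℝ) : ℂ) * ((σ p : ℂ) * f p) = f p
    push_cast
    rw [inv_mul_cancel_left₀ (hσ0 p)])
  have hderiv : ∀ x y, HasDerivAt (fun t => S' (V t (S x))) y 0 ↔
      HasDerivAt (fun t => V t (S x)) (S y) 0 := by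
    intro x y
    constructor
    · intro h
      have h1 := (S.restrictScalars ℝ).hasFDerivAt.comp_hasDerivAt 0 h
      refine h1.congr_of_eventuallyEq (Eventually.of_forall fun t => ?_)
      exact (hSS' _).symm
    · intro h
      have h1 := (S'.restrictScalars ℝ).hasFDerivAt.comp_hasDerivAt 0 h
      exact h1.congr_deriv (hS'S y)
  refine ⟨fun t => S'.comp ((V t).comp S), ?_, ?_, ?_, ?_, ?_, ?_⟩
  · ext1 f
    change S' (V 0 (S f)) = f
    rw [hV0]; exact hS'S f
  · intro t t' f
    change S' (V (t + t') (S f)) = S' (V t (S (S' (V t' (S f)))))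
    rw [hSS', hVadd]
  · intro f
    exact S'.continuous.comp (hVcont (S f))
  · intro K hK hKp x y hxy
    -- Leaving the closed subspace `K` arbitrary allows the core statement to be applied later to
    -- the closure of the operator on test functions. A diagonal similarity preserves it, because
    -- `S'` maps a unit vector to a multiple of itself.
    let Q : Ell2 (κ × (J → ℕ)) × Ell2 (κ × (J → ℕ)) →L[ℂ]
      Ell2 (κ × (J → ℕ)) × Ell2 (κ × (J → ℕ)) := S'.prodMap S'
    have hle : coreGraph hβ ξ π hA ha ≤ K.comap Q.toLinearMap := by
      refine Submodule.topologicalClosure_minimal _ (Submodule.span_le.2 ?_)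
        (hK.preimage Q.continuous)
      rintro _ ⟨p, rfl⟩
      change (S' (unitVec p), S' (jacobiUnit hβ ξ π hA ha p)) ∈ K
      have h1 : S' (unitVec p) = (((σ p)⁻¹ : ℝ) : ℂ) • unitVec p := by
        refine lp.ext (funext fun q => ?_)
        change (((σ q)⁻¹ : ℝ) : ℂ) * unitVec p q = (((σ p)⁻¹ : ℝ) : ℂ) * unitVec p q
        by_cases hq : q = p
        · rw [hq]
        · rw [unitVec_ne hq, mul_zero, mul_zero]
      have h2 : (fun q => (σ q : ℂ) * unitVec p q) = fun q => (σ p : ℂ) * unitVec p q := by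
        funext q
        by_cases hq : q = p
        · rw [hq]
        · rw [unitVec_ne hq, mul_zero, mul_zero]
      have h3 := hKp p ((σ p : ℂ) • S' (jacobiUnit hβ ξ π hA ha p)) fun q => by
        change (σ p : ℂ) * ((((σ q)⁻¹ : ℝ) : ℂ) * jacobi (edge β ξ π a) (unitVec p) q) = _
        have h4 := jacobi_symmetrizer β ξ π a (unitVec p) q
        rw [← hσ, h2, jacobi_const_mul] at h4
        rw [mul_left_comm, h4]
        push_cast
        rw [inv_mul_cancel_left₀ (hσ0 q)]
      have h5 := K.smul_mem (((σ p)⁻¹ : ℝ) : ℂ) h3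
      rw [Prod.smul_mk, smul_smul] at h5
      push_cast at h5 h1
      rwa [inv_mul_cancel₀ (hσ0 p), one_smul, ← h1] at h5
    have h1 := hle (hVcore _ _ ((hderiv x y).1 hxy))
    change (S' (S x), S' (S y)) ∈ K at h1
    rwa [hS'S, hS'S] at h1
  · intro x y hxy
    refine (hderiv x y).2 (hVmax _ _ fun p => ?_)
    have := jacobi_symmetrizer β ξ π a x p
    change (σ p : ℂ) * y p = jacobi (edge β ξ π a) (fun q => (σ q : ℂ) * x q) p
    rw [hxy, ← this]
  · intro t f
    -- The symmetrizer is real and diagonal, hence self-adjoint and bounded for every weighted norm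
    -- together with its inverse. The adjoint is thus the unitary group at time `-t` up to harmless
    -- factors.
    have hadj : (S'.comp ((V t).comp S)).adjoint = S.comp ((V (-t)).comp S') := by
      symm
      rw [ContinuousLinearMap.eq_adjoint_iff]
      intro x y
      change inner ℂ (S (V (-t) (S' x))) y = inner ℂ x (S' (V t (S y)))
      rw [hS, inner_multOp, hVinner, neg_neg, hS', inner_multOp]
    rw [hadj]
    change wsum _ (S (V (-t) (S' f))) ≤ _
    have h1 := hCb ξ a ha (-t) (V (-t)) (fun W C hW h => hVb W (-t) C hW h) (S' f)
    rw [show bracket (-t) = bracket t by rw [bracket, neg_sq, ← bracket]] at h1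
    calc wsum (fun p => totalWeight β ξ 1 p ^ s) (S (V (-t) (S' f)))
        ≤ ENNReal.ofReal (M ^ 2) * wsum (fun p => totalWeight β ξ 1 p ^ s) (V (-t) (S' f)) :=
          wsum_mul_le _ fun p _ => pow_le_pow_left₀ (norm_nonneg _) (hσM p) 2
      _ ≤ ENNReal.ofReal (M ^ 2) * (C * ENNReal.ofReal (bracket t ^ (2 * s)) *
            (ENNReal.ofReal 1 * wsum (fun p => totalWeight β ξ 1 p ^ s) f)) := by
          refine mul_le_mul' le_rfl (h1.trans (mul_le_mul' le_rfl ?_))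
          refine wsum_mul_le _ fun p _ => ?_
          calc _ ≤ (1 : ℝ) ^ 2 := pow_le_pow_left₀ (norm_nonneg _) (hσi p) 2
            _ = 1 := one_pow 2
      _ = _ := by rw [ENNReal.ofReal_one]; ring

end Coordinates

end

/-! ### The Gaussian measure and normalized Hermite functions. -/

section

open ProbabilityTheory in
/-- The one-dimensional Maxwellian distribution. -/
def gaussianV (β : ℝ) : Measure ℝ := gaussianReal 0 (Real.toNNReal β⁻¹)

instance (β : ℝ) : IsProbabilityMeasure (gaussianV β) := by unfold gaussianV; infer_instance

instance : IsProbabilityMeasure (volume : Measure UnitAddCircle) :=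
  ⟨by rw [AddCircle.measure_univ]; simp⟩

instance (d : ℕ) : IsProbabilityMeasure (volume : Measure (UnitAddTorus (Fin d))) :=
  inferInstanceAs (IsProbabilityMeasure (Measure.pi fun _ : Fin d => (volume : Measure UnitAddCircle)))

instance (d m : ℕ) : BorelSpace (PhaseN d m) :=
  @Pi.borelSpace (Fin (m + 1)) (fun _ => Phase d) _ _ _ _ fun _ =>
    inferInstanceAs (BorelSpace (Phase d))

lemma maxwellian_eq_prod (d : ℕ) {β : ℝ} (hβ : 0 < β) (v : Fin d → ℝ) :
    maxwellian d β v = ∏ i, ProbabilityTheory.gaussianPDFReal 0 (Real.toNNReal β⁻¹) (v i) := by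
  have h1 : (√(2 * Real.pi * β⁻¹))⁻¹ = (β / (2 * Real.pi)) ^ (1 / 2 : ℝ) := by
    rw [← Real.sqrt_inv, Real.sqrt_eq_rpow]
    congr 1
    field_simp
  simp only [ProbabilityTheory.gaussianPDFReal, sub_zero,
    Real.coe_toNNReal _ (inv_nonneg.2 hβ.le), maxwellian]
  rw [Finset.prod_mul_distrib, ← Real.exp_sum, Finset.prod_const, h1, ← Real.rpow_natCast,
    ← Real.rpow_mul (by positivity), Finset.card_univ, Fintype.card_fin, Finset.mul_sum]
  congr 2
  · ring
  · refine Finset.sum_congr rfl fun i _ => ?_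
    field_simp

lemma withDensity_maxwellian (d : ℕ) {β : ℝ} (hβ : 0 < β) :
    ((volume : Measure (Fin d → ℝ)).withDensity fun v => ENNReal.ofReal (maxwellian d β v)) =
      Measure.pi fun _ => gaussianV β := by
  have hv : Real.toNNReal β⁻¹ ≠ 0 := by simpa using hβ
  symm
  refine Measure.pi_eq fun s hs => ?_
  rw [withDensity_apply _ (MeasurableSet.univ_pi hs)]
  simp_rw [maxwellian_eq_prod d hβ]
  rw [volume_pi, Measure.restrict_pi_pi, ← ofReal_integral_eq_lintegral_ofReal,
    integral_fintype_prod_eq_prod]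
  · rw [ENNReal.ofReal_prod_of_nonneg]
    · refine Finset.prod_congr rfl fun i _ => ?_
      rw [gaussianV, ProbabilityTheory.gaussianReal_apply_eq_integral _ hv]
    · intro i _
      exact integral_nonneg fun x => ProbabilityTheory.gaussianPDFReal_nonneg _ _ _
  · exact Integrable.fintype_prod fun i =>
      (ProbabilityTheory.integrable_gaussianPDFReal _ _).restrict
  · exact ae_of_all _ fun v =>
      Finset.prod_nonneg fun i _ => ProbabilityTheory.gaussianPDFReal_nonneg _ _ _

lemma phaseMeasure_eq (d : ℕ) {β : ℝ} (hβ : 0 < β) :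
    phaseMeasure d β = (volume : Measure (UnitAddTorus (Fin d))).prod
      (Measure.pi fun _ => gaussianV β) := by
  rw [phaseMeasure, withDensity_maxwellian d hβ]

lemma isProbabilityMeasure_phaseMeasure (d : ℕ) {β : ℝ} (hβ : 0 < β) :
    IsProbabilityMeasure (phaseMeasure d β) := by
  rw [phaseMeasure_eq d hβ]; infer_instance

/-! ### One-dimensional Hermite functions -/

open Polynomial

lemma derivative_hermite (n : ℕ) :
    derivative (hermite (n + 1)) = (n + 1 : ℤ[X]) * hermite n := by
  induction n with
  | zero => simp
  | succ n ih =>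
    rw [hermite_succ (n + 1)]
    simp only [derivative_sub, derivative_mul, derivative_X, ih]
    have h : derivative ((n : ℤ[X]) + 1) = 0 := by simp
    rw [h]
    have := hermite_succ n
    push_cast
    linear_combination (-(n + 1 : ℤ[X])) * this

/-- The real Hermite polynomial. -/
def hermiteR (n : ℕ) : ℝ[X] := (hermite n).map (Int.castRingHom ℝ)

lemma hermiteR_succ (n : ℕ) : hermiteR (n + 1) = X * hermiteR n - derivative (hermiteR n) := by
  simp [hermiteR, derivative_map]

lemma derivative_hermiteR (n : ℕ) :
    derivative (hermiteR (n + 1)) = (n + 1 : ℝ[X]) * hermiteR n := by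
  simp only [hermiteR, derivative_map, derivative_hermite, Polynomial.map_mul, Polynomial.map_add,
    Polynomial.map_natCast, Polynomial.map_one]

lemma aeval_hermite (n : ℕ) (x : ℝ) : aeval x (hermite n) = eval x (hermiteR n) := by
  rw [hermiteR, eval_map]; rfl

lemma integrable_polynomial_gaussianReal (v : NNReal) (p : ℝ[X]) :
    Integrable (fun x => eval x p) (ProbabilityTheory.gaussianReal 0 v) := by
  have h : ∀ n : ℕ, Integrable (fun x : ℝ => x ^ n) (ProbabilityTheory.gaussianReal 0 v) := by
    refine ProbabilityTheory.integrable_pow_of_mem_interior_integrableExpSet (X := id) ?_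
    simp [ProbabilityTheory.integrableExpSet_id_gaussianReal]
  simp_rw [eval_eq_sum, Polynomial.sum]
  exact integrable_finsetSum _ fun n _ => (h n).const_mul _

/-- Gaussian integration by parts: the derivative of the density times `p` integrates to zero. -/
lemma integral_X_mul_gaussianReal (p : ℝ[X]) :
    ∫ x, eval x (X * p) ∂ProbabilityTheory.gaussianReal 0 1 =
      ∫ x, eval x (derivative p) ∂ProbabilityTheory.gaussianReal 0 1 := by
  have hint : ∀ q : ℝ[X], Integrable fun x =>
      ProbabilityTheory.gaussianPDFReal 0 1 x * eval x q := by
    intro q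
    have h := integrable_polynomial_gaussianReal 1 q
    rw [ProbabilityTheory.gaussianReal_of_var_ne_zero _ one_ne_zero,
      integrable_withDensity_iff_integrable_smul'
        (ProbabilityTheory.measurable_gaussianPDF _ _)
        (ae_of_all _ fun _ => ProbabilityTheory.gaussianPDF_lt_top)] at h
    simpa [ProbabilityTheory.toReal_gaussianPDF] using h
  have hder : ∀ x : ℝ, HasDerivAt
      (fun x => ProbabilityTheory.gaussianPDFReal 0 1 x * eval x p)
      (ProbabilityTheory.gaussianPDFReal 0 1 x * eval x (derivative p - X * p)) x := by
    intro x
    have h1 : HasDerivAt (ProbabilityTheory.gaussianPDFReal 0 1)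
        (-x * ProbabilityTheory.gaussianPDFReal 0 1 x) x := by
      have h2 : HasDerivAt (fun y : ℝ => -(y - 0) ^ 2 / (2 * ((1 : NNReal) : ℝ))) (-x) x := by
        have := (((hasDerivAt_id x).sub_const 0).pow 2).neg.div_const (2 * ((1 : NNReal) : ℝ))
        refine this.congr_deriv ?_
        simp
        ring
      have := (h2.exp).const_mul (√(2 * Real.pi * ((1 : NNReal) : ℝ)))⁻¹
      refine this.congr_deriv ?_
      simp only [ProbabilityTheory.gaussianPDFReal]
      ring
    refine (h1.mul (p.hasDerivAt x)).congr_deriv ?_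
    simp only [eval_sub, eval_mul, eval_X]
    ring
  have h0 := integral_eq_zero_of_hasDerivAt_of_integrable hder (hint _) (hint _)
  rw [ProbabilityTheory.integral_gaussianReal_eq_integral_smul one_ne_zero,
    ProbabilityTheory.integral_gaussianReal_eq_integral_smul one_ne_zero, ← sub_eq_zero]
  simp only [smul_eq_mul]
  rw [← integral_sub (hint _) (hint _), ← neg_eq_zero, ← integral_neg]
  refine Eq.trans (integral_congr_ae (ae_of_all _ fun x => ?_)) h0
  simp only [eval_sub]
  ring

/-- The recursion `H_{m+1} = X H_m - H_m'` says that Hermite polynomials are raised by the Gaussian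
adjoint of differentiation. Iteration gives orthogonality. -/
lemma integral_hermiteR_succ_mul (m : ℕ) (p : ℝ[X]) :
    ∫ x, eval x (hermiteR (m + 1) * p) ∂ProbabilityTheory.gaussianReal 0 1 =
      ∫ x, eval x (hermiteR m * derivative p) ∂ProbabilityTheory.gaussianReal 0 1 := by
  have h1 : hermiteR (m + 1) * p = X * (hermiteR m * p) - derivative (hermiteR m) * p := by
    rw [hermiteR_succ]; ring
  have h2 : hermiteR m * derivative p =
      derivative (hermiteR m * p) - derivative (hermiteR m) * p := by
    rw [derivative_mul]; ring
  rw [h1, h2]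
  simp only [eval_sub]
  rw [integral_sub (integrable_polynomial_gaussianReal _ _)
    (integrable_polynomial_gaussianReal _ _), integral_sub (integrable_polynomial_gaussianReal _ _)
    (integrable_polynomial_gaussianReal _ _), integral_X_mul_gaussianReal]

lemma integral_hermiteR_mul (m n : ℕ) :
    ∫ x, eval x (hermiteR m * hermiteR n) ∂ProbabilityTheory.gaussianReal 0 1 =
      if m = n then (n.factorial : ℝ) else 0 := by
  induction m generalizing n with
  | zero =>
    cases n with
    | zero => simp [hermiteR]
    | succ n =>
      rw [mul_comm, integral_hermiteR_succ_mul]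
      simp [hermiteR]
  | succ m ih =>
    rw [integral_hermiteR_succ_mul]
    cases n with
    | zero => simp [hermiteR]
    | succ n =>
      rw [derivative_hermiteR]
      have : hermiteR m * ((n + 1 : ℝ[X]) * hermiteR n) =
          C (n + 1 : ℝ) * (hermiteR m * hermiteR n) := by
        simp only [map_add, map_natCast, map_one]; ring
      rw [this]
      simp only [eval_mul, eval_C]
      rw [integral_const_mul]
      have := ih n
      simp only [eval_mul] at this
      rw [this]
      by_cases h : m = n
      · simp [h, Nat.factorial_succ]
      · simp [h]

lemma hermiteFun_eq (β : ℝ) (n : ℕ) (v : ℝ) :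
    hermiteFun β n v = eval (√β * v) (hermiteR n) / √(n.factorial : ℝ) := by
  rw [hermiteFun, aeval_hermite]

lemma map_gaussianV {β : ℝ} (hβ : 0 < β) :
    (gaussianV β).map (fun v => √β * v) = ProbabilityTheory.gaussianReal 0 1 := by
  rw [gaussianV, ProbabilityTheory.gaussianReal_map_const_mul]
  congr 1
  · simp
  · ext
    simp [Real.sq_sqrt hβ.le, Real.coe_toNNReal _ (inv_nonneg.2 hβ.le), hβ.ne']

lemma continuous_hermiteFun (β : ℝ) (n : ℕ) : Continuous (hermiteFun β n) := by
  have : hermiteFun β n = fun v => eval (√β * v) (hermiteR n) / √(n.factorial : ℝ) :=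
    funext (hermiteFun_eq β n)
  rw [this]
  exact ((hermiteR n).continuous.comp (continuous_const.mul continuous_id)).div_const _

lemma integral_hermiteFun_mul {β : ℝ} (hβ : 0 < β) (m n : ℕ) :
    ∫ v, hermiteFun β m v * hermiteFun β n v ∂gaussianV β = if m = n then 1 else 0 := by
  have h1 : ∀ v, hermiteFun β m v * hermiteFun β n v =
      (√(m.factorial : ℝ))⁻¹ * (√(n.factorial : ℝ))⁻¹ *
        (fun x => eval x (hermiteR m * hermiteR n)) (√β * v) := by
    intro v
    simp only [hermiteFun_eq, eval_mul]
    ring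
  simp_rw [h1]
  rw [integral_const_mul, ← integral_map (f := fun x => eval x (hermiteR m * hermiteR n))
    (by fun_prop) (hermiteR m * hermiteR n).continuous.aestronglyMeasurable, map_gaussianV hβ,
    integral_hermiteR_mul]
  by_cases h : m = n
  · subst h
    have h0 : (0 : ℝ) < m.factorial := by exact_mod_cast m.factorial_pos
    have := Real.mul_self_sqrt h0.le
    simp only [if_true]
    field_simp
    nlinarith
  · simp [h]

lemma integrable_hermiteFun_mul {β : ℝ} (m n : ℕ) :
    Integrable (fun v => hermiteFun β m v * hermiteFun β n v) (gaussianV β) := by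
  have h := integrable_polynomial_gaussianReal (Real.toNNReal β⁻¹)
    ((hermiteR m * hermiteR n).comp (C √β * X) * C ((√(m.factorial : ℝ))⁻¹ * (√(n.factorial : ℝ))⁻¹))
  refine h.congr (ae_of_all _ fun v => ?_)
  simp only [hermiteFun_eq, eval_mul, eval_comp, eval_C, eval_X]
  ring

lemma hermiteFun_zero (β v : ℝ) : hermiteFun β 0 v = 1 := by simp [hermiteFun]

/-- The three-term recurrence for multiplication by `v`. -/
lemma mul_hermiteFun_succ {β : ℝ} (hβ : 0 < β) (n : ℕ) (v : ℝ) :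
    v * hermiteFun β (n + 1) v =
      √((n + 1 : ℕ) + 1) / √β * hermiteFun β (n + 1 + 1) v + √(n + 1) / √β * hermiteFun β n v := by
  have hb : 0 < √β := Real.sqrt_pos.2 hβ
  have h1 : eval (√β * v) (hermiteR (n + 1 + 1)) =
      √β * v * eval (√β * v) (hermiteR (n + 1)) - (n + 1) * eval (√β * v) (hermiteR n) := by
    rw [hermiteR_succ, derivative_hermiteR]
    simp
  simp only [hermiteFun_eq, h1, Nat.factorial_succ]
  push_cast
  have h2 : (0 : ℝ) < √(n + 1) := Real.sqrt_pos.2 (by positivity)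
  have h3 : (0 : ℝ) < √(n + 1 + 1) := Real.sqrt_pos.2 (by positivity)
  have h4 : (0 : ℝ) < √(n.factorial : ℝ) := Real.sqrt_pos.2 (by positivity)
  have h5 : √((n : ℝ) + 1) ^ 2 = n + 1 := Real.sq_sqrt (by positivity)
  rw [Real.sqrt_mul (by positivity), Real.sqrt_mul (by positivity)]
  field_simp
  rw [Real.sqrt_mul (by positivity)]
  linear_combination (-(√(n.factorial : ℝ) * √(n + 1) * eval (v * √β) (hermiteR n))) * h5

lemma mul_hermiteFun_zero {β : ℝ} (hβ : 0 < β) (v : ℝ) :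
    v * hermiteFun β 0 v = 1 / √β * hermiteFun β 1 v := by
  have hb : 0 < √β := Real.sqrt_pos.2 hβ
  simp [hermiteFun]
  field_simp

end

/-! ### Orthonormality of the Fourier–Hermite functions. -/

section

instance (d : ℕ) (β : ℝ) [hβ : Fact (0 < β)] : IsProbabilityMeasure (phaseMeasure d β) :=
  isProbabilityMeasure_phaseMeasure d hβ.out

instance (d m : ℕ) (β : ℝ) [Fact (0 < β)] : IsProbabilityMeasure (phaseMeasureN d m β) :=
  inferInstanceAs (IsProbabilityMeasure (Measure.pi fun _ : Fin (m + 1) => phaseMeasure d β))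

section Fourier

lemma integral_fourier (n : ℤ) :
    ∫ x : UnitAddCircle, fourier n x = if n = 0 then 1 else 0 := by
  have h := AddCircle.volume_eq_smul_haarAddCircle (T := 1)
  rw [ENNReal.ofReal_one, one_smul] at h
  have h2 := fourierCoeff_fourier (T := 1) n
  have h3 := congrFun h2 0
  rw [fourierCoeff] at h3
  simp only [neg_zero, fourier_zero, one_smul] at h3
  rw [h, h3, Pi.single_apply]
  simp [eq_comm]

lemma integral_mFourier {d : ℕ} (k : Fin d → ℤ) :
    ∫ x : UnitAddTorus (Fin d), UnitAddTorus.mFourier k x = if k = 0 then 1 else 0 := by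
  have h1 : ∫ x : UnitAddTorus (Fin d), UnitAddTorus.mFourier k x =
      ∏ i, ∫ x : UnitAddCircle, fourier (k i) x :=
    integral_fintype_prod_eq_prod (μ := fun _ : Fin d => (volume : Measure UnitAddCircle))
      fun i x => fourier (k i) x
  rw [h1]
  simp_rw [integral_fourier]
  rw [Finset.prod_ite_zero]
  simp [funext_iff]

lemma conj_mFourier_mul {d : ℕ} (k k' : Fin d → ℤ) (x : UnitAddTorus (Fin d)) :
    conj (UnitAddTorus.mFourier k x) * UnitAddTorus.mFourier k' x =
      UnitAddTorus.mFourier (k' - k) x := by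
  rw [← UnitAddTorus.mFourier_neg, ← UnitAddTorus.mFourier_add]
  congr 1
  abel_nf

lemma norm_mFourier_apply {d : ℕ} (k : Fin d → ℤ) (x : UnitAddTorus (Fin d)) :
    ‖UnitAddTorus.mFourier k x‖ = 1 := by
  simp only [UnitAddTorus.mFourier, ContinuousMap.coe_mk, norm_prod, fourier_apply,
    Circle.norm_coe, Finset.prod_const_one]

end Fourier

variable {d m : ℕ} {β : ℝ}

/-- The one-particle Fourier–Hermite function. -/
def phaseBasis (β : ℝ) (k : Fin d → ℤ) (n : Fin d → ℕ) (w : Phase d) : ℂ :=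
  UnitAddTorus.mFourier k w.1 * ∏ i, (hermiteFun β (n i) (w.2 i) : ℂ)

lemma fhBasis_eq (p : FHIndex d m) (z : PhaseN d m) :
    fhBasis β p z = ∏ j, phaseBasis β (p.1 j) (p.2 j) (z j) := rfl

lemma continuous_phaseBasis (k : Fin d → ℤ) (n : Fin d → ℕ) :
    Continuous (phaseBasis β k n) := by
  unfold phaseBasis
  refine Continuous.mul ((UnitAddTorus.mFourier k).continuous.comp continuous_fst) ?_
  refine continuous_finsetProd _ fun i _ => Complex.continuous_ofReal.comp ?_
  exact (continuous_hermiteFun β (n i)).comp ((continuous_apply i).comp continuous_snd)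

lemma continuous_fhBasis (p : FHIndex d m) : Continuous (fhBasis β p) := by
  rw [show fhBasis β p = fun z : PhaseN d m => ∏ j, phaseBasis β (p.1 j) (p.2 j) (z j) from
    funext (fhBasis_eq p)]
  refine continuous_finsetProd _ fun j _ => ?_
  have h := continuous_phaseBasis (β := β) (p.1 j) (p.2 j)
  have h2 : Continuous fun z : PhaseN d m => z j := continuous_apply j
  exact Continuous.comp (g := phaseBasis β (p.1 j) (p.2 j)) h h2

lemma conj_phaseBasis_mul (k k' : Fin d → ℤ) (n n' : Fin d → ℕ) (w : Phase d) :
    conj (phaseBasis β k n w) * phaseBasis β k' n' w =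
      UnitAddTorus.mFourier (k' - k) w.1 *
        ∏ i, ((hermiteFun β (n i) (w.2 i) * hermiteFun β (n' i) (w.2 i) : ℝ) : ℂ) := by
  simp only [phaseBasis, map_mul, map_prod, Complex.conj_ofReal]
  rw [← conj_mFourier_mul]
  push_cast
  rw [Finset.prod_mul_distrib]
  ring

variable [hβ : Fact (0 < β)]

lemma integrable_conj_phaseBasis_mul (k k' : Fin d → ℤ) (n n' : Fin d → ℕ) :
    Integrable (fun w => conj (phaseBasis β k n w) * phaseBasis β k' n' w)
      (phaseMeasure d β) := by
  simp_rw [conj_phaseBasis_mul]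
  rw [phaseMeasure_eq d hβ.out]
  refine Integrable.mul_prod (f := fun x => UnitAddTorus.mFourier (k' - k) x)
    (g := fun v : Fin d → ℝ => ∏ i, ((hermiteFun β (n i) (v i) * hermiteFun β (n' i) (v i) : ℝ) : ℂ))
    ?_ ?_
  · exact (integrable_const (1 : ℝ)).mono'
      (UnitAddTorus.mFourier _).continuous.aestronglyMeasurable
      (ae_of_all _ fun x => by simp [norm_mFourier_apply])
  · exact Integrable.fintype_prod fun i => (integrable_hermiteFun_mul _ _).ofReal

lemma integral_conj_phaseBasis_mul (k k' : Fin d → ℤ) (n n' : Fin d → ℕ) :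
    ∫ w, conj (phaseBasis β k n w) * phaseBasis β k' n' w ∂phaseMeasure d β =
      if k = k' ∧ n = n' then 1 else 0 := by
  simp_rw [conj_phaseBasis_mul]
  rw [phaseMeasure_eq d hβ.out, integral_prod_mul (fun x => UnitAddTorus.mFourier (k' - k) x)
    (fun v : Fin d → ℝ => ∏ i, ((hermiteFun β (n i) (v i) * hermiteFun β (n' i) (v i) : ℝ) : ℂ)),
    integral_mFourier, integral_fintype_prod_eq_prod
      (fun i v => ((hermiteFun β (n i) v * hermiteFun β (n' i) v : ℝ) : ℂ))]
  have h1 : ∀ i, ∫ v, ((hermiteFun β (n i) v * hermiteFun β (n' i) v : ℝ) : ℂ) ∂gaussianV β =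
      if n i = n' i then 1 else 0 := by
    intro i
    rw [integral_complex_ofReal, integral_hermiteFun_mul hβ.out]
    split_ifs <;> simp
  simp_rw [h1]
  rw [Finset.prod_ite_zero]
  by_cases hk : k = k'
  · simp [hk, funext_iff]
  · have : k' - k ≠ 0 := sub_ne_zero.2 (Ne.symm hk)
    simp [hk, this]

lemma conj_fhBasis_mul (p q : FHIndex d m) (z : PhaseN d m) :
    conj (fhBasis β p z) * fhBasis β q z =
      ∏ j, conj (phaseBasis β (p.1 j) (p.2 j) (z j)) * phaseBasis β (q.1 j) (q.2 j) (z j) := by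
  rw [fhBasis_eq, fhBasis_eq, map_prod, Finset.prod_mul_distrib]

lemma integrable_conj_fhBasis_mul (p q : FHIndex d m) :
    Integrable (fun z => conj (fhBasis β p z) * fhBasis β q z) (phaseMeasureN d m β) := by
  simp_rw [conj_fhBasis_mul]
  exact Integrable.fintype_prod fun j => integrable_conj_phaseBasis_mul _ _ _ _

lemma integral_conj_fhBasis_mul (p q : FHIndex d m) :
    ∫ z, conj (fhBasis β p z) * fhBasis β q z ∂phaseMeasureN d m β =
      if p = q then 1 else 0 := by
  simp_rw [conj_fhBasis_mul]
  rw [phaseMeasureN, integral_fintype_prod_eq_prod (fun j w =>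
    conj (phaseBasis β (p.1 j) (p.2 j) w) * phaseBasis β (q.1 j) (q.2 j) w)]
  simp_rw [integral_conj_phaseBasis_mul]
  rw [Finset.prod_ite_zero]
  simp [Prod.ext_iff, funext_iff, forall_and]

lemma memLp_fhBasis (p : FHIndex d m) : MemLp (fhBasis β p) 2 (phaseMeasureN d m β) := by
  rw [memLp_two_iff_integrable_sq_norm (continuous_fhBasis p).aestronglyMeasurable]
  refine (integrable_conj_fhBasis_mul p p).norm.congr (ae_of_all _ fun z => ?_)
  simp [sq]

/-- The Fourier–Hermite functions as elements of `L²`. -/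
def fhLp (p : FHIndex d m) : L2 d m β := (memLp_fhBasis p).toLp

lemma coeFn_fhLp (p : FHIndex d m) :
    (fhLp p : L2 d m β) =ᵐ[phaseMeasureN d m β] fhBasis β p := (memLp_fhBasis p).coeFn_toLp

lemma inner_fhLp (p : FHIndex d m) (G : L2 d m β) : inner ℂ (fhLp p) G = fhCoeff G p := by
  rw [L2.inner_def, fhCoeff]
  refine integral_congr_ae ?_
  filter_upwards [coeFn_fhLp (β := β) p] with z hz
  rw [RCLike.inner_apply, hz, mul_comm]

lemma fhCoeff_congr {G : L2 d m β} {g : PhaseN d m → ℂ} (h : G =ᵐ[phaseMeasureN d m β] g)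
    (p : FHIndex d m) : fhCoeff G p = ∫ z, conj (fhBasis β p z) * g z ∂phaseMeasureN d m β := by
  refine integral_congr_ae ?_
  filter_upwards [h] with z hz
  rw [hz]

lemma orthonormal_fhLp : Orthonormal ℂ (fhLp : FHIndex d m → L2 d m β) := by
  classical
  rw [orthonormal_iff_ite]
  intro p q
  rw [inner_fhLp, fhCoeff_congr (coeFn_fhLp q), integral_conj_fhBasis_mul]

end

/-! ### Multiplication by velocities; from Hermite functions to characters. -/

section

variable {d m : ℕ} {β : ℝ}

/-- Indices of the Fourier–Hermite basis, with the Hermite degrees in uncurried form. -/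
abbrev FHIndex' (d m : ℕ) : Type := (Fin (m + 1) → Fin d → ℤ) × (Fin (m + 1) × Fin d → ℕ)

/-- Reindexing of the Fourier–Hermite basis. -/
def indexEquiv (d m : ℕ) : FHIndex d m ≃ FHIndex' d m :=
  Equiv.prodCongr (Equiv.refl _) (Equiv.curry (Fin (m + 1)) (Fin d) ℕ).symm

/-- The Fourier–Hermite function with uncurried index. -/
def fhFun (β : ℝ) (p : FHIndex' d m) (z : PhaseN d m) : ℂ := fhBasis β ((indexEquiv d m).symm p) z

/-- The velocity coordinate with index `e`. -/
def vel (e : Fin (m + 1) × Fin d) (z : PhaseN d m) : ℝ := (z e.1).2 e.2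

lemma fhFun_eq (p : FHIndex' d m) (z : PhaseN d m) :
    fhFun β p z = (∏ j, UnitAddTorus.mFourier (p.1 j) (z j).1) *
      ∏ e, (hermiteFun β (p.2 e) (vel e z) : ℂ) := by
  rw [Fintype.prod_prod_type, ← Finset.prod_mul_distrib]
  rfl

lemma continuous_vel (e : Fin (m + 1) × Fin d) : Continuous (vel e : PhaseN d m → ℝ) :=
  (continuous_apply e.2).comp (continuous_snd.comp
    (continuous_apply e.1 : Continuous fun z : PhaseN d m => z e.1))

/-- The matrix entries of multiplication by a velocity coordinate. -/
def velCoeff (β : ℝ) (e : Fin (m + 1) × Fin d) (q : FHIndex' d m) : ℝ :=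
  √(q.2 e + 1) / √β

lemma prod_hermiteFun_up (e : Fin (m + 1) × Fin d) (n : ℕ) (p : FHIndex' d m) (z : PhaseN d m) :
    ∏ e', (hermiteFun β ((p.2 + Pi.single e n : Fin (m + 1) × Fin d → ℕ) e') (vel e' z) : ℂ) =
      hermiteFun β (p.2 e + n) (vel e z) *
        ∏ e' ∈ Finset.univ.erase e, (hermiteFun β (p.2 e') (vel e' z) : ℂ) := by
  rw [← Finset.mul_prod_erase _ _ (Finset.mem_univ e)]
  congr 1
  · simp
  · refine Finset.prod_congr rfl fun e' he' => ?_
    rw [Finset.mem_erase] at he'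
    simp [he'.1]

/-- The three-term recurrence in the slot `e`, with all other factors inert. In the ground state
there is no lower neighbour, and `raise` vanishes accordingly. -/
lemma vel_mul_fhFun [hβ : Fact (0 < β)] (e : Fin (m + 1) × Fin d) (p : FHIndex' d m)
    (z : PhaseN d m) :
    (vel e z : ℂ) * fhFun β p z =
      lower e (velCoeff β e) (fun q => fhFun β q z) p +
        raise e (velCoeff β e) (fun q => fhFun β q z) p := by
  by_cases hp : p.2 e = 0
  · rw [raise_of_eq_zero hp, add_zero, lower, fhFun_eq, fhFun_eq]
    simp only [up]
    rw [prod_hermiteFun_up, ← Finset.mul_prod_erase _ _ (Finset.mem_univ e), hp, velCoeff, hp]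
    have h := congrArg (Complex.ofReal) (mul_hermiteFun_zero hβ.out (vel e z))
    push_cast at h ⊢
    simp only [zero_add, Real.sqrt_one, Complex.ofReal_one]
    linear_combination (∏ j, UnitAddTorus.mFourier (p.1 j) (z j).1) *
      (∏ e' ∈ Finset.univ.erase e, (hermiteFun β (p.2 e') (vel e' z) : ℂ)) * h
  · obtain ⟨q, rfl⟩ := exists_up_eq hp
    rw [raise_up, lower, fhFun_eq, fhFun_eq, fhFun_eq]
    have h2 : (up e (up e q)).2 = q.2 + Pi.single e 2 := by
      simp only [up]
      rw [add_assoc, ← Pi.single_add]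
    have h1 : (up e q).2 = q.2 + Pi.single e 1 := rfl
    rw [h2, velCoeff, velCoeff, up_snd_self, h1, prod_hermiteFun_up, prod_hermiteFun_up,
      ← Finset.mul_prod_erase Finset.univ _ (Finset.mem_univ e)]
    have h := congrArg (Complex.ofReal) (mul_hermiteFun_succ hβ.out (q.2 e) (vel e z))
    have h3 : ∀ i, (up e (up e q)).1 i = q.1 i := fun _ => rfl
    have h4 : ∀ i, (up e q).1 i = q.1 i := fun _ => rfl
    simp only [h3, h4]
    push_cast at h ⊢
    linear_combination (∏ j, UnitAddTorus.mFourier (q.1 j) (z j).1) *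
      (∏ e' ∈ Finset.univ.erase e, (hermiteFun β (q.2 e') (vel e' z) : ℂ)) * h

variable [hβ : Fact (0 < β)]

lemma memLp_fhFun (p : FHIndex' d m) : MemLp (fhFun β p) 2 (phaseMeasureN d m β) :=
  memLp_fhBasis _

lemma integrable_prod_vel {f : Fin (m + 1) → Fin d → ℝ → ℝ}
    (hf : ∀ j i, Integrable (f j i) (gaussianV β)) :
    Integrable (fun z : PhaseN d m => ∏ j, ∏ i, f j i ((z j).2 i)) (phaseMeasureN d m β) := by
  refine Integrable.fintype_prod (μ := fun _ : Fin (m + 1) => phaseMeasure d β)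
    (f := fun j (w : Phase d) => ∏ i, f j i (w.2 i)) fun j => ?_
  rw [phaseMeasure_eq d hβ.out]
  have h := Integrable.mul_prod (μ := (volume : Measure (UnitAddTorus (Fin d))))
    (ν := Measure.pi fun _ : Fin d => gaussianV β)
    (f := fun _ => (1 : ℝ)) (g := fun v : Fin d → ℝ => ∏ i, f j i (v i))
    (integrable_const _) (Integrable.fintype_prod fun i => hf j i)
  simpa using h

/-- Linear functions of the velocities. -/
def linVel (ξ : Fin (m + 1) × Fin d → ℝ) (z : PhaseN d m) : ℝ := ∑ e, ξ e * vel e z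

lemma continuous_linVel (ξ : Fin (m + 1) × Fin d → ℝ) :
    Continuous (linVel ξ : PhaseN d m → ℝ) :=
  continuous_finsetSum _ fun e _ => continuous_const.mul (continuous_vel e)

/-- The majorant for the exponential series of a character. Its square is at most a product of
one-dimensional functions with finite Gaussian integral. -/
lemma memLp_exp_linVel (ξ : Fin (m + 1) × Fin d → ℝ) :
    MemLp (fun z : PhaseN d m => Real.exp |linVel ξ z|) 2 (phaseMeasureN d m β) := by
  have hc : Continuous fun z : PhaseN d m => Real.exp |linVel ξ z| :=
    Real.continuous_exp.comp (continuous_abs.comp (continuous_linVel ξ))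
  rw [memLp_two_iff_integrable_sq hc.aestronglyMeasurable]
  have h1 : ∀ j i, Integrable (fun v => Real.exp (2 * |ξ (j, i)| * |v|)) (gaussianV β) := by
    intro j i
    exact ProbabilityTheory.integrable_exp_mul_abs (X := fun v => v)
      (ProbabilityTheory.integrable_exp_mul_gaussianReal _)
      (ProbabilityTheory.integrable_exp_mul_gaussianReal _)
  refine (integrable_prod_vel h1).mono' (hc.pow 2).aestronglyMeasurable (ae_of_all _ fun z => ?_)
  rw [Real.norm_of_nonneg (by positivity), ← Real.exp_nat_mul]
  simp_rw [← Real.exp_sum]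
  rw [Real.exp_le_exp, ← Fintype.sum_prod_type'
    (f := fun j i => 2 * |ξ (j, i)| * |(z j).2 i|)]
  push_cast
  rw [linVel]
  calc 2 * |∑ e, ξ e * vel e z| ≤ 2 * ∑ e, |ξ e * vel e z| := by
        gcongr; exact Finset.abs_sum_le_sum_abs _ _
    _ = _ := by
        rw [Finset.mul_sum]
        refine Finset.sum_congr rfl fun e _ => ?_
        rw [abs_mul, vel]; ring

/-- The span of the Fourier–Hermite functions. -/
def fhSpan (d m : ℕ) (β : ℝ) : Submodule ℂ (PhaseN d m → ℂ) := Submodule.span ℂ (Set.range (fhFun β))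

lemma vel_mul_mem_fhSpan (e : Fin (m + 1) × Fin d) {F : PhaseN d m → ℂ}
    (hF : F ∈ fhSpan d m β) : (fun z => (vel e z : ℂ) * F z) ∈ fhSpan d m β := by
  induction hF using Submodule.span_induction with
  | mem F hF =>
    obtain ⟨p, rfl⟩ := hF
    have hmem : ∀ q : FHIndex' d m, fhFun β q ∈ fhSpan d m β := fun q =>
      Submodule.subset_span ⟨q, rfl⟩
    by_cases hp : p.2 e = 0
    · have : (fun z => (vel e z : ℂ) * fhFun β p z) = (velCoeff β e p : ℂ) • fhFun β (up e p) := by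
        funext z
        rw [vel_mul_fhFun, raise_of_eq_zero hp, add_zero]
        rfl
      rw [this]
      exact Submodule.smul_mem _ _ (hmem _)
    · obtain ⟨q, rfl⟩ := exists_up_eq hp
      have : (fun z => (vel e z : ℂ) * fhFun β (up e q) z) =
          (velCoeff β e (up e q) : ℂ) • fhFun β (up e (up e q)) +
            (velCoeff β e q : ℂ) • fhFun β q := by
        funext z
        rw [vel_mul_fhFun, raise_up]
        rfl
      rw [this]
      exact Submodule.add_mem _ (Submodule.smul_mem _ _ (hmem _)) (Submodule.smul_mem _ _ (hmem _))
  | zero => simp only [Pi.zero_apply, mul_zero]; exact Submodule.zero_mem _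
  | add F F' _ _ h h' =>
    simp only [Pi.add_apply, mul_add]
    exact Submodule.add_mem _ h h'
  | smul c F _ h =>
    have := Submodule.smul_mem _ c h
    refine (congrArg (· ∈ fhSpan d m β) ?_).mp this
    funext z
    simp only [Pi.smul_apply, smul_eq_mul]
    ring

/-- The plane waves in the position variables. -/
def planeWave (k : Fin (m + 1) → Fin d → ℤ) (z : PhaseN d m) : ℂ :=
  ∏ j, UnitAddTorus.mFourier (k j) (z j).1

lemma planeWave_mul_pow_mem_fhSpan (k : Fin (m + 1) → Fin d → ℤ) (ξ : Fin (m + 1) × Fin d → ℝ)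
    (n : ℕ) : (fun z => planeWave k z * (linVel ξ z : ℂ) ^ n) ∈ fhSpan d m β := by
  induction n with
  | zero =>
    refine Submodule.subset_span ⟨(k, 0), ?_⟩
    funext z
    simp [fhFun_eq, hermiteFun_zero, planeWave]
  | succ n ih =>
    have h : (fun z => planeWave k z * (linVel ξ z : ℂ) ^ (n + 1)) =
        ∑ e, (ξ e : ℂ) • fun z => (vel e z : ℂ) * (planeWave k z * (linVel ξ z : ℂ) ^ n) := by
      funext z
      simp only [Finset.sum_apply, Pi.smul_apply, smul_eq_mul, pow_succ]
      conv_lhs => rw [linVel]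
      push_cast
      rw [← mul_assoc, Finset.mul_sum]
      refine Finset.sum_congr rfl fun e _ => ?_
      simp only [linVel]
      push_cast
      ring
    rw [h]
    exact Submodule.sum_mem _ fun e _ => Submodule.smul_mem _ _ (vel_mul_mem_fhSpan e ih)

lemma memLp_of_mem_fhSpan {F : PhaseN d m → ℂ} (hF : F ∈ fhSpan d m β) :
    MemLp F 2 (phaseMeasureN d m β) := by
  induction hF using Submodule.span_induction with
  | mem F hF => obtain ⟨p, rfl⟩ := hF; exact memLp_fhFun p
  | zero => exact MemLp.zero
  | add F F' _ _ h h' => exact h.add h'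
  | smul c F _ h => exact h.const_smul c

lemma integrable_conj_mul {F f : PhaseN d m → ℂ} (hF : MemLp F 2 (phaseMeasureN d m β))
    (hf : MemLp f 2 (phaseMeasureN d m β)) :
    Integrable (fun z => conj (F z) * f z) (phaseMeasureN d m β) :=
  MemLp.integrable_mul (p := 2) (q := 2) hF.star hf

lemma integral_conj_mul_eq_zero_of_mem_fhSpan {f : PhaseN d m → ℂ}
    (hf : MemLp f 2 (phaseMeasureN d m β))
    (h0 : ∀ p : FHIndex' d m, ∫ z, conj (fhFun β p z) * f z ∂phaseMeasureN d m β = 0)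
    {F : PhaseN d m → ℂ} (hF : F ∈ fhSpan d m β) :
    ∫ z, conj (F z) * f z ∂phaseMeasureN d m β = 0 := by
  induction hF using Submodule.span_induction with
  | mem F hF => obtain ⟨p, rfl⟩ := hF; exact h0 p
  | zero => simp
  | add F F' hF hF' h h' =>
    simp only [Pi.add_apply, map_add, add_mul]
    rw [integral_add (integrable_conj_mul (memLp_of_mem_fhSpan hF) hf)
      (integrable_conj_mul (memLp_of_mem_fhSpan hF') hf), h, h', add_zero]
  | smul c F _ h =>
    simp only [Pi.smul_apply, smul_eq_mul, map_mul, mul_assoc]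
    rw [integral_const_mul, h, mul_zero]

/-- The characters of the phase space. -/
def phaseChar (k : Fin (m + 1) → Fin d → ℤ) (ξ : Fin (m + 1) × Fin d → ℝ) (z : PhaseN d m) : ℂ :=
  planeWave k z * Complex.exp (Complex.I * linVel ξ z)

lemma norm_planeWave (k : Fin (m + 1) → Fin d → ℤ) (z : PhaseN d m) : ‖planeWave k z‖ = 1 := by
  simp [planeWave, norm_prod, norm_mFourier_apply]

lemma continuous_planeWave (k : Fin (m + 1) → Fin d → ℤ) :
    Continuous (planeWave k : PhaseN d m → ℂ) := by
  refine continuous_finsetProd _ fun j _ => ?_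
  exact (UnitAddTorus.mFourier (k j)).continuous.comp (continuous_fst.comp
    (continuous_apply j : Continuous fun z : PhaseN d m => z j))

lemma continuous_phaseChar (k : Fin (m + 1) → Fin d → ℤ) (ξ : Fin (m + 1) × Fin d → ℝ) :
    Continuous (phaseChar k ξ : PhaseN d m → ℂ) :=
  (continuous_planeWave k).mul (Complex.continuous_exp.comp
    (continuous_const.mul (Complex.continuous_ofReal.comp (continuous_linVel ξ))))

/-- The exponential in the velocities is expanded into its power series, each term of which lies in
the span of the Fourier–Hermite functions. Termwise integration is justified by the integrable
majorant `exp |linVel ξ| * ‖f‖`. -/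
lemma integral_phaseChar_mul_eq_zero {f : PhaseN d m → ℂ}
    (hf : MemLp f 2 (phaseMeasureN d m β))
    (h0 : ∀ p : FHIndex' d m, ∫ z, conj (fhFun β p z) * f z ∂phaseMeasureN d m β = 0)
    (k : Fin (m + 1) → Fin d → ℤ) (ξ : Fin (m + 1) × Fin d → ℝ) :
    ∫ z, conj (phaseChar k ξ z) * f z ∂phaseMeasureN d m β = 0 := by
  set μ := phaseMeasureN d m β
  let F : ℕ → PhaseN d m → ℂ := fun n z =>
    ((-Complex.I) ^ n / (n.factorial : ℂ)) *
      (conj (planeWave k z * (linVel ξ z : ℂ) ^ n) * f z)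
  have hterm : ∀ n, ∫ z, F n z ∂μ = 0 := by
    intro n
    simp only [F]
    rw [integral_const_mul, integral_conj_mul_eq_zero_of_mem_fhSpan hf h0
      (planeWave_mul_pow_mem_fhSpan k ξ n), mul_zero]
  have hsum := hasSum_integral_of_dominated_convergence (μ := μ) (F := F)
    (f := fun z => conj (phaseChar k ξ z) * f z)
    (fun n z => |linVel ξ z| ^ n / (n.factorial : ℝ) * ‖f z‖) ?_ ?_ ?_ ?_ ?_
  · rw [← hsum.tsum_eq]
    simp [hterm]
  · intro n
    exact ((integrable_conj_mul (memLp_of_mem_fhSpan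
      (planeWave_mul_pow_mem_fhSpan k ξ n)) hf).const_mul _).aestronglyMeasurable
  · intro n
    refine ae_of_all _ fun z => le_of_eq ?_
    simp only [F]
    rw [norm_mul, norm_mul, norm_div, norm_pow, norm_neg, Complex.norm_I, one_pow, RCLike.norm_conj,
      norm_mul, norm_planeWave, norm_pow, Complex.norm_real, Complex.norm_natCast, Real.norm_eq_abs]
    ring
  · exact ae_of_all _ fun z => (Real.summable_pow_div_factorial _).mul_right _
  · have h1 : ∀ z, ∑' n : ℕ, |linVel ξ z| ^ n / (n.factorial : ℝ) * ‖f z‖ =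
        Real.exp |linVel ξ z| * ‖f z‖ := by
      intro z
      rw [tsum_mul_right, Real.exp_eq_exp_ℝ, NormedSpace.exp_eq_tsum_div]
    simp_rw [h1]
    exact MemLp.integrable_mul (p := 2) (q := 2) (memLp_exp_linVel ξ) hf.norm
  · refine ae_of_all _ fun z => ?_
    have h1 := NormedSpace.expSeries_div_hasSum_exp (-Complex.I * (linVel ξ z : ℂ))
    rw [← Complex.exp_eq_exp_ℂ] at h1
    have h2 := (h1.mul_left (conj (planeWave k z))).mul_right (f z)
    have h3 : conj (phaseChar k ξ z) =
        conj (planeWave k z) * Complex.exp (-Complex.I * (linVel ξ z : ℂ)) := by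
      rw [phaseChar, map_mul, ← Complex.exp_conj]
      simp
    rw [h3]
    refine h2.congr_fun fun n => ?_
    simp only [F, map_mul, map_pow, Complex.conj_ofReal, mul_pow]
    ring

end

/-! ### Completeness of the Fourier–Hermite basis. -/

section

variable {d m : ℕ} {β : ℝ}

/-- Frequencies of the characters of phase space. -/
abbrev Freq (d m : ℕ) : Type := (Fin (m + 1) → Fin d → ℤ) × (Fin (m + 1) × Fin d → ℝ)

lemma planeWave_add (k k' : Fin (m + 1) → Fin d → ℤ) (z : PhaseN d m) :
    planeWave (k + k') z = planeWave k z * planeWave k' z := by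
  simp only [planeWave, Pi.add_apply, UnitAddTorus.mFourier_add, Finset.prod_mul_distrib]

lemma planeWave_neg (k : Fin (m + 1) → Fin d → ℤ) (z : PhaseN d m) :
    planeWave (-k) z = conj (planeWave k z) := by
  simp only [planeWave, Pi.neg_apply, UnitAddTorus.mFourier_neg, map_prod]

lemma linVel_add (ξ ξ' : Fin (m + 1) × Fin d → ℝ) (z : PhaseN d m) :
    linVel (ξ + ξ') z = linVel ξ z + linVel ξ' z := by
  simp only [linVel, Pi.add_apply, add_mul, Finset.sum_add_distrib]

lemma linVel_neg (ξ : Fin (m + 1) × Fin d → ℝ) (z : PhaseN d m) :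
    linVel (-ξ) z = -linVel ξ z := by
  simp only [linVel, Pi.neg_apply, neg_mul, Finset.sum_neg_distrib]

lemma phaseChar_add (a b : Freq d m) (z : PhaseN d m) :
    phaseChar (a + b).1 (a + b).2 z = phaseChar a.1 a.2 z * phaseChar b.1 b.2 z := by
  simp only [phaseChar, Prod.fst_add, Prod.snd_add, planeWave_add, linVel_add]
  push_cast
  rw [mul_add, Complex.exp_add]
  ring

lemma phaseChar_neg (a : Freq d m) (z : PhaseN d m) :
    phaseChar (-a).1 (-a).2 z = conj (phaseChar a.1 a.2 z) := by
  simp only [phaseChar, Prod.fst_neg, Prod.snd_neg, planeWave_neg, linVel_neg, map_mul,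
    ← Complex.exp_conj, Complex.conj_I, Complex.conj_ofReal]
  push_cast
  rw [mul_neg, neg_mul]

lemma norm_phaseChar (a : Freq d m) (z : PhaseN d m) : ‖phaseChar a.1 a.2 z‖ = 1 := by
  rw [phaseChar, norm_mul, norm_planeWave, mul_comm Complex.I, Complex.norm_exp_ofReal_mul_I,
    one_mul]

open BoundedContinuousFunction

/-- The characters of phase space, as bounded continuous functions. -/
def charBCF (a : Freq d m) : PhaseN d m →ᵇ ℂ :=
  BoundedContinuousFunction.ofNormedAddCommGroup (phaseChar a.1 a.2) (continuous_phaseChar _ _) 1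
    fun z => (norm_phaseChar a z).le

lemma charBCF_apply (a : Freq d m) (z : PhaseN d m) : charBCF a z = phaseChar a.1 a.2 z := rfl

lemma charBCF_mul (a b : Freq d m) : charBCF a * charBCF b = charBCF (a + b) := by
  ext z
  simp only [BoundedContinuousFunction.mul_apply, charBCF_apply, phaseChar_add]

lemma star_charBCF (a : Freq d m) : star (charBCF a) = charBCF (-a) := by
  ext z
  simp only [BoundedContinuousFunction.star_apply, charBCF_apply, phaseChar_neg]
  rfl

lemma charBCF_zero : (charBCF (0 : Freq d m)) = 1 := by
  ext z
  simp [charBCF_apply, phaseChar, planeWave, linVel, UnitAddTorus.mFourier_zero]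

/-- The trigonometric polynomials on phase space. -/
def charAlg (d m : ℕ) : StarSubalgebra ℂ (PhaseN d m →ᵇ ℂ) where
  toSubalgebra := (Submodule.span ℂ (Set.range (charBCF : Freq d m → _))).toSubalgebra
    (charBCF_zero (d := d) (m := m) ▸ Submodule.subset_span ⟨0, rfl⟩)
    (by
      intro x y hx hy
      induction hx, hy using Submodule.span_induction₂ with
      | mem_mem x y hx hy =>
        obtain ⟨a, rfl⟩ := hx
        obtain ⟨b, rfl⟩ := hy
        rw [charBCF_mul]
        exact Submodule.subset_span ⟨_, rfl⟩
      | zero_left y hy => rw [zero_mul]; exact Submodule.zero_mem _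
      | zero_right y hy => rw [mul_zero]; exact Submodule.zero_mem _
      | add_left x y z _ _ _ h h' => rw [add_mul]; exact Submodule.add_mem _ h h'
      | add_right x y z _ _ _ h h' => rw [mul_add]; exact Submodule.add_mem _ h h'
      | smul_left r x y _ _ h => rw [smul_mul_assoc]; exact Submodule.smul_mem _ _ h
      | smul_right r x y _ _ h => rw [mul_smul_comm]; exact Submodule.smul_mem _ _ h)
  star_mem' := by
    intro x hx
    change x ∈ Submodule.span ℂ (Set.range (charBCF : Freq d m → _)) at hx
    change star x ∈ Submodule.span ℂ (Set.range (charBCF : Freq d m → _))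
    induction hx using Submodule.span_induction with
    | mem x hx =>
      obtain ⟨a, rfl⟩ := hx
      rw [star_charBCF]
      exact Submodule.subset_span ⟨_, rfl⟩
    | zero => rw [star_zero]; exact Submodule.zero_mem _
    | add x y _ _ h h' => rw [star_add]; exact Submodule.add_mem _ h h'
    | smul c x _ h => rw [star_smul]; exact Submodule.smul_mem _ _ h

lemma mem_charAlg {x : PhaseN d m →ᵇ ℂ} :
    x ∈ charAlg d m ↔ x ∈ Submodule.span ℂ (Set.range (charBCF : Freq d m → _)) := Iff.rfl

lemma exists_phaseChar_ne {z w : PhaseN d m} (h : z ≠ w) :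
    ∃ a : Freq d m, phaseChar a.1 a.2 z ≠ phaseChar a.1 a.2 w := by
  obtain ⟨j, hj⟩ := Function.ne_iff.1 h
  by_cases hx : (z j).1 = (w j).1
  · have hv : (z j).2 ≠ (w j).2 := fun hv => hj (Prod.ext hx hv)
    obtain ⟨i, hi⟩ := Function.ne_iff.1 hv
    -- This frequency makes the phases at the two points differ by `π`, so that the characters have
    -- opposite signs.
    refine ⟨(0, Pi.single (j, i) (Real.pi / ((z j).2 i - (w j).2 i))), fun heq => ?_⟩
    have hlin : ∀ (c : ℝ) (y : PhaseN d m), linVel (Pi.single (j, i) c) y = c * (y j).2 i := by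
      intro c y
      rw [linVel, Finset.sum_eq_single (j, i)]
      · simp [vel]
      · intro e _ he; simp [he]
      · simp
    simp only [phaseChar, hlin, planeWave, Pi.zero_apply, UnitAddTorus.mFourier_zero,
      ContinuousMap.one_apply, Finset.prod_const_one, one_mul] at heq
    have hne : (z j).2 i - (w j).2 i ≠ 0 := sub_ne_zero.2 hi
    have h1 : Complex.exp (Complex.I * ((Real.pi / ((z j).2 i - (w j).2 i) * (z j).2 i : ℝ) : ℂ)) =
        Complex.exp (Real.pi * Complex.I) *
        Complex.exp (Complex.I * ((Real.pi / ((z j).2 i - (w j).2 i) * (w j).2 i : ℝ) : ℂ)) := by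
      rw [← Complex.exp_add]
      congr 1
      have : Real.pi / ((z j).2 i - (w j).2 i) * (z j).2 i =
          Real.pi + Real.pi / ((z j).2 i - (w j).2 i) * (w j).2 i := by
        field_simp
        ring
      rw [this]
      push_cast
      ring
    rw [h1, Complex.exp_pi_mul_I] at heq
    have h2 := Complex.exp_ne_zero
      (Complex.I * ((Real.pi / ((z j).2 i - (w j).2 i) * (w j).2 i : ℝ) : ℂ))
    apply h2
    linear_combination (-1 / 2 : ℂ) * heq
  · obtain ⟨i, hi⟩ := Function.ne_iff.1 hx
    refine ⟨(Pi.single j (Pi.single i 1), 0), fun heq => hi ?_⟩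
    have hw : ∀ y : PhaseN d m, phaseChar (Pi.single j (Pi.single i 1)) 0 y =
        fourier 1 ((y j).1 i) := by
      intro y
      rw [phaseChar, planeWave, Finset.prod_eq_single j]
      · rw [Pi.single_eq_same, UnitAddTorus.mFourier_single]
        simp [linVel]
      · intro j' _ hj'
        rw [Pi.single_eq_of_ne hj', UnitAddTorus.mFourier_zero, ContinuousMap.one_apply]
      · simp
    rw [hw, hw, fourier_one, fourier_one] at heq
    exact AddCircle.injective_toCircle one_ne_zero (Circle.ext heq)

lemma separatesPoints_charAlg :
    ((charAlg d m).map (BoundedContinuousFunction.toContinuousMapStarₐ ℂ)).SeparatesPoints := by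
  intro z w h
  obtain ⟨a, ha⟩ := exists_phaseChar_ne h
  exact ⟨phaseChar a.1 a.2, ⟨toContinuousMapStarₐ ℂ (charBCF a),
    ⟨charBCF a, mem_charAlg.2 (Submodule.subset_span ⟨a, rfl⟩), rfl⟩, rfl⟩, ha⟩

lemma integrable_phaseChar_mul {μ : Measure (PhaseN d m)} {f : PhaseN d m → ℂ}
    (hf : Integrable f μ) (a : Freq d m) :
    Integrable (fun z => phaseChar a.1 a.2 z * f z) μ :=
  hf.bdd_mul (c := 1) (continuous_phaseChar _ _).aestronglyMeasurable
    (ae_of_all _ fun z => (norm_phaseChar a z).le)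

/-- A real integrable function with vanishing Fourier transform vanishes. -/
lemma ae_eq_zero_of_integral_phaseChar_real {μ : Measure (PhaseN d m)} [IsFiniteMeasure μ]
    {g : PhaseN d m → ℝ} (hg : Integrable g μ)
    (h0 : ∀ a : Freq d m, ∫ z, phaseChar a.1 a.2 z * (g z : ℂ) ∂μ = 0) : g =ᵐ[μ] 0 := by
  have hm1 : AEMeasurable (fun z => Real.toNNReal (g z)) μ := hg.1.aemeasurable.real_toNNReal
  have hm2 : AEMeasurable (fun z => Real.toNNReal (-g z)) μ := hg.neg.1.aemeasurable.real_toNNReal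
  have hfin : ∀ {g' : PhaseN d m → ℝ}, Integrable g' μ → ∫⁻ z, (Real.toNNReal (g' z) : ℝ≥0∞) ∂μ ≠ ⊤ := by
    intro g' hg'
    exact ((lintegral_ofReal_le_lintegral_enorm g').trans_lt hg'.2).ne
  have i1 : IsFiniteMeasure (μ.withDensity fun z => (Real.toNNReal (g z) : ℝ≥0∞)) :=
    isFiniteMeasure_withDensity (hfin hg)
  have i2 : IsFiniteMeasure (μ.withDensity fun z => (Real.toNNReal (-g z) : ℝ≥0∞)) :=
    isFiniteMeasure_withDensity (hfin hg.neg)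
  -- The positive and negative parts of `g` are densities of finite measures with the same integrals
  -- against all characters. The trigonometric polynomials form a star algebra separating points,
  -- hence they determine finite measures.
  have hP : (μ.withDensity fun z => (Real.toNNReal (g z) : ℝ≥0∞)) =
      μ.withDensity fun z => (Real.toNNReal (-g z) : ℝ≥0∞) := by
    refine ext_of_forall_mem_subalgebra_integral_eq_of_pseudoEMetric_complete_countable
      separatesPoints_charAlg fun x hx => ?_
    rw [mem_charAlg] at hx
    induction hx using Submodule.span_induction with
    | mem x hx =>
      obtain ⟨a, rfl⟩ := hx
      rw [integral_withDensity_eq_integral_smul₀ hm1, integral_withDensity_eq_integral_smul₀ hm2,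
        ← sub_eq_zero, ← integral_sub]
      · rw [← h0 a]
        refine integral_congr_ae (ae_of_all _ fun z => ?_)
        simp only [NNReal.smul_def, charBCF_apply, Complex.real_smul]
        rw [← sub_mul, ← Complex.ofReal_sub, Real.coe_toNNReal', Real.coe_toNNReal',
          max_zero_sub_eq_self, mul_comm]
      · refine (integrable_phaseChar_mul hg.pos_part.ofReal a).congr (ae_of_all _ fun z => ?_)
        simp only [NNReal.smul_def, charBCF_apply, Complex.real_smul, Real.coe_toNNReal', mul_comm]
        rfl
      · refine (integrable_phaseChar_mul hg.neg_part.ofReal a).congr (ae_of_all _ fun z => ?_)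
        simp only [NNReal.smul_def, charBCF_apply, Complex.real_smul, Real.coe_toNNReal', mul_comm]
        rfl
    | zero => simp
    | add x y _ _ h h' =>
      simp only [BoundedContinuousFunction.add_apply]
      rw [integral_add (x.integrable _) (y.integrable _),
        integral_add (x.integrable _) (y.integrable _), h, h']
    | smul c x _ h =>
      simp only [BoundedContinuousFunction.smul_apply]
      rw [integral_smul, integral_smul, h]
  rw [withDensity_eq_iff hm1.coe_nnreal_ennreal hm2.coe_nnreal_ennreal (hfin hg)] at hP
  filter_upwards [hP] with z hz
  have h1 : Real.toNNReal (g z) = Real.toNNReal (-g z) := by exact_mod_cast hz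
  have h2 := congrArg (fun x : NNReal => (x : ℝ)) h1
  simp only [Real.coe_toNNReal'] at h2
  have := max_zero_sub_eq_self (g z)
  rw [Pi.zero_apply]
  linarith

/-- The set of characters is stable under conjugation, so the hypothesis passes to the real and
imaginary parts. -/
lemma ae_eq_zero_of_integral_phaseChar {μ : Measure (PhaseN d m)} [IsFiniteMeasure μ]
    {f : PhaseN d m → ℂ} (hf : Integrable f μ)
    (h0 : ∀ a : Freq d m, ∫ z, conj (phaseChar a.1 a.2 z) * f z ∂μ = 0) : f =ᵐ[μ] 0 := by
  have h1 : ∀ a : Freq d m, ∫ z, phaseChar a.1 a.2 z * f z ∂μ = 0 := by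
    intro a
    have := h0 (-a)
    simpa only [phaseChar_neg, Complex.conj_conj] using this
  have h2 : ∀ a : Freq d m, ∫ z, phaseChar a.1 a.2 z * conj (f z) ∂μ = 0 := by
    intro a
    have h3 := congrArg conj (h0 a)
    rw [← integral_conj] at h3
    simpa using h3
  have hfc : Integrable (fun z => conj (f z)) μ :=
    Complex.conjCLE.toContinuousLinearMap.integrable_comp hf
  have hre : (fun z => (f z).re) =ᵐ[μ] 0 := by
    refine ae_eq_zero_of_integral_phaseChar_real hf.re fun a => ?_
    have h3 : ∀ z, phaseChar a.1 a.2 z * ((f z).re : ℂ) =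
        (1 / 2 : ℂ) * (phaseChar a.1 a.2 z * f z + phaseChar a.1 a.2 z * conj (f z)) := by
      intro z
      rw [Complex.re_eq_add_conj]; ring
    simp_rw [h3]
    rw [integral_const_mul, integral_add (integrable_phaseChar_mul hf a)
      (integrable_phaseChar_mul hfc a), h1, h2]
    simp
  have him : (fun z => (f z).im) =ᵐ[μ] 0 := by
    refine ae_eq_zero_of_integral_phaseChar_real hf.im fun a => ?_
    have h3 : ∀ z, phaseChar a.1 a.2 z * ((f z).im : ℂ) =
        (1 / (2 * Complex.I) : ℂ) *
          (phaseChar a.1 a.2 z * f z - phaseChar a.1 a.2 z * conj (f z)) := by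
      intro z
      rw [Complex.im_eq_sub_conj]; ring
    simp_rw [h3]
    rw [integral_const_mul, integral_sub (integrable_phaseChar_mul hf a)
      (integrable_phaseChar_mul hfc a), h1, h2]
    simp
  filter_upwards [hre, him] with z hz hz'
  exact Complex.ext hz hz'

variable [hβ : Fact (0 < β)]

lemma fhCoeff_eq_integral_fhFun (G : L2 d m β) (p : FHIndex' d m) :
    fhCoeff G ((indexEquiv d m).symm p) =
      ∫ z, conj (fhFun β p z) * G z ∂phaseMeasureN d m β := rfl

lemma span_fhLp_orthogonal :
    (Submodule.span ℂ (Set.range (fhLp : FHIndex d m → L2 d m β)))ᗮ = ⊥ := by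
  rw [Submodule.eq_bot_iff]
  intro G hG
  have h0 : ∀ p : FHIndex' d m, ∫ z, conj (fhFun β p z) * G z ∂phaseMeasureN d m β = 0 := by
    intro p
    rw [← fhCoeff_eq_integral_fhFun, ← inner_fhLp]
    exact hG _ (Submodule.subset_span ⟨_, rfl⟩)
  have hGm : MemLp G 2 (phaseMeasureN d m β) := Lp.memLp G
  exact Lp.eq_zero_iff_ae_eq_zero.2 (ae_eq_zero_of_integral_phaseChar
    (hGm.integrable (by norm_num)) fun a => integral_phaseChar_mul_eq_zero hGm h0 a.1 a.2)

/-- The Fourier–Hermite Hilbert basis. -/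
def fhHilbertBasis (d m : ℕ) (β : ℝ) [Fact (0 < β)] : HilbertBasis (FHIndex' d m) ℂ (L2 d m β) :=
  HilbertBasis.mkOfOrthogonalEqBot (v := fhLp ∘ (indexEquiv d m).symm)
    (orthonormal_fhLp.comp _ (indexEquiv d m).symm.injective) (by
      rw [(indexEquiv d m).symm.surjective.range_comp, span_fhLp_orthogonal])

lemma fhHilbertBasis_apply (p : FHIndex' d m) :
    fhHilbertBasis d m β p = fhLp ((indexEquiv d m).symm p) := by
  rw [fhHilbertBasis, HilbertBasis.coe_mkOfOrthogonalEqBot, Function.comp_apply]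

lemma fhHilbertBasis_repr (G : L2 d m β) (p : FHIndex' d m) :
    (fhHilbertBasis d m β).repr G p = fhCoeff G ((indexEquiv d m).symm p) := by
  rw [HilbertBasis.repr_apply_apply, fhHilbertBasis_apply, inner_fhLp]

end

/-! ### Translations and derivatives in the position variables. -/

section

variable {d m : ℕ} {β : ℝ}

lemma isOpenQuotientMap_torusCover (d : ℕ) : IsOpenQuotientMap (torusCover d) :=
  IsOpenQuotientMap.piMap (f := fun (_ : Fin d) (y : ℝ) => (y : UnitAddCircle)) fun _ =>
    QuotientAddGroup.isOpenQuotientMap_mk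

/-- Smoothness is defined on the covering space; the quotient property lets continuity descend to
phase space. -/
lemma isOpenQuotientMap_phaseCover (d m : ℕ) : IsOpenQuotientMap (phaseCover d m) :=
  IsOpenQuotientMap.piMap
    (f := fun (_ : Fin (m + 1)) (y : (Fin d → ℝ) × (Fin d → ℝ)) => ((torusCover d y.1, y.2) : Phase d))
    fun _ => (isOpenQuotientMap_torusCover d).prodMap IsOpenQuotientMap.id

/-- Translation of a position coordinate. -/
def shiftX (j : Fin (m + 1)) (i : Fin d) (h : ℝ) (z : PhaseN d m) : PhaseN d m :=
  z + Pi.single j (Pi.single i (h : UnitAddCircle), 0)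

/-- The direction of a position coordinate in the covering space. -/
def dirX (j : Fin (m + 1)) (i : Fin d) : Fin (m + 1) → (Fin d → ℝ) × (Fin d → ℝ) :=
  Pi.single j (Pi.single i 1, 0)

lemma shiftX_apply_self (j : Fin (m + 1)) (i : Fin d) (h : ℝ) (z : PhaseN d m) :
    shiftX j i h z j = ((z j).1 + Pi.single i (h : UnitAddCircle), (z j).2) := by
  ext <;> simp [shiftX]

lemma shiftX_apply_of_ne {j j' : Fin (m + 1)} (hj : j' ≠ j) (i : Fin d) (h : ℝ) (z : PhaseN d m) :
    shiftX j i h z j' = z j' := by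
  simp [shiftX, hj]

lemma shiftX_phaseCover (j : Fin (m + 1)) (i : Fin d) (h : ℝ)
    (y : Fin (m + 1) → (Fin d → ℝ) × (Fin d → ℝ)) :
    shiftX j i h (phaseCover d m y) = phaseCover d m (y + h • dirX j i) := by
  funext j'
  by_cases hj : j' = j
  · subst hj
    rw [shiftX_apply_self]
    refine Prod.ext (funext fun i' => ?_) ?_
    · by_cases hi : i' = i
      · subst hi
        simp [phaseCover, torusCover, dirX]
      · simp [phaseCover, torusCover, dirX, hi]
    · simp [phaseCover, dirX]
  · rw [shiftX_apply_of_ne hj]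
    simp [phaseCover, dirX, hj]

lemma shiftX_add (j : Fin (m + 1)) (i : Fin d) (h h' : ℝ) (z : PhaseN d m) :
    shiftX j i h' (shiftX j i h z) = shiftX j i (h + h') z := by
  obtain ⟨y, rfl⟩ := (isOpenQuotientMap_phaseCover d m).surjective z
  rw [shiftX_phaseCover, shiftX_phaseCover, shiftX_phaseCover, add_smul, add_assoc]

lemma hasDerivAt_shiftX_zero {g : PhaseN d m → ℂ}
    (hg : ContDiff ℝ ∞ fun y => g (phaseCover d m y)) (j : Fin (m + 1)) (i : Fin d)
    (y : Fin (m + 1) → (Fin d → ℝ) × (Fin d → ℝ)) :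
    HasDerivAt (fun h => g (shiftX j i h (phaseCover d m y)))
      (fderiv ℝ (fun y => g (phaseCover d m y)) y (dirX j i)) 0 := by
  simp_rw [shiftX_phaseCover]
  have h1 : HasFDerivAt (fun y => g (phaseCover d m y))
      (fderiv ℝ (fun y => g (phaseCover d m y)) y) (y + (0 : ℝ) • dirX j i) := by
    rw [zero_smul, add_zero]
    exact (hg.differentiable (by simp) y).hasFDerivAt
  have h2 : HasDerivAt (fun h : ℝ => y + h • dirX j i) (dirX j i) 0 := by
    simpa using ((hasDerivAt_id (0 : ℝ)).smul_const (dirX j i)).const_add y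
  exact h1.comp_hasDerivAt 0 h2

lemma derivX_phaseCover {g : PhaseN d m → ℂ}
    (hg : ContDiff ℝ ∞ fun y => g (phaseCover d m y)) (j : Fin (m + 1)) (i : Fin d)
    (y : Fin (m + 1) → (Fin d → ℝ) × (Fin d → ℝ)) :
    derivX j i g (phaseCover d m y) =
      fderiv ℝ (fun y => g (phaseCover d m y)) y (dirX j i) :=
  (hasDerivAt_shiftX_zero hg j i y).deriv

lemma hasDerivAt_shiftX {g : PhaseN d m → ℂ}
    (hg : ContDiff ℝ ∞ fun y => g (phaseCover d m y)) (j : Fin (m + 1)) (i : Fin d)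
    (z : PhaseN d m) (h : ℝ) :
    HasDerivAt (fun h => g (shiftX j i h z)) (derivX j i g (shiftX j i h z)) h := by
  obtain ⟨y, hy⟩ := (isOpenQuotientMap_phaseCover d m).surjective (shiftX j i h z)
  have h1 := hasDerivAt_shiftX_zero hg j i y
  rw [← derivX_phaseCover hg, hy] at h1
  have h2 : (fun t => g (shiftX j i t z)) =
      fun t => (fun s => g (shiftX j i s (shiftX j i h z))) (t - h) := by
    funext t
    simp only [shiftX_add, add_sub_cancel]
  rw [h2]
  refine HasDerivAt.comp_sub_const (f := fun s => g (shiftX j i s (shiftX j i h z))) h h ?_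
  rwa [sub_self]

lemma continuous_of_contDiff_lift {g : PhaseN d m → ℂ}
    (hg : ContDiff ℝ ∞ fun y => g (phaseCover d m y)) : Continuous g :=
  (isOpenQuotientMap_phaseCover d m).isQuotientMap.continuous_iff.2 hg.continuous

lemma continuous_derivX {g : PhaseN d m → ℂ}
    (hg : ContDiff ℝ ∞ fun y => g (phaseCover d m y)) (j : Fin (m + 1)) (i : Fin d) :
    Continuous (derivX j i g) := by
  refine (isOpenQuotientMap_phaseCover d m).isQuotientMap.continuous_iff.2 ?_
  have : derivX j i g ∘ phaseCover d m =
      fun y => fderiv ℝ (fun y => g (phaseCover d m y)) y (dirX j i) :=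
    funext (derivX_phaseCover hg j i)
  rw [this]
  exact (hg.continuous_fderiv (by simp)).clm_apply continuous_const

lemma continuous_shiftX (j : Fin (m + 1)) (i : Fin d) (z : PhaseN d m) :
    Continuous fun h => shiftX j i h z := by
  obtain ⟨y, rfl⟩ := (isOpenQuotientMap_phaseCover d m).surjective z
  simp_rw [shiftX_phaseCover]
  exact (isOpenQuotientMap_phaseCover d m).continuous.comp (by fun_prop)

lemma shiftX_zero (j : Fin (m + 1)) (i : Fin d) (z : PhaseN d m) : shiftX j i 0 z = z := by
  obtain ⟨y, rfl⟩ := (isOpenQuotientMap_phaseCover d m).surjective z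
  rw [shiftX_phaseCover, zero_smul, add_zero]

lemma hasCompactSupport_derivX {g : PhaseN d m → ℂ} (hg : HasCompactSupport g)
    (j : Fin (m + 1)) (i : Fin d) : HasCompactSupport (derivX j i g) := by
  refine HasCompactSupport.of_support_subset_isCompact hg fun z hz => ?_
  by_contra hz'
  apply hz
  have h1 : ∀ᶠ h in 𝓝 (0 : ℝ), g (shiftX j i h z) = 0 := by
    have h2 : Tendsto (fun h => shiftX j i h z) (𝓝 0) (𝓝 z) := by
      simpa [shiftX_zero] using (continuous_shiftX j i z).tendsto 0
    filter_upwards [h2.eventually ((isClosed_tsupport g).isOpen_compl.mem_nhds hz')] with h hh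
    exact image_eq_zero_of_notMem_tsupport hh
  exact (Filter.EventuallyEq.deriv_eq (f := fun _ => (0 : ℂ)) h1).trans (deriv_const _ _)

lemma IsTestFunction.continuous {g : PhaseN d m → ℂ} (hg : IsTestFunction g) : Continuous g :=
  continuous_of_contDiff_lift hg.1

lemma IsTestFunction.exists_bound {g : PhaseN d m → ℂ} (hg : IsTestFunction g) :
    ∃ C, ∀ z, ‖g z‖ ≤ C := hg.2.exists_bound_of_continuous hg.continuous

lemma IsTestFunction.exists_bound_derivX {g : PhaseN d m → ℂ} (hg : IsTestFunction g)
    (j : Fin (m + 1)) (i : Fin d) : ∃ C, ∀ z, ‖derivX j i g z‖ ≤ C :=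
  (hasCompactSupport_derivX hg.2 j i).exists_bound_of_continuous (continuous_derivX hg.1 j i)

variable [hβ : Fact (0 < β)]

lemma measurePreserving_shiftX (j : Fin (m + 1)) (i : Fin d) (h : ℝ) :
    MeasurePreserving (shiftX j i h) (phaseMeasureN d m β) (phaseMeasureN d m β) := by
  have h1 : ∀ j', MeasurePreserving (fun w : Phase d => if j' = j then
      ((w.1 + Pi.single i (h : UnitAddCircle), w.2) : Phase d) else w)
      (phaseMeasure d β) (phaseMeasure d β) := by
    intro j'
    by_cases hj : j' = j
    · simp only [hj, if_true]
      have h2 : MeasurePreserving (fun x : UnitAddTorus (Fin d) =>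
          x + Pi.single i (h : UnitAddCircle)) volume volume := measurePreserving_add_right _ _
      rw [phaseMeasure_eq d hβ.out]
      exact h2.prod (MeasurePreserving.id _)
    · simp only [hj, if_false]
      exact MeasurePreserving.id _
  have h2 := measurePreserving_pi (fun _ : Fin (m + 1) => phaseMeasure d β)
    (fun _ : Fin (m + 1) => phaseMeasure d β) h1
  refine (congrArg (fun T => MeasurePreserving T (phaseMeasureN d m β) (phaseMeasureN d m β)) ?_).mpr h2
  funext z j'
  by_cases hj : j' = j
  · subst hj; rw [shiftX_apply_self]; simp
  · rw [shiftX_apply_of_ne hj]; simp [hj]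

/-- The position frequencies. -/
def freqX (k : Fin (m + 1) → Fin d → ℤ) (e : Fin (m + 1) × Fin d) : ℝ := 2 * Real.pi * k e.1 e.2

lemma mFourier_add_single (k : Fin d → ℤ) (x : UnitAddTorus (Fin d)) (i : Fin d) (h : ℝ) :
    UnitAddTorus.mFourier k (x + Pi.single i (h : UnitAddCircle)) =
      Complex.exp (Complex.I * (2 * Real.pi * k i : ℝ) * h) * UnitAddTorus.mFourier k x := by
  simp only [UnitAddTorus.mFourier, ContinuousMap.coe_mk]
  rw [← Finset.mul_prod_erase _ _ (Finset.mem_univ i),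
    ← Finset.mul_prod_erase Finset.univ _ (Finset.mem_univ i), ← mul_assoc]
  congr 1
  · rw [Pi.add_apply, Pi.single_eq_same, fourier_apply, smul_add, AddCircle.toCircle_add,
      Circle.coe_mul, ← fourier_apply, ← fourier_apply, mul_comm, fourier_coe_apply]
    congr 2
    push_cast
    ring
  · refine Finset.prod_congr rfl fun i' hi' => ?_
    rw [Pi.add_apply, Pi.single_eq_of_ne (Finset.ne_of_mem_erase hi'), add_zero]

lemma vel_shiftX (e : Fin (m + 1) × Fin d) (j : Fin (m + 1)) (i : Fin d) (h : ℝ)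
    (z : PhaseN d m) : vel e (shiftX j i h z) = vel e z := by
  by_cases hj : e.1 = j
  · subst hj; simp [vel, shiftX_apply_self]
  · simp [vel, shiftX_apply_of_ne hj]

lemma fhFun_shiftX (p : FHIndex' d m) (j : Fin (m + 1)) (i : Fin d) (h : ℝ) (z : PhaseN d m) :
    fhFun β p (shiftX j i h z) =
      Complex.exp (Complex.I * freqX p.1 (j, i) * h) * fhFun β p z := by
  rw [fhFun_eq, fhFun_eq, ← mul_assoc]
  simp_rw [vel_shiftX]
  congr 1
  rw [← Finset.mul_prod_erase _ _ (Finset.mem_univ j),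
    ← Finset.mul_prod_erase Finset.univ _ (Finset.mem_univ j), ← mul_assoc]
  congr 1
  · rw [shiftX_apply_self, mFourier_add_single]
    rfl
  · refine Finset.prod_congr rfl fun j' hj' => ?_
    rw [shiftX_apply_of_ne (Finset.ne_of_mem_erase hj')]

lemma memLp_vel_mul_fhFun (e : Fin (m + 1) × Fin d) (p : FHIndex' d m) :
    MemLp (fun z => (vel e z : ℂ) * fhFun β p z) 2 (phaseMeasureN d m β) :=
  memLp_of_mem_fhSpan (vel_mul_mem_fhSpan e (Submodule.subset_span ⟨p, rfl⟩))

/-- Integration by parts on the torus, made through translations. The integral of `w` times a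
translate of `g` is differentiated in the shift. By invariance of the measure the shift can be moved
onto `w`, where it acts by the factor `exp(iξh)`. -/
lemma integral_fhFun_mul_vel_mul_derivX {g : PhaseN d m → ℂ} (hg : IsTestFunction g)
    (e : Fin (m + 1) × Fin d) (p : FHIndex' d m) :
    ∫ z, conj (fhFun β p z) * ((vel e z : ℂ) * derivX e.1 e.2 g z) ∂phaseMeasureN d m β =
      Complex.I * freqX p.1 e *
        ∫ z, conj ((vel e z : ℂ) * fhFun β p z) * g z ∂phaseMeasureN d m β := by
  set μ := phaseMeasureN d m β
  obtain ⟨C, hC⟩ := hg.exists_bound_derivX e.1 e.2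
  have hw : Integrable (fun z => conj ((vel e z : ℂ) * fhFun β p z)) μ :=
    Complex.conjCLE.toContinuousLinearMap.integrable_comp
      ((memLp_vel_mul_fhFun e p).integrable (by norm_num))
  set w : PhaseN d m → ℂ := fun z => conj ((vel e z : ℂ) * fhFun β p z)
  obtain ⟨C₀, hC₀⟩ := hg.exists_bound
  have hcs : ∀ h, Continuous fun z : PhaseN d m => shiftX e.1 e.2 h z := fun h =>
    continuous_id.add continuous_const
  have h1 : HasDerivAt (fun h => ∫ z, w z * g (shiftX e.1 e.2 h z) ∂μ)
      (∫ z, w z * derivX e.1 e.2 g (shiftX e.1 e.2 0 z) ∂μ) 0 := by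
    refine (hasDerivAt_integral_of_dominated_loc_of_deriv_le (μ := μ)
      (F := fun h z => w z * g (shiftX e.1 e.2 h z))
      (F' := fun h z => w z * derivX e.1 e.2 g (shiftX e.1 e.2 h z))
      (bound := fun z => ‖w z‖ * C) (s := Set.univ) Filter.univ_mem ?_ ?_ ?_ ?_ ?_ ?_).2
    · exact Eventually.of_forall fun h => hw.1.mul
        (hg.continuous.comp (hcs h)).aestronglyMeasurable
    · exact hw.mul_bdd (c := C₀) (hg.continuous.comp (hcs 0)).aestronglyMeasurable
        (ae_of_all _ fun z => hC₀ _)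
    · exact hw.1.mul ((continuous_derivX hg.1 _ _).comp (hcs 0)).aestronglyMeasurable
    · refine ae_of_all _ fun z h _ => ?_
      rw [norm_mul]
      gcongr
      exact hC _
    · exact hw.norm.mul_const C
    · exact ae_of_all _ fun z h _ => (hasDerivAt_shiftX hg.1 _ _ z h).const_mul _
  have h2 : ∀ h : ℝ, ∫ z, w z * g (shiftX e.1 e.2 h z) ∂μ =
      Complex.exp (Complex.I * freqX p.1 e * h) * ∫ z, w z * g z ∂μ := by
    intro h
    have hmp := measurePreserving_shiftX (β := β) e.1 e.2 h (m := m)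
    have h3 : ∫ z, w (shiftX e.1 e.2 h z) * g (shiftX e.1 e.2 h z) ∂μ = ∫ z, w z * g z ∂μ := by
      have h4 := integral_map (μ := μ) hmp.measurable.aemeasurable
        (f := fun z => w z * g z) (by
          rw [hmp.map_eq]
          exact hw.1.mul hg.continuous.aestronglyMeasurable)
      rw [hmp.map_eq] at h4
      exact h4.symm
    rw [← h3, ← integral_const_mul]
    refine integral_congr_ae (ae_of_all _ fun z => ?_)
    simp only [w, vel_shiftX, fhFun_shiftX, map_mul, ← Complex.exp_conj, Complex.conj_I,
      Complex.conj_ofReal]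
    have h5 : Complex.exp (Complex.I * freqX p.1 e * h) *
        Complex.exp (-Complex.I * freqX p.1 e * h) = 1 := by
      rw [← Complex.exp_add]; simp
    linear_combination (-((vel e z : ℂ) * conj (fhFun β p z) * g (shiftX e.1 e.2 h z))) * h5
  have h3 : HasDerivAt (fun h => ∫ z, w z * g (shiftX e.1 e.2 h z) ∂μ)
      (Complex.I * freqX p.1 e * ∫ z, w z * g z ∂μ) 0 := by
    simp_rw [h2]
    have h4 : HasDerivAt (fun h : ℝ => Complex.I * freqX p.1 e * (h : ℂ))
        (Complex.I * freqX p.1 e) 0 := by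
      simpa using (Complex.ofRealCLM.hasDerivAt (x := (0 : ℝ))).const_mul (Complex.I * freqX p.1 e)
    have h5 := (h4.cexp).mul_const (∫ z, w z * g z ∂μ)
    simpa using h5
  refine Eq.trans ?_ (h3.unique h1).symm
  refine integral_congr_ae (ae_of_all _ fun z => ?_)
  simp only [w, shiftX_zero, map_mul, Complex.conj_ofReal]
  ring

end

section

variable {d m : ℕ} {β : ℝ}

/-! ### The potential -/

lemma IsW1Infty.nonneg {V : UnitAddTorus (Fin d) → ℝ} {gradV : UnitAddTorus (Fin d) → Fin d → ℝ}
    {K : ℝ} (h : IsW1Infty V gradV K) : 0 ≤ K := by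
  obtain ⟨x, hx⟩ := h.bound.exists
  exact (abs_nonneg _).trans hx

/-- A bounded measurable representative of the gradient of the potential. -/
lemma IsW1Infty.exists_measurable_bounded {V : UnitAddTorus (Fin d) → ℝ}
    {gradV : UnitAddTorus (Fin d) → Fin d → ℝ} {K : ℝ} (h : IsW1Infty V gradV K) :
    ∃ G : UnitAddTorus (Fin d) → Fin d → ℝ, Measurable G ∧ (∀ x i, |G x i| ≤ K) ∧
      gradV =ᵐ[volume] G := by
  have hm := h.aesm_grad.aemeasurable
  have hs : MeasurableSet {x | ∀ i, |hm.mk gradV x i| ≤ K} := by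
    rw [Set.ofPred_forall]
    refine MeasurableSet.iInter fun i => measurableSet_le ?_ measurable_const
    exact continuous_abs.measurable.comp ((measurable_pi_apply i).comp hm.measurable_mk)
  refine ⟨Set.indicator {x | ∀ i, |hm.mk gradV x i| ≤ K} (hm.mk gradV),
    hm.measurable_mk.indicator hs, fun x i => ?_, ?_⟩
  · by_cases hx : x ∈ {x | ∀ i, |hm.mk gradV x i| ≤ K}
    · rw [Set.indicator_of_mem hx]; exact hx i
    · rw [Set.indicator_of_notMem hx]; simpa using h.nonneg
  · filter_upwards [hm.ae_eq_mk, h.bound_grad] with x hx hb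
    rw [Set.indicator_of_mem, hx]
    intro i
    rw [← hx]; exact hb i

lemma IsW1Infty.congr_grad {V : UnitAddTorus (Fin d) → ℝ}
    {gradV G : UnitAddTorus (Fin d) → Fin d → ℝ} {K : ℝ} (h : IsW1Infty V gradV K)
    (hG : gradV =ᵐ[volume] G) : IsW1Infty V G K where
  aesm := h.aesm
  aesm_grad := h.aesm_grad.congr hG
  bound := h.bound
  bound_grad := by
    filter_upwards [h.bound_grad, hG] with x hx hx'
    rw [← hx']; exact hx
  weak_grad := fun φ hφ i => by
    rw [h.weak_grad φ hφ i]
    congr 1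
    refine integral_congr_ae ?_
    filter_upwards [hG] with x hx
    rw [hx]

lemma contDiff_mFourier (k : Fin d → ℤ) : IsSmoothTorus (fun x => UnitAddTorus.mFourier k x) := by
  have h : (fun y : Fin d → ℝ => UnitAddTorus.mFourier k (torusCover d y)) =
      fun y => ∏ i, Complex.exp (2 * Real.pi * Complex.I * k i * (y i : ℂ)) := by
    funext y
    simp only [UnitAddTorus.mFourier, ContinuousMap.coe_mk, torusCover, fourier_coe_apply]
    simp
  rw [IsSmoothTorus, h]
  refine contDiff_prod fun i _ => ContDiff.cexp (contDiff_const.mul ?_)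
  exact Complex.ofRealCLM.contDiff.comp (contDiff_apply ℝ ℝ i)

lemma torusDeriv_mFourier (k : Fin d → ℤ) (i : Fin d) (x : UnitAddTorus (Fin d)) :
    torusDeriv i (fun x => UnitAddTorus.mFourier k x) x =
      Complex.I * (2 * Real.pi * k i : ℝ) * UnitAddTorus.mFourier k x := by
  rw [torusDeriv]
  simp_rw [mFourier_add_single]
  have h4 : HasDerivAt (fun h : ℝ => Complex.I * (2 * Real.pi * k i : ℝ) * (h : ℂ))
      (Complex.I * (2 * Real.pi * k i : ℝ)) 0 := by
    simpa using (Complex.ofRealCLM.hasDerivAt (x := (0 : ℝ))).const_mul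
      (Complex.I * (2 * Real.pi * k i : ℝ))
  simpa using ((h4.cexp).mul_const (UnitAddTorus.mFourier k x)).deriv

/-- The Fourier coefficients of the gradient of the potential. -/
lemma IsW1Infty.fourierCoeff_grad {V : UnitAddTorus (Fin d) → ℝ}
    {gradV : UnitAddTorus (Fin d) → Fin d → ℝ} {K : ℝ} (h : IsW1Infty V gradV K)
    (k : Fin d → ℤ) (i : Fin d) :
    ∫ x, conj (UnitAddTorus.mFourier k x) * (gradV x i : ℂ) =
      Complex.I * (2 * Real.pi * k i : ℝ) * fourierCoeffV V k := by
  -- The frequency `-k` gives the conjugate of the character with frequency `k`.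
  have h1 := h.weak_grad _ (contDiff_mFourier (-k)) i
  simp_rw [torusDeriv_mFourier, UnitAddTorus.mFourier_neg] at h1
  have h2 : ∀ x, (gradV x i : ℂ) * conj (UnitAddTorus.mFourier k x) =
    conj (UnitAddTorus.mFourier k x) * (gradV x i : ℂ) := fun x => mul_comm _ _
  simp_rw [h2] at h1
  rw [← neg_eq_iff_eq_neg.2 h1, fourierCoeffV, ← integral_const_mul, ← integral_neg]
  refine integral_congr_ae (ae_of_all _ fun x => ?_)
  simp only [Pi.neg_apply]
  push_cast
  ring

lemma IsW1Infty.fourierCoeffV_re_le {V : UnitAddTorus (Fin d) → ℝ}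
    {gradV : UnitAddTorus (Fin d) → Fin d → ℝ} {K : ℝ} (h : IsW1Infty V gradV K)
    (k : Fin d → ℤ) : (fourierCoeffV V k).re ≤ K := by
  refine (Complex.re_le_norm _).trans ?_
  have := norm_integral_le_of_norm_le_const (μ := (volume : Measure (UnitAddTorus (Fin d))))
    (f := fun x => conj (UnitAddTorus.mFourier k x) * (V x : ℂ)) (C := K) (by
      filter_upwards [h.bound] with x hx
      rw [norm_mul, RCLike.norm_conj, norm_mFourier_apply, one_mul, Complex.norm_real]
      exact hx)
  simpa [fourierCoeffV] using this

/-! ### The convolution term -/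

/-- The convolution with a component of the gradient of the potential in one particle. -/
def convTerm (β : ℝ) (gradV : UnitAddTorus (Fin d) → Fin d → ℝ) (j : Fin (m + 1)) (i : Fin d)
    (g : PhaseN d m → ℂ) (z : PhaseN d m) : ℂ :=
  ∫ w, (gradV ((z j).1 - w.1) i : ℂ) * g (Function.update z j w) ∂(phaseMeasure d β)

variable [hβ : Fact (0 < β)]

/-- The reflected translation `w ↦ x_j - w` pulls null sets back to null sets. The gradient may thus
be replaced by a representative that is measurable and bounded everywhere. -/
lemma convTerm_congr {gradV G : UnitAddTorus (Fin d) → Fin d → ℝ} (h : gradV =ᵐ[volume] G)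
    (j : Fin (m + 1)) (i : Fin d) (g : PhaseN d m → ℂ) :
    convTerm β gradV j i g = convTerm β G j i g := by
  funext z
  refine integral_congr_ae ?_
  have h1 : Measure.QuasiMeasurePreserving (fun w : Phase d => (z j).1 - w.1)
      (phaseMeasure d β) volume := by
    rw [phaseMeasure_eq d hβ.out]
    exact (quasiMeasurePreserving_sub_left_of_right_invariant volume (z j).1).comp
      measurePreserving_fst.quasiMeasurePreserving
  filter_upwards [h1.ae_eq_comp h] with w hw
  have hw' : gradV ((z j).1 - w.1) = G ((z j).1 - w.1) := hw
  rw [hw']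

lemma iL_congr {gradV G : UnitAddTorus (Fin d) → Fin d → ℝ} (h : gradV =ᵐ[volume] G) (N : ℕ)
    (g : PhaseN d m → ℂ) : iL N β gradV g = iL N β G g := by
  funext z
  rw [iL, iL]
  refine Finset.sum_congr rfl fun j _ => ?_
  rw [iLj, iLj]
  have := fun i => congrFun (convTerm_congr (β := β) h j i g) z
  simp only [convTerm] at this
  simp_rw [this]

/-- Exchange of one particle with an additional one. -/
def swapAt (j : Fin (m + 1)) (y : PhaseN d m × Phase d) : PhaseN d m × Phase d :=
  (Function.update y.1 j y.2, y.1 j)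

/-- This exchange turns the integrated particle `z_*` into an argument of `g`, and so moves the
convolution from `g` onto the basis function. -/
lemma measurePreserving_swapAt (j : Fin (m + 1)) :
    MeasurePreserving (swapAt j) ((phaseMeasureN d m β).prod (phaseMeasure d β))
      ((phaseMeasureN d m β).prod (phaseMeasure d β)) := by
  set ν := phaseMeasure d β
  have he := measurePreserving_piFinSuccAbove (fun _ : Fin (m + 1) => ν) j
  set ρ : Measure (Fin m → Phase d) := Measure.pi fun _ => ν
  have hmid : MeasurePreserving
      (fun y : (Phase d × (Fin m → Phase d)) × Phase d => ((y.2, y.1.2), y.1.1))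
      ((ν.prod ρ).prod ν) ((ν.prod ρ).prod ν) := by
    have s1 : MeasurePreserving (Prod.swap : (Phase d × (Fin m → Phase d)) × Phase d → _)
      ((ν.prod ρ).prod ν) (ν.prod (ν.prod ρ)) := Measure.measurePreserving_swap
    have s2 : MeasurePreserving (Prod.map id Prod.swap :
      Phase d × (Phase d × (Fin m → Phase d)) → _)
      (ν.prod (ν.prod ρ)) (ν.prod (ρ.prod ν)) :=
      (MeasurePreserving.id ν).prod Measure.measurePreserving_swap
    have s3 := (measurePreserving_prodAssoc ν ρ ν).symm
    exact (s3.comp s2).comp s1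
  refine (congrArg (fun T => MeasurePreserving T ((phaseMeasureN d m β).prod ν)
    ((phaseMeasureN d m β).prod ν)) (funext fun y => ?_)).mpr
    (((he.symm.prod (MeasurePreserving.id ν)).comp hmid).comp (he.prod (MeasurePreserving.id ν)))
  exact Prod.ext (Fin.insertNth_removeNth (α := fun _ => Phase d) j y.2 y.1).symm rfl

end

/-! ### Fourier–Hermite coefficients of the convolution term. -/

section

variable {d m : ℕ} {β : ℝ} [hβ : Fact (0 < β)]

lemma integral_conj_mFourier_mul_sub {V : UnitAddTorus (Fin d) → ℝ}
    {gradV : UnitAddTorus (Fin d) → Fin d → ℝ} {K : ℝ} (h : IsW1Infty V gradV K)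
    (k : Fin d → ℤ) (i : Fin d) (x : UnitAddTorus (Fin d)) :
    ∫ y, conj (UnitAddTorus.mFourier k y) * (gradV (y - x) i : ℂ) =
      conj (UnitAddTorus.mFourier k x) *
        (Complex.I * (2 * Real.pi * k i : ℝ) * fourierCoeffV V k) := by
  rw [← h.fourierCoeff_grad, ← integral_const_mul]
  have h0 := integral_sub_right_eq_self (μ := (volume : Measure (UnitAddTorus (Fin d))))
    (fun y => conj (UnitAddTorus.mFourier k x) *
      (conj (UnitAddTorus.mFourier k y) * (gradV y i : ℂ))) x
  rw [← h0]
  refine integral_congr_ae (ae_of_all _ fun y => ?_)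
  have h1 : UnitAddTorus.mFourier k (y - x) =
      conj (UnitAddTorus.mFourier k x) * UnitAddTorus.mFourier k y := by
    simp only [UnitAddTorus.mFourier, ContinuousMap.coe_mk, map_prod, ← Finset.prod_mul_distrib]
    refine Finset.prod_congr rfl fun i _ => ?_
    rw [Pi.sub_apply, sub_eq_add_neg, fourier_apply, smul_add, AddCircle.toCircle_add,
      Circle.coe_mul, mul_comm, smul_neg, ← neg_smul, ← fourier_apply, ← fourier_apply, fourier_neg]
  have h2 : UnitAddTorus.mFourier k x * conj (UnitAddTorus.mFourier k x) = 1 := by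
    rw [Complex.mul_conj, Complex.normSq_eq_norm_sq, norm_mFourier_apply]; simp
  simp only [h1, map_mul, Complex.conj_conj]
  linear_combination (-(conj (UnitAddTorus.mFourier k y) * (gradV (y - x) i : ℂ))) * h2

/-- The coordinate `v_i` is `1/√β` times a Hermite function of degree one, so orthonormality
applies. -/
lemma integral_prod_hermiteFun_mul_coord (n : Fin d → ℕ) (i : Fin d) :
    ∫ v : Fin d → ℝ, (∏ i', (hermiteFun β (n i') (v i') : ℂ)) * (v i : ℂ)
      ∂Measure.pi (fun _ => gaussianV β) = if n = Pi.single i 1 then ((1 / √β : ℝ) : ℂ) else 0 := by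
  have hb : (√β : ℝ) ≠ 0 := (Real.sqrt_pos.2 hβ.out).ne'
  have h1 : ∀ v : Fin d → ℝ, (∏ i', (hermiteFun β (n i') (v i') : ℂ)) * (v i : ℂ) =
      ((1 / √β : ℝ) : ℂ) * ∏ i', ((hermiteFun β (n i') (v i') *
        hermiteFun β ((Pi.single i 1 : Fin d → ℕ) i') (v i') : ℝ) : ℂ) := by
    intro v
    have h2 : ∏ i', hermiteFun β ((Pi.single i 1 : Fin d → ℕ) i') (v i') = √β * v i := by
      rw [Finset.prod_eq_single i]
      · simp [hermiteFun]
      · intro i' _ hi'; rw [Pi.single_eq_of_ne hi', hermiteFun_zero]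
      · simp
    rw [← Complex.ofReal_prod, ← Complex.ofReal_prod, Finset.prod_mul_distrib, h2]
    rw [← Complex.ofReal_mul, ← Complex.ofReal_mul]
    congr 1
    field_simp
  simp_rw [h1]
  rw [integral_const_mul, integral_fintype_prod_eq_prod
    (fun i' v => ((hermiteFun β (n i') v * hermiteFun β ((Pi.single i 1 : Fin d → ℕ) i') v : ℝ) : ℂ))]
  simp_rw [integral_complex_ofReal, integral_hermiteFun_mul hβ.out]
  by_cases h : n = Pi.single i 1
  · simp [h]
  · rw [if_neg h]
    obtain ⟨i', hi'⟩ := Function.ne_iff.1 h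
    rw [Finset.prod_eq_zero (Finset.mem_univ i'), mul_zero]
    simp [hi']

lemma integral_conj_phaseBasis_mul_grad {V : UnitAddTorus (Fin d) → ℝ}
    {gradV : UnitAddTorus (Fin d) → Fin d → ℝ} {K : ℝ} (h : IsW1Infty V gradV K)
    (k : Fin d → ℤ) (n : Fin d → ℕ) (i : Fin d) (x : UnitAddTorus (Fin d)) :
    ∫ w, conj (phaseBasis β k n w) * ((w.2 i : ℂ) * (gradV (w.1 - x) i : ℂ)) ∂phaseMeasure d β =
      if n = Pi.single i 1 then conj (UnitAddTorus.mFourier k x) *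
        (Complex.I * (2 * Real.pi * k i / √β : ℝ) * fourierCoeffV V k) else 0 := by
  have h1 : ∀ w : Phase d, conj (phaseBasis β k n w) * ((w.2 i : ℂ) * (gradV (w.1 - x) i : ℂ)) =
      (conj (UnitAddTorus.mFourier k w.1) * (gradV (w.1 - x) i : ℂ)) *
      ((∏ i', (hermiteFun β (n i') (w.2 i') : ℂ)) * (w.2 i : ℂ)) := by
    intro w
    simp only [phaseBasis, map_mul, map_prod, Complex.conj_ofReal]
    ring
  simp_rw [h1]
  rw [phaseMeasure_eq d hβ.out, integral_prod_mul
    (fun y => conj (UnitAddTorus.mFourier k y) * (gradV (y - x) i : ℂ))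
    (fun v : Fin d → ℝ => (∏ i', (hermiteFun β (n i') (v i') : ℂ)) * (v i : ℂ)),
    integral_conj_mFourier_mul_sub h, integral_prod_hermiteFun_mul_coord]
  split_ifs
  · push_cast; ring
  · simp

lemma fhFun_update (p : FHIndex' d m) (j : Fin (m + 1)) (z : PhaseN d m) (w : Phase d) :
    fhFun β p (Function.update z j w) =
      phaseBasis β (p.1 j) (fun i => p.2 (j, i)) w *
        ∏ j' ∈ Finset.univ.erase j, phaseBasis β (p.1 j') (fun i => p.2 (j', i)) (z j') := by
  have h1 : fhFun β p (Function.update z j w) =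
      ∏ j', phaseBasis β (p.1 j') (fun i => p.2 (j', i)) (Function.update z j w j') := rfl
  rw [h1, ← Finset.mul_prod_erase _ _ (Finset.mem_univ j), Function.update_self]
  congr 1
  refine Finset.prod_congr rfl fun j' hj' => ?_
  rw [Function.update_of_ne (Finset.ne_of_mem_erase hj')]

open Classical in
/-- The coefficients of the convolution term in the Fourier–Hermite basis. -/
def convCoeff (β : ℝ) (V : UnitAddTorus (Fin d) → ℝ) (e : Fin (m + 1) × Fin d)
    (q : FHIndex' d m) : ℝ :=
  if ∀ i, q.2 (e.1, i) = 0 then freqX q.1 e / √β * (fourierCoeffV V (q.1 e.1)).re else 0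

/-- The factor `v_i` sees only the Hermite degree one in direction `i` within the slot `j`.
Integrating out that slot leaves a plane wave of Hermite degree zero there. The term therefore acts
only along the edge out of the ground state of block `j`. -/
lemma integral_conj_fhFun_update_mul_grad {V : UnitAddTorus (Fin d) → ℝ}
    {gradV : UnitAddTorus (Fin d) → Fin d → ℝ} {K : ℝ} (h : IsW1Infty V gradV K)
    (hV : FourierNonneg V) (e : Fin (m + 1) × Fin d) (p : FHIndex' d m) (z : PhaseN d m) :
    ∫ w, conj (fhFun β p (Function.update z e.1 w)) *
        ((w.2 e.2 : ℂ) * (gradV (w.1 - (z e.1).1) e.2 : ℂ)) ∂phaseMeasure d β =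
      Complex.I * raise e (convCoeff β V e) (fun q => conj (fhFun β q z)) p := by
  obtain ⟨j, i⟩ := e
  simp only [fhFun_update, map_mul]
  have h1 : ∀ (a b c : ℂ), a * b * c = b * (a * c) := fun a b c => by ring
  simp_rw [h1]
  rw [integral_const_mul, integral_conj_phaseBasis_mul_grad h]
  obtain ⟨r, hr⟩ : ∃ r : (Fin d → ℤ) → ℝ, ∀ k, fourierCoeffV V k = (r k : ℂ) :=
    ⟨fun k => (fourierCoeffV V k).re, fun k => Complex.ext rfl (hV k).2⟩
  by_cases hp : p.2 (j, i) = 0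
  · rw [raise_of_eq_zero hp, if_neg]
    · simp
    · intro hc
      have := congrFun hc i
      simp [hp] at this
  · obtain ⟨q, rfl⟩ := exists_up_eq hp
    rw [raise_up, convCoeff]
    have hiff : (fun i' => (up (j, i) q).2 (j, i')) = Pi.single i 1 ↔ ∀ i', q.2 (j, i') = 0 := by
      rw [funext_iff]
      refine forall_congr' fun i' => ?_
      by_cases hi : i' = i
      · subst hi; simp [up_snd_self]
      · rw [up_snd_ne (by simpa using hi), Pi.single_eq_of_ne hi]
    by_cases hc : ∀ i', q.2 (j, i') = 0
    · rw [if_pos (hiff.2 hc), if_pos hc]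
      have h2 : fhFun β q z = UnitAddTorus.mFourier (q.1 j) (z j).1 *
          ∏ j' ∈ Finset.univ.erase j, phaseBasis β (q.1 j') (fun i => q.2 (j', i)) (z j') := by
        have := fhFun_update (β := β) q j z (z j)
        rw [Function.update_eq_self] at this
        rw [this]
        congr 1
        simp [phaseBasis, hc, hermiteFun_zero]
      have h3 : ∏ j' ∈ Finset.univ.erase j,
            phaseBasis β ((up (j, i) q).1 j') (fun i' => (up (j, i) q).2 (j', i')) (z j') =
          ∏ j' ∈ Finset.univ.erase j, phaseBasis β (q.1 j') (fun i => q.2 (j', i)) (z j') := by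
        refine Finset.prod_congr rfl fun j' hj' => ?_
        have h4 : (fun i' => (up (j, i) q).2 (j', i')) = fun i' => q.2 (j', i') :=
          funext fun i' => up_snd_ne (by simp [Finset.ne_of_mem_erase hj']) q
        rw [h4]
        rfl
      have h5 : (up (j, i) q).1 = q.1 := rfl
      rw [h3, h2, h5, hr, Complex.ofReal_re, map_mul, freqX]
      push_cast
      ring
    · rw [if_neg (fun h' => hc (hiff.1 h')), if_neg hc]
      simp

lemma integrable_conj_fhFun_mul_vel (e : Fin (m + 1) × Fin d) (p : FHIndex' d m) :
    Integrable (fun z => conj (fhFun β p z) * (vel e z : ℂ)) (phaseMeasureN d m β) := by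
  refine (Complex.conjCLE.toContinuousLinearMap.integrable_comp
      ((memLp_vel_mul_fhFun (β := β) e p).integrable (by norm_num))).congr
    (ae_of_all _ fun z => ?_)
  simp [mul_comm]

lemma integral_conj_raise_mul (e : Fin (m + 1) × Fin d) (c : FHIndex' d m → ℝ)
    (g : PhaseN d m → ℂ) (p : FHIndex' d m) :
    ∫ z, raise e c (fun q => conj (fhFun β q z)) p * g z ∂phaseMeasureN d m β =
      raise e c (fun q => ∫ z, conj (fhFun β q z) * g z ∂phaseMeasureN d m β) p := by
  by_cases hp : p.2 e = 0
  · rw [raise_of_eq_zero hp]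
    simp_rw [raise_of_eq_zero hp]
    simp
  · obtain ⟨q, rfl⟩ := exists_up_eq hp
    simp_rw [raise_up, mul_assoc]
    rw [integral_const_mul]

lemma measurable_grad_sub {gradV : UnitAddTorus (Fin d) → Fin d → ℝ} (hm : Measurable gradV)
    (e : Fin (m + 1) × Fin d) :
    Measurable fun y : PhaseN d m × Phase d => (gradV ((y.1 e.1).1 - y.2.1) e.2 : ℂ) := by
  have h1 : Continuous fun y : PhaseN d m × Phase d => (y.1 e.1).1 - y.2.1 := by
    have h2 : Continuous fun y : PhaseN d m × Phase d => y.1 e.1 :=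
      (continuous_apply e.1).comp continuous_fst
    exact (continuous_fst.comp h2).sub (continuous_fst.comp continuous_snd)
  exact Complex.measurable_ofReal.comp ((measurable_pi_apply e.2).comp (hm.comp h1.measurable))

/-- The kernel of the convolution term tested against a Fourier–Hermite function. -/
def convKernel (β : ℝ) (gradV : UnitAddTorus (Fin d) → Fin d → ℝ) (g : PhaseN d m → ℂ)
    (e : Fin (m + 1) × Fin d) (p : FHIndex' d m) (y : PhaseN d m × Phase d) : ℂ :=
  (conj (fhFun β p y.1) * (vel e y.1 : ℂ)) *
    ((gradV ((y.1 e.1).1 - y.2.1) e.2 : ℂ) * g (Function.update y.1 e.1 y.2))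

lemma integrable_convKernel {gradV : UnitAddTorus (Fin d) → Fin d → ℝ} {K : ℝ}
    (hm : Measurable gradV) (hb : ∀ x i, |gradV x i| ≤ K)
    {g : PhaseN d m → ℂ} (hg : Continuous g) {C : ℝ} (hC : ∀ z, ‖g z‖ ≤ C)
    (e : Fin (m + 1) × Fin d) (p : FHIndex' d m) :
    Integrable (convKernel β gradV g e p) ((phaseMeasureN d m β).prod (phaseMeasure d β)) := by
  have hupd : Continuous fun y : PhaseN d m × Phase d => Function.update y.1 e.1 y.2 :=
    continuous_fst.update e.1 continuous_snd
  have h1 : Integrable (fun y : PhaseN d m × Phase d =>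
      conj (fhFun β p y.1) * (vel e y.1 : ℂ))
      ((phaseMeasureN d m β).prod (phaseMeasure d β)) :=
    (integrable_conj_fhFun_mul_vel e p).comp_fst _
  refine h1.mul_bdd (c := K * C) ?_ (ae_of_all _ fun y => ?_)
  · exact ((measurable_grad_sub hm e).mul (hg.comp hupd).measurable).aestronglyMeasurable
  · rw [norm_mul, Complex.norm_real]
    exact mul_le_mul (hb _ _) (hC _) (norm_nonneg _) ((abs_nonneg _).trans (hb 0 e.2))

lemma integral_convKernel_right (gradV : UnitAddTorus (Fin d) → Fin d → ℝ) (g : PhaseN d m → ℂ)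
    (e : Fin (m + 1) × Fin d) (p : FHIndex' d m) (z : PhaseN d m) :
    ∫ w, convKernel β gradV g e p (z, w) ∂phaseMeasure d β =
      conj (fhFun β p z) * ((vel e z : ℂ) * convTerm β gradV e.1 e.2 g z) := by
  simp only [convKernel, convTerm]
  rw [integral_const_mul, mul_assoc]

/-- Fubini's theorem after exchanging the particle `z_j` with the integrated one. -/
lemma integral_fhFun_mul_vel_mul_convTerm {V : UnitAddTorus (Fin d) → ℝ}
    {gradV : UnitAddTorus (Fin d) → Fin d → ℝ} {K : ℝ} (h : IsW1Infty V gradV K)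
    (hV : FourierNonneg V) (hm : Measurable gradV) (hb : ∀ x i, |gradV x i| ≤ K)
    {g : PhaseN d m → ℂ} (hg : Continuous g) {C : ℝ} (hC : ∀ z, ‖g z‖ ≤ C)
    (e : Fin (m + 1) × Fin d) (p : FHIndex' d m) :
    ∫ z, conj (fhFun β p z) * ((vel e z : ℂ) * convTerm β gradV e.1 e.2 g z)
        ∂phaseMeasureN d m β =
      Complex.I * raise e (convCoeff β V e)
        (fun q => ∫ z, conj (fhFun β q z) * g z ∂phaseMeasureN d m β) p := by
  set μ := phaseMeasureN d m β
  set ν := phaseMeasure d β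
  have hF : Integrable (convKernel β gradV g e p) (μ.prod ν) :=
    integrable_convKernel hm hb hg hC e p
  have hmp := measurePreserving_swapAt (β := β) (d := d) e.1
  have hs : ∫ y, convKernel β gradV g e p y ∂μ.prod ν =
      ∫ y, convKernel β gradV g e p (swapAt e.1 y) ∂μ.prod ν := by
    have h1 := integral_map (μ := μ.prod ν) hmp.measurable.aemeasurable
      (f := convKernel β gradV g e p) (by rw [hmp.map_eq]; exact hF.1)
    rwa [hmp.map_eq] at h1
  have hFs : Integrable (fun y => convKernel β gradV g e p (swapAt e.1 y)) (μ.prod ν) :=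
    (hmp.integrable_comp hF.1).2 hF
  simp_rw [← integral_convKernel_right]
  rw [← integral_prod _ hF, hs, integral_prod _ hFs, ← integral_conj_raise_mul,
    ← integral_const_mul]
  refine integral_congr_ae (ae_of_all _ fun z => ?_)
  simp only
  rw [← mul_assoc, ← integral_conj_fhFun_update_mul_grad h hV, ← integral_mul_const]
  refine integral_congr_ae (ae_of_all _ fun w => ?_)
  simp only [convKernel, swapAt, Function.update_self, Function.update_idem,
    Function.update_eq_self, vel]
  ring

end

/-! ### The matrix of the linearized Vlasov operator. -/

section

variable {d m : ℕ} {β : ℝ}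

/-- The strength of the mean-field coupling in each particle. -/
def coupling (m N : ℕ) (β : ℝ) (j : Fin (m + 1)) : ℝ :=
  if j = 0 then 0 else ((N : ℝ) + 1 - m) / N * β

/-- The coupling coefficients of the linearized Vlasov operator in the Fourier–Hermite basis. -/
def fourierCoupling (m N : ℕ) (β : ℝ) (V : UnitAddTorus (Fin d) → ℝ)
    (k : Fin (m + 1) → Fin d → ℤ) (j : Fin (m + 1)) : ℝ :=
  coupling m N β j * (fourierCoeffV V (k j)).re

lemma coupling_nonneg {N : ℕ} (hN : m ≤ N) (hβ : 0 ≤ β) (j : Fin (m + 1)) :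
    0 ≤ coupling m N β j := by
  rw [coupling]
  split_ifs
  · exact le_rfl
  · have : (m : ℝ) ≤ N := by exact_mod_cast hN
    have : (0 : ℝ) ≤ (N : ℝ) + 1 - m := by linarith
    positivity

/-- A label `j ≠ 0` exists only for `m ≥ 1`. Then `N ≥ 1` and the fraction is at most one. -/
lemma coupling_le {N : ℕ} (hN : m ≤ N) (hβ : 0 ≤ β) (j : Fin (m + 1)) :
    coupling m N β j ≤ β := by
  rw [coupling]
  split_ifs with hj
  · exact hβ
  · have hm1 : 1 ≤ m := by
      by_contra hm
      have : m = 0 := by omega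
      subst this
      exact hj (Fin.ext (by omega))
    have h1 : (1 : ℝ) ≤ m := by exact_mod_cast hm1
    have h2 : (m : ℝ) ≤ N := by exact_mod_cast hN
    have h3 : ((N : ℝ) + 1 - m) / N ≤ 1 := by
      rw [div_le_one (by linarith)]; linarith
    nlinarith

lemma iL_eq_sum (N : ℕ) (gradV : UnitAddTorus (Fin d) → Fin d → ℝ) (g : PhaseN d m → ℂ)
    (z : PhaseN d m) :
    iL N β gradV g z = ∑ e : Fin (m + 1) × Fin d, ((vel e z : ℂ) * derivX e.1 e.2 g z +
      (coupling m N β e.1 : ℂ) * ((vel e z : ℂ) * convTerm β gradV e.1 e.2 g z)) := by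
  rw [iL, Fintype.sum_prod_type]
  refine Finset.sum_congr rfl fun j _ => ?_
  simp only
  rw [iLj, Finset.sum_add_distrib, ← Finset.mul_sum, coupling]
  by_cases hj : j = 0
  · simp [hj, vel]
  · simp only [hj, if_false]
    rfl

variable [hβ : Fact (0 < β)]

lemma integral_conj_vel_mul_fhFun_mul {g : PhaseN d m → ℂ}
    (hg : ∀ q : FHIndex' d m, Integrable (fun z => conj (fhFun β q z) * g z) (phaseMeasureN d m β))
    (e : Fin (m + 1) × Fin d) (p : FHIndex' d m) :
    ∫ z, conj ((vel e z : ℂ) * fhFun β p z) * g z ∂phaseMeasureN d m β =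
      lower e (velCoeff β e) (fun q => ∫ z, conj (fhFun β q z) * g z ∂phaseMeasureN d m β) p +
      raise e (velCoeff β e) (fun q => ∫ z, conj (fhFun β q z) * g z ∂phaseMeasureN d m β) p := by
  simp_rw [vel_mul_fhFun]
  by_cases hp : p.2 e = 0
  · simp_rw [raise_of_eq_zero hp, lower, add_zero, map_mul, Complex.conj_ofReal, mul_assoc]
    rw [integral_const_mul]
  · obtain ⟨q, rfl⟩ := exists_up_eq hp
    simp_rw [raise_up, lower, map_add, map_mul, Complex.conj_ofReal, add_mul, mul_assoc]
    rw [integral_add ((hg _).const_mul _) ((hg _).const_mul _), integral_const_mul,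
      integral_const_mul]

lemma integral_conj_fhFun_mul_iL {V : UnitAddTorus (Fin d) → ℝ}
    {gradV : UnitAddTorus (Fin d) → Fin d → ℝ} {K : ℝ} (h : IsW1Infty V gradV K)
    (hV : FourierNonneg V) (hm : Measurable gradV) (hb : ∀ x i, |gradV x i| ≤ K)
    {N : ℕ} (hN : m ≤ N) {g : PhaseN d m → ℂ} (hg : IsTestFunction g) (p : FHIndex' d m) :
    ∫ z, conj (fhFun β p z) * iL N β gradV g z ∂phaseMeasureN d m β =
      vlasovMatrix β freqX Prod.fst (fourierCoupling m N β V)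
        (fun q => ∫ z, conj (fhFun β q z) * g z ∂phaseMeasureN d m β) p := by
  set μ := phaseMeasureN d m β
  obtain ⟨C, hC⟩ := hg.exists_bound
  have hint1 : ∀ e : Fin (m + 1) × Fin d, Integrable
      (fun z => conj (fhFun β p z) * ((vel e z : ℂ) * derivX e.1 e.2 g z)) μ := by
    intro e
    obtain ⟨C', hC'⟩ := hg.exists_bound_derivX e.1 e.2
    refine ((integrable_conj_fhFun_mul_vel (β := β) e p).mul_bdd (c := C')
      (continuous_derivX hg.1 e.1 e.2).aestronglyMeasurable (ae_of_all _ hC')).congr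
      (ae_of_all _ fun z => mul_assoc _ _ _)
  have hint2 : ∀ e : Fin (m + 1) × Fin d, Integrable
      (fun z => conj (fhFun β p z) * ((vel e z : ℂ) * convTerm β gradV e.1 e.2 g z)) μ := by
    intro e
    refine (integrable_convKernel (β := β) hm hb hg.continuous hC e p).integral_prod_left.congr
      (ae_of_all _ fun z => integral_convKernel_right _ _ _ _ _)
  have hgi : ∀ q : FHIndex' d m, Integrable (fun z => conj (fhFun β q z) * g z) μ := by
    intro q
    have h1 := (memLp_fhFun (β := β) q).integrable (by norm_num)
    exact (Complex.conjCLE.toContinuousLinearMap.integrable_comp h1).mul_bdd (c := C)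
      hg.continuous.aestronglyMeasurable (ae_of_all _ hC)
  set c : FHIndex' d m → ℂ := fun q => ∫ z, conj (fhFun β q z) * g z ∂μ
  have hsum : ∫ z, conj (fhFun β p z) * iL N β gradV g z ∂μ =
      ∑ e : Fin (m + 1) × Fin d,
        (Complex.I * freqX p.1 e * (lower e (velCoeff β e) c p + raise e (velCoeff β e) c p) +
        coupling m N β e.1 * (Complex.I * raise e (convCoeff β V e) c p)) := by
    simp_rw [iL_eq_sum, Finset.mul_sum, mul_add]
    rw [integral_finsetSum]
    · refine Finset.sum_congr rfl fun e _ => ?_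
      have h1 : ∀ z, conj (fhFun β p z) * ((coupling m N β e.1 : ℂ) *
          ((vel e z : ℂ) * convTerm β gradV e.1 e.2 g z)) =
          (coupling m N β e.1 : ℂ) * (conj (fhFun β p z) *
          ((vel e z : ℂ) * convTerm β gradV e.1 e.2 g z)) := fun z => by ring
      simp_rw [h1]
      rw [integral_add (hint1 e) ((hint2 e).const_mul _), integral_const_mul,
        integral_fhFun_mul_vel_mul_derivX hg, integral_conj_vel_mul_fhFun_mul hgi,
        integral_fhFun_mul_vel_mul_convTerm h hV hm hb hg.continuous hC, mul_add]
    · intro e _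
      refine (hint1 e).add (((hint2 e).const_mul (coupling m N β e.1 : ℂ)).congr
        (ae_of_all _ fun z => ?_))
      simp only
      ring
  rw [hsum, vlasovMatrix, Finset.mul_sum]
  refine Finset.sum_congr rfl fun e _ => ?_
  have hlow : Complex.I * freqX p.1 e * lower e (velCoeff β e) c p =
      Complex.I * lower e (fun q => freqX q.1 e * √(q.2 e + 1) / √β) c p := by
    simp only [lower, velCoeff]
    push_cast
    ring
  -- On an edge out of the ground state the convolution adds `a` times the transport entry, giving
  -- `1 + a`, which is the square of the block factor because `a ≥ 0`. On all other edges it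
  -- contributes nothing.
  have hraise : Complex.I * freqX p.1 e * raise e (velCoeff β e) c p +
      coupling m N β e.1 * (Complex.I * raise e (convCoeff β V e) c p) =
      Complex.I * raise e (fun q => freqX q.1 e * √(q.2 e + 1) / √β *
        blockFactor Prod.fst (fourierCoupling m N β V) e q ^ 2) c p := by
    by_cases hp : p.2 e = 0
    · simp [raise_of_eq_zero hp]
    · obtain ⟨q, rfl⟩ := exists_up_eq hp
      simp only [raise_up, convCoeff, blockFactor, velCoeff]
      have h5 : (up e q).1 = q.1 := rfl
      have hiff : (∀ e' : Fin (m + 1) × Fin d, e'.1 = e.1 → q.2 e' = 0) ↔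
          ∀ i, q.2 (e.1, i) = 0 := by
        constructor
        · exact fun h' i => h' _ rfl
        · rintro h' ⟨j, i⟩ (rfl : j = e.1)
          exact h' i
      by_cases hc : ∀ i, q.2 (e.1, i) = 0
      · rw [if_pos hc, if_pos (hiff.2 hc), Real.sq_sqrt, h5, hc e.2, fourierCoupling]
        · push_cast
          simp only [zero_add, Real.sqrt_one, Complex.ofReal_one]
          ring
        · have := mul_nonneg (coupling_nonneg hN hβ.out.le e.1) (hV (q.1 e.1)).1
          rw [fourierCoupling]
          linarith
      · rw [if_neg hc, if_neg (fun h' => hc (hiff.1 h')), h5]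
        push_cast
        ring
  rw [mul_add, mul_add, ← hlow, ← hraise]
  ring

/-- The coefficients in the Fourier–Hermite basis, as a square summable sequence. -/
def coeffMap (d m : ℕ) (β : ℝ) [Fact (0 < β)] : L2 d m β ≃ₗᵢ[ℂ] Ell2 (FHIndex' d m) :=
  (fhHilbertBasis d m β).repr

lemma coeffMap_eq_fhCoeff (G : L2 d m β) (p : FHIndex' d m) :
    coeffMap d m β G p = fhCoeff G ((indexEquiv d m).symm p) := fhHilbertBasis_repr G p

lemma coeffMap_apply (G : L2 d m β) (p : FHIndex' d m) :
    coeffMap d m β G p = ∫ z, conj (fhFun β p z) * G z ∂phaseMeasureN d m β := by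
  rw [coeffMap_eq_fhCoeff, fhCoeff_eq_integral_fhFun]

lemma coeffMap_congr {G : L2 d m β} {g : PhaseN d m → ℂ} (h : G =ᵐ[phaseMeasureN d m β] g)
    (p : FHIndex' d m) :
    coeffMap d m β G p = ∫ z, conj (fhFun β p z) * g z ∂phaseMeasureN d m β := by
  rw [coeffMap_apply]
  refine integral_congr_ae ?_
  filter_upwards [h] with z hz
  rw [hz]

lemma continuous_vlasovMatrix_coord {κ J B : Type*} [DecidableEq κ] [Fintype J] [DecidableEq J]
    (ξ : κ → J → ℝ) (π : J → B) (a : κ → B → ℝ) (p : κ × (J → ℕ)) :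
    Continuous fun f : Ell2 (κ × (J → ℕ)) => vlasovMatrix β ξ π a f p := by
  have hc : ∀ q : κ × (J → ℕ), Continuous fun f : Ell2 (κ × (J → ℕ)) => f q := fun q =>
    (lp.lipschitzWith_one_eval 2 q).continuous
  refine continuous_const.mul (continuous_finsetSum _ fun e _ => ?_)
  refine (continuous_const.mul (hc _)).add ?_
  by_cases hp : p.2 e = 0
  · simp_rw [raise_of_eq_zero hp]
    exact continuous_const
  · obtain ⟨q, rfl⟩ := exists_up_eq hp
    simp_rw [raise_up]
    exact continuous_const.mul (hc _)

/-- The coordinates of pairs in the graph of the linearized Vlasov operator. -/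
lemma coeffMap_of_mem_iLGraph {V : UnitAddTorus (Fin d) → ℝ}
    {gradV : UnitAddTorus (Fin d) → Fin d → ℝ} {K : ℝ} (h : IsW1Infty V gradV K)
    (hV : FourierNonneg V) (hm : Measurable gradV) (hb : ∀ x i, |gradV x i| ≤ K)
    {N : ℕ} (hN : m ≤ N) {y : L2 d m β × L2 d m β} (hy : y ∈ iLGraph N β gradV)
    (p : FHIndex' d m) :
    coeffMap d m β y.2 p =
      vlasovMatrix β freqX Prod.fst (fourierCoupling m N β V) (coeffMap d m β y.1) p := by
  -- Each coordinate of the matrix product involves finitely many entries, so the identity is closed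
  -- in `L²` and passes from test functions to the closure.
  have hcl : IsClosed {y : L2 d m β × L2 d m β | coeffMap d m β y.2 p =
      vlasovMatrix β freqX Prod.fst (fourierCoupling m N β V) (coeffMap d m β y.1) p} := by
    refine isClosed_eq ?_ ?_
    · exact (lp.lipschitzWith_one_eval 2 p).continuous.comp
        ((coeffMap d m β).continuous.comp continuous_snd)
    · exact (continuous_vlasovMatrix_coord _ _ _ p).comp
        ((coeffMap d m β).continuous.comp continuous_fst)
  refine closure_minimal ?_ hcl hy
  rintro ⟨x, y⟩ ⟨g, hg, hx, hy⟩
  change coeffMap d m β y p =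
      vlasovMatrix β freqX Prod.fst (fourierCoupling m N β V) (coeffMap d m β x) p
  rw [coeffMap_congr hy, integral_conj_fhFun_mul_iL h hV hm hb hN hg]
  congr 1
  funext q
  exact (coeffMap_congr hx q).symm

end

section

variable {d m : ℕ} {β : ℝ}

/-! ### Velocity cutoffs -/

/-- A smooth bump function on the line. -/
def lineBump : ContDiffBump (0 : ℝ) := ⟨1, 2, one_pos, one_lt_two⟩

/-- Smooth velocity cutoffs. -/
def velCutoff (n : ℕ) (z : PhaseN d m) : ℝ :=
  ∏ e : Fin (m + 1) × Fin d, lineBump (vel e z / (n + 1))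

lemma velCutoff_nonneg (n : ℕ) (z : PhaseN d m) : 0 ≤ velCutoff n z :=
  Finset.prod_nonneg fun _ _ => lineBump.nonneg

lemma velCutoff_le_one (n : ℕ) (z : PhaseN d m) : velCutoff n z ≤ 1 :=
  Finset.prod_le_one (fun _ _ => lineBump.nonneg) fun _ _ => lineBump.le_one

lemma tendsto_velCutoff (z : PhaseN d m) : Tendsto (fun n => velCutoff n z) atTop (𝓝 1) := by
  have h1 : ∀ e : Fin (m + 1) × Fin d,
      Tendsto (fun n : ℕ => lineBump (vel e z / (n + 1))) atTop (𝓝 1) := by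
    intro e
    have h2 : Tendsto (fun n : ℕ => vel e z / ((n : ℝ) + 1)) atTop (𝓝 0) :=
      (tendsto_const_div_atTop_nhds_zero_nat (vel e z)).comp (tendsto_add_atTop_nat 1) |>.congr
        fun n => by simp
    have h3 : lineBump (0 : ℝ) = 1 := lineBump.one_of_mem_closedBall (by simp [lineBump])
    have h4 := (lineBump.continuous.tendsto 0).comp h2
    rwa [h3] at h4
  simpa [velCutoff] using tendsto_finsetProd Finset.univ fun e _ => h1 e

lemma velCutoff_shiftX (n : ℕ) (j : Fin (m + 1)) (i : Fin d) (h : ℝ) (z : PhaseN d m) :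
    velCutoff n (shiftX j i h z) = velCutoff n z := by
  simp only [velCutoff, vel_shiftX]

/-- The Fourier–Hermite functions with a velocity cutoff. -/
def fhCut (β : ℝ) (p : FHIndex' d m) (n : ℕ) (z : PhaseN d m) : ℂ := velCutoff n z * fhFun β p z

lemma contDiff_hermiteFun (β : ℝ) (n : ℕ) : ContDiff ℝ ∞ (hermiteFun β n) := by
  have h : hermiteFun β n = fun v =>
      Polynomial.aeval (√β * v) (hermiteR n) / √(n.factorial : ℝ) := by
    funext v
    rw [hermiteFun_eq]
    rfl
  rw [h]
  exact ((Polynomial.contDiff_aeval (hermiteR n) ∞).comp (contDiff_const.mul contDiff_id)).div_const _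

lemma contDiff_vel_phaseCover (e : Fin (m + 1) × Fin d) :
    ContDiff ℝ ∞ fun y => vel e (phaseCover d m y) := by
  change ContDiff ℝ ∞ fun y : Fin (m + 1) → (Fin d → ℝ) × (Fin d → ℝ) => (y e.1).2 e.2
  fun_prop

lemma contDiff_fhCut (p : FHIndex' d m) (n : ℕ) :
    ContDiff ℝ ∞ fun y => fhCut β p n (phaseCover d m y) := by
  have h1 : ContDiff ℝ ∞ fun y => velCutoff n (phaseCover d m y) := by
    refine contDiff_prod fun e _ => ?_
    exact lineBump.contDiff.comp ((contDiff_vel_phaseCover e).div_const _)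
  have h2 : ContDiff ℝ ∞ fun y => fhFun β p (phaseCover d m y) := by
    simp_rw [fhFun_eq]
    refine ContDiff.mul (contDiff_prod fun j _ => ?_) (contDiff_prod fun e _ => ?_)
    · exact ContDiff.comp (g := fun y : Fin d → ℝ => UnitAddTorus.mFourier (p.1 j) (torusCover d y))
        (contDiff_mFourier (p.1 j)) (contDiff_fst.comp (contDiff_apply ℝ _ j))
    · exact Complex.ofRealCLM.contDiff.comp ((contDiff_hermiteFun β _).comp
        (contDiff_vel_phaseCover e))
  exact (Complex.ofRealCLM.contDiff.comp h1).mul h2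

lemma hasCompactSupport_fhCut (p : FHIndex' d m) (n : ℕ) : HasCompactSupport (fhCut β p n) := by
  let Q : Set (PhaseN d m) := Set.univ.pi fun _ =>
    (Set.univ : Set (UnitAddTorus (Fin d))) ×ˢ
      (Set.univ.pi fun _ : Fin d => Set.Icc (-(2 * ((n : ℝ) + 1))) (2 * ((n : ℝ) + 1)))
  have hQ : IsCompact Q := isCompact_univ_pi fun _ =>
    isCompact_univ.prod (isCompact_univ_pi fun _ => isCompact_Icc)
  refine HasCompactSupport.of_support_subset_isCompact hQ fun z hz => ?_
  have hz1 : velCutoff n z ≠ 0 := fun h0 => hz (by simp [fhCut, h0])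
  rw [velCutoff, Finset.prod_ne_zero_iff] at hz1
  intro j _
  refine ⟨Set.mem_univ _, fun i _ => ?_⟩
  have h1 := hz1 (j, i) (Finset.mem_univ _)
  have h2 : vel (j, i) z / ((n : ℝ) + 1) ∈ Function.support lineBump := h1
  rw [lineBump.support_eq, Metric.mem_ball, dist_zero_right, Real.norm_eq_abs, abs_div,
    abs_of_pos (by positivity : (0 : ℝ) < (n : ℝ) + 1), div_lt_iff₀ (by positivity)] at h2
  exact abs_le.1 h2.le

lemma isTestFunction_fhCut (p : FHIndex' d m) (n : ℕ) : IsTestFunction (fhCut β p n) :=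
  ⟨contDiff_fhCut p n, hasCompactSupport_fhCut p n⟩

lemma norm_fhCut_le (p : FHIndex' d m) (n : ℕ) (z : PhaseN d m) :
    ‖fhCut β p n z‖ ≤ ‖fhFun β p z‖ := by
  rw [fhCut, norm_mul, Complex.norm_real, Real.norm_of_nonneg (velCutoff_nonneg n z)]
  exact mul_le_of_le_one_left (norm_nonneg _) (velCutoff_le_one n z)

lemma tendsto_fhCut (p : FHIndex' d m) (z : PhaseN d m) :
    Tendsto (fun n => fhCut β p n z) atTop (𝓝 (fhFun β p z)) := by
  have := ((Complex.continuous_ofReal.tendsto 1).comp (tendsto_velCutoff z)).mul_const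
    (fhFun β p z)
  simpa [fhCut] using this

variable [hβ : Fact (0 < β)]

/-- The cutoff depends on velocities only, so the function remains an eigenfunction of the position
derivatives. -/
lemma derivX_fhCut (p : FHIndex' d m) (n : ℕ) (e : Fin (m + 1) × Fin d) (z : PhaseN d m) :
    derivX e.1 e.2 (fhCut β p n) z = Complex.I * freqX p.1 e * fhCut β p n z := by
  have h1 : ∀ h : ℝ, fhCut β p n (shiftX e.1 e.2 h z) =
      Complex.exp (Complex.I * freqX p.1 e * h) * fhCut β p n z := by
    intro h
    rw [fhCut, velCutoff_shiftX, fhFun_shiftX, fhCut]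
    ring
  change deriv (fun h => fhCut β p n (shiftX e.1 e.2 h z)) 0 = _
  simp_rw [h1]
  have h4 : HasDerivAt (fun h : ℝ => Complex.I * freqX p.1 e * (h : ℂ))
      (Complex.I * freqX p.1 e) 0 := by
    simpa using (Complex.ofRealCLM.hasDerivAt (x := (0 : ℝ))).const_mul (Complex.I * freqX p.1 e)
  simpa using ((h4.cexp).mul_const (fhCut β p n z)).deriv

lemma integrable_phaseBasis (k : Fin d → ℤ) (n : Fin d → ℕ) :
    Integrable (phaseBasis β k n) (phaseMeasure d β) := by
  refine (integrable_conj_phaseBasis_mul 0 k 0 n).congr (ae_of_all _ fun w => ?_)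
  simp [phaseBasis, UnitAddTorus.mFourier_zero, hermiteFun_zero]

lemma integrable_fhFun_update (p : FHIndex' d m) (j : Fin (m + 1)) (z : PhaseN d m) :
    Integrable (fun w => fhFun β p (Function.update z j w)) (phaseMeasure d β) := by
  simp_rw [fhFun_update]
  exact (integrable_phaseBasis _ _).mul_const _

lemma continuous_update_right (j : Fin (m + 1)) (z : PhaseN d m) :
    Continuous fun w : Phase d => Function.update z j w :=
  continuous_const.update j continuous_id

lemma measurable_grad_sub_right {gradV : UnitAddTorus (Fin d) → Fin d → ℝ}
    (hm : Measurable gradV) (e : Fin (m + 1) × Fin d) (z : PhaseN d m) :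
    Measurable fun w : Phase d => (gradV ((z e.1).1 - w.1) e.2 : ℂ) :=
  (measurable_grad_sub hm e).comp measurable_prodMk_left

/-- The formal action of the linearized Vlasov operator on a Fourier–Hermite function. -/
def iLBasis (N : ℕ) (β : ℝ) (gradV : UnitAddTorus (Fin d) → Fin d → ℝ) (p : FHIndex' d m)
    (z : PhaseN d m) : ℂ :=
  ∑ e : Fin (m + 1) × Fin d, ((vel e z : ℂ) * (Complex.I * freqX p.1 e * fhFun β p z) +
    (coupling m N β e.1 : ℂ) * ((vel e z : ℂ) * convTerm β gradV e.1 e.2 (fhFun β p) z))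

lemma tendsto_iL_fhCut {gradV : UnitAddTorus (Fin d) → Fin d → ℝ} {K : ℝ}
    (hm : Measurable gradV) (hb : ∀ x i, |gradV x i| ≤ K) (N : ℕ) (p : FHIndex' d m)
    (z : PhaseN d m) :
    Tendsto (fun n => iL N β gradV (fhCut β p n) z) atTop (𝓝 (iLBasis N β gradV p z)) := by
  simp_rw [iL_eq_sum, derivX_fhCut]
  refine tendsto_finsetSum _ fun e _ => ?_
  refine (((tendsto_fhCut p z).const_mul _).const_mul _).add (Tendsto.const_mul _
    (Tendsto.const_mul _ ?_))
  refine tendsto_integral_of_dominated_convergence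
    (fun w => K * ‖fhFun β p (Function.update z e.1 w)‖) ?_ ?_ ?_ ?_
  · intro n
    exact ((measurable_grad_sub_right hm e z).mul ((isTestFunction_fhCut p n).continuous.comp
      (continuous_update_right e.1 z)).measurable).aestronglyMeasurable
  · exact (integrable_fhFun_update p e.1 z).norm.const_mul _
  · intro n
    refine ae_of_all _ fun w => ?_
    rw [norm_mul, Complex.norm_real]
    exact mul_le_mul (hb _ _) (norm_fhCut_le _ _ _) (norm_nonneg _)
      ((abs_nonneg _).trans (hb 0 e.2))
  · exact ae_of_all _ fun w => (tendsto_fhCut p _).const_mul _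

/-- A square integrable majorant for the action of the operator on cut off basis functions. -/
def iLBound (N : ℕ) (β K : ℝ) (p : FHIndex' d m) (z : PhaseN d m) : ℝ :=
  ∑ e : Fin (m + 1) × Fin d, (|vel e z| * (|freqX p.1 e| * ‖fhFun β p z‖) +
    |coupling m N β e.1| * (|vel e z| * (K * ∫ w, ‖fhFun β p (Function.update z e.1 w)‖
      ∂phaseMeasure d β)))

lemma norm_convTerm_fhCut_le {gradV : UnitAddTorus (Fin d) → Fin d → ℝ} {K : ℝ}
    (hb : ∀ x i, |gradV x i| ≤ K) (e : Fin (m + 1) × Fin d)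
    (p : FHIndex' d m) (n : ℕ) (z : PhaseN d m) :
    ‖convTerm β gradV e.1 e.2 (fhCut β p n) z‖ ≤
      K * ∫ w, ‖fhFun β p (Function.update z e.1 w)‖ ∂phaseMeasure d β := by
  rw [← integral_const_mul]
  refine norm_integral_le_of_norm_le ((integrable_fhFun_update p e.1 z).norm.const_mul _)
    (ae_of_all _ fun w => ?_)
  rw [norm_mul, Complex.norm_real]
  exact mul_le_mul (hb _ _) (norm_fhCut_le _ _ _) (norm_nonneg _)
    ((abs_nonneg _).trans (hb 0 e.2))

lemma norm_iL_fhCut_le {gradV : UnitAddTorus (Fin d) → Fin d → ℝ} {K : ℝ}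
    (hb : ∀ x i, |gradV x i| ≤ K) (N : ℕ) (p : FHIndex' d m) (n : ℕ) (z : PhaseN d m) :
    ‖iL N β gradV (fhCut β p n) z‖ ≤ iLBound N β K p z := by
  rw [iL_eq_sum, iLBound]
  simp_rw [derivX_fhCut]
  refine (norm_sum_le _ _).trans (Finset.sum_le_sum fun e _ => (norm_add_le _ _).trans ?_)
  simp only [norm_mul, Complex.norm_real, Complex.norm_I, one_mul, Real.norm_eq_abs]
  gcongr
  · exact norm_fhCut_le p n z
  · exact norm_convTerm_fhCut_le hb e p n z

lemma memLp_vel_mul_integral_fhFun (e : Fin (m + 1) × Fin d) (p : FHIndex' d m) :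
    MemLp (fun z => |vel e z| * ∫ w, ‖fhFun β p (Function.update z e.1 w)‖ ∂phaseMeasure d β) 2
      (phaseMeasureN d m β) := by
  -- The index `p` with the slot of `e` erased: integrating `|fhFun β p|` over that slot gives a
  -- constant times `|fhFun β q|`.
  let q : FHIndex' d m := (fun j => if j = e.1 then 0 else p.1 j,
    fun e' => if e'.1 = e.1 then 0 else p.2 e')
  have hq : ∀ z : PhaseN d m, ‖fhFun β q z‖ =
      ‖∏ j' ∈ Finset.univ.erase e.1, phaseBasis β (p.1 j') (fun i => p.2 (j', i)) (z j')‖ := by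
    intro z
    have h1 := fhFun_update (β := β) q e.1 z (z e.1)
    rw [Function.update_eq_self] at h1
    rw [h1, norm_mul]
    have h2 : ‖phaseBasis β (q.1 e.1) (fun i => q.2 (e.1, i)) (z e.1)‖ = 1 := by
      simp [q, phaseBasis, UnitAddTorus.mFourier_zero, hermiteFun_zero]
    rw [h2, one_mul]
    congr 1
    refine Finset.prod_congr rfl fun j' hj' => ?_
    simp [q, Finset.ne_of_mem_erase hj']
  refine ((memLp_vel_mul_fhFun (β := β) e q).norm.const_mul
    (∫ w, ‖phaseBasis β (p.1 e.1) (fun i => p.2 (e.1, i)) w‖ ∂phaseMeasure d β)).ae_eq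
    (ae_of_all _ fun z => ?_)
  simp only [fhFun_update, norm_mul, Complex.norm_real, Real.norm_eq_abs]
  rw [integral_mul_const, hq z]
  ring

lemma memLp_iLBound (N : ℕ) (K : ℝ) (p : FHIndex' d m) :
    MemLp (iLBound N β K p) 2 (phaseMeasureN d m β) := by
  refine memLp_finsetSum _ fun e _ => ?_
  refine MemLp.add (((memLp_vel_mul_fhFun (β := β) e p).norm.const_mul |freqX p.1 e|).ae_eq
    (ae_of_all _ fun z => ?_)) (((memLp_vel_mul_integral_fhFun (β := β) e p).const_mul
    (|coupling m N β e.1| * K)).ae_eq (ae_of_all _ fun z => ?_))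
  · simp only [norm_mul, Complex.norm_real, Real.norm_eq_abs]
    ring
  · simp only
    ring

lemma aestronglyMeasurable_iL {gradV : UnitAddTorus (Fin d) → Fin d → ℝ}
    (hm : Measurable gradV) (N : ℕ) {g : PhaseN d m → ℂ} (hg : IsTestFunction g) :
    AEStronglyMeasurable (iL N β gradV g) (phaseMeasureN d m β) := by
  have h1 : iL N β gradV g = fun z => ∑ e : Fin (m + 1) × Fin d,
      ((vel e z : ℂ) * derivX e.1 e.2 g z +
      (coupling m N β e.1 : ℂ) * ((vel e z : ℂ) * convTerm β gradV e.1 e.2 g z)) :=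
    funext (iL_eq_sum N gradV g)
  rw [h1]
  have hv : ∀ e : Fin (m + 1) × Fin d, AEStronglyMeasurable (fun z : PhaseN d m => (vel e z : ℂ))
      (phaseMeasureN d m β) := fun e =>
    (Complex.continuous_ofReal.comp (continuous_vel e)).aestronglyMeasurable
  refine Finset.aestronglyMeasurable_fun_sum _ fun e _ => ((hv e).mul
    (continuous_derivX hg.1 e.1 e.2).aestronglyMeasurable).add
    (((hv e).mul ?_).const_mul _)
  have hupd : Continuous fun y : PhaseN d m × Phase d => Function.update y.1 e.1 y.2 :=
    continuous_fst.update e.1 continuous_snd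
  exact (((measurable_grad_sub hm e).mul
    (hg.continuous.comp hupd).measurable).stronglyMeasurable.integral_prod_right).aestronglyMeasurable

/-- Dominated convergence in `L²`. -/
lemma tendsto_toLp_of_dominated {α : Type*} [MeasurableSpace α] {μ : Measure α}
    {F : ℕ → α → ℂ} {f : α → ℂ} {B : α → ℝ} (hB : MemLp B 2 μ)
    (hF : ∀ n, MemLp (F n) 2 μ) (hf : MemLp f 2 μ)
    (hle : ∀ n, ∀ᵐ x ∂μ, ‖F n x‖ ≤ B x) (hlef : ∀ᵐ x ∂μ, ‖f x‖ ≤ B x)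
    (hlim : ∀ᵐ x ∂μ, Tendsto (fun n => F n x) atTop (𝓝 (f x))) :
    Tendsto (fun n => (hF n).toLp) atTop (𝓝 hf.toLp) := by
  rw [Lp.tendsto_Lp_iff_tendsto_eLpNorm'']
  have h2 : ∀ h : α → ℂ, eLpNorm h 2 μ = (∫⁻ x, ‖h x‖ₑ ^ (2 : ℝ) ∂μ) ^ (1 / 2 : ℝ) := by
    intro h
    rw [eLpNorm_eq_lintegral_rpow_enorm_toReal (by norm_num) (by norm_num)]
    simp
  simp_rw [h2]
  have h3 : Tendsto (fun n => ∫⁻ x, ‖(F n - f) x‖ₑ ^ (2 : ℝ) ∂μ) atTop (𝓝 (∫⁻ _, 0 ∂μ)) := by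
    refine tendsto_lintegral_of_dominated_convergence' (fun x => ‖2 * B x‖ₑ ^ (2 : ℝ)) ?_ ?_ ?_ ?_
    · intro n
      exact ((hF n).1.sub hf.1).enorm.pow_const _
    · intro n
      filter_upwards [hle n, hlef] with x h1 h2
      refine ENNReal.rpow_le_rpow ?_ (by norm_num)
      rw [← ofReal_norm, ← ofReal_norm]
      refine ENNReal.ofReal_le_ofReal ((norm_sub_le _ _).trans ?_)
      rw [Real.norm_eq_abs]
      exact (by linarith : ‖F n x‖ + ‖f x‖ ≤ 2 * B x).trans (le_abs_self _)
    · have h4 := lintegral_rpow_enorm_lt_top_of_eLpNorm_lt_top (by norm_num) (by norm_num)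
        (hB.const_mul 2).2
      simpa using h4.ne
    · filter_upwards [hlim] with x hx
      have h5 : Tendsto (fun n => ‖(F n - f) x‖ₑ) atTop (𝓝 0) := by
        have h6 := (hx.sub_const (f x)).enorm
        simpa using h6
      have h7 := (ENNReal.continuous_rpow_const (y := 2)).tendsto 0 |>.comp h5
      simpa [Function.comp_def] using h7
  have h8 := (ENNReal.continuous_rpow_const (y := (1 / 2 : ℝ))).tendsto 0
  rw [lintegral_zero] at h3
  simpa [Function.comp_def] using h8.comp h3

/-- The Fourier–Hermite functions belong to the domain of the linearized Vlasov operator. -/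
lemma exists_mem_iLGraph {gradV : UnitAddTorus (Fin d) → Fin d → ℝ} {K : ℝ}
    (hm : Measurable gradV) (hb : ∀ x i, |gradV x i| ≤ K) (N : ℕ) (p : FHIndex' d m) :
    ∃ y : L2 d m β, (fhHilbertBasis d m β p, y) ∈ iLGraph N β gradV := by
  have hB : MemLp (iLBound N β K p) 2 (phaseMeasureN d m β) := memLp_iLBound N K p
  have hL : ∀ n, MemLp (iL N β gradV (fhCut β p n)) 2 (phaseMeasureN d m β) := fun n =>
    hB.mono' (aestronglyMeasurable_iL hm N (isTestFunction_fhCut p n))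
      (ae_of_all _ fun z => norm_iL_fhCut_le hb N p n z)
  have hlim := fun z => tendsto_iL_fhCut (β := β) hm hb N p z
  have hle : ∀ z, ‖iLBasis N β gradV p z‖ ≤ iLBound N β K p z := fun z =>
    le_of_tendsto (hlim z).norm (Eventually.of_forall fun n => norm_iL_fhCut_le hb N p n z)
  have hY : MemLp (iLBasis N β gradV p) 2 (phaseMeasureN d m β) :=
    hB.mono' (aestronglyMeasurable_of_tendsto_ae atTop (fun n => (hL n).1) (ae_of_all _ hlim))
      (ae_of_all _ hle)
  have hC : ∀ n, MemLp (fhCut β p n) 2 (phaseMeasureN d m β) := fun n =>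
    (memLp_fhFun p).norm.mono' (isTestFunction_fhCut p n).continuous.aestronglyMeasurable
      (ae_of_all _ fun z => norm_fhCut_le p n z)
  refine ⟨hY.toLp, ?_⟩
  have hx : fhHilbertBasis d m β p = (memLp_fhFun p).toLp := fhHilbertBasis_apply p
  rw [hx]
  -- Both the cut-off functions and their images converge in `L²` by dominated convergence, so the
  -- limit pair lies in the closed graph.
  refine mem_closure_of_tendsto (b := atTop) (f := fun n => ((hC n).toLp, (hL n).toLp)) ?_
    (Eventually.of_forall fun n => ⟨fhCut β p n, isTestFunction_fhCut p n, (hC n).coeFn_toLp,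
      (hL n).coeFn_toLp⟩)
  rw [nhds_prod_eq]
  exact (tendsto_toLp_of_dominated (memLp_fhFun p).norm hC (memLp_fhFun p)
      (fun n => ae_of_all _ fun z => norm_fhCut_le p n z) (ae_of_all _ fun z => le_rfl)
      (ae_of_all _ fun z => tendsto_fhCut p z)).prodMk
    (tendsto_toLp_of_dominated hB hL hY (fun n => ae_of_all _ fun z => norm_iL_fhCut_le hb N p n z)
      (ae_of_all _ hle) (ae_of_all _ hlim))

end

/-! ### Linearity of the operator on test functions, Sobolev norms in coordinates, duality. -/

section

variable {d m : ℕ} {β : ℝ}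

lemma IsTestFunction.add {g h : PhaseN d m → ℂ} (hg : IsTestFunction g) (hh : IsTestFunction h) :
    IsTestFunction (g + h) := ⟨hg.1.add hh.1, hg.2.add hh.2⟩

lemma IsTestFunction.smul {g : PhaseN d m → ℂ} (hg : IsTestFunction g) (c : ℂ) :
    IsTestFunction (c • g) := ⟨hg.1.const_smul c, hg.2.smul_left (f := fun _ => c)⟩

lemma isTestFunction_zero : IsTestFunction (0 : PhaseN d m → ℂ) :=
  ⟨contDiff_const, HasCompactSupport.zero⟩

lemma IsTestFunction.hasDerivAt {g : PhaseN d m → ℂ} (hg : IsTestFunction g)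
    (j : Fin (m + 1)) (i : Fin d) (z : PhaseN d m) :
    HasDerivAt (fun h => g (shiftX j i h z)) (derivX j i g z) 0 := by
  simpa [shiftX_zero] using hasDerivAt_shiftX hg.1 j i z 0

lemma derivX_add {g h : PhaseN d m → ℂ} (hg : IsTestFunction g) (hh : IsTestFunction h)
    (j : Fin (m + 1)) (i : Fin d) (z : PhaseN d m) :
    derivX j i (g + h) z = derivX j i g z + derivX j i h z :=
  ((hg.hasDerivAt j i z).add (hh.hasDerivAt j i z)).deriv

lemma derivX_smul {g : PhaseN d m → ℂ} (hg : IsTestFunction g) (c : ℂ)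
    (j : Fin (m + 1)) (i : Fin d) (z : PhaseN d m) :
    derivX j i (c • g) z = c * derivX j i g z :=
  ((hg.hasDerivAt j i z).const_smul c).deriv

variable [hβ : Fact (0 < β)]

lemma IsTestFunction.integrable_grad_mul {g : PhaseN d m → ℂ} (hg : IsTestFunction g)
    {gradV : UnitAddTorus (Fin d) → Fin d → ℝ} {K : ℝ}
    (hm : Measurable gradV) (hb : ∀ x i, |gradV x i| ≤ K) (e : Fin (m + 1) × Fin d)
    (z : PhaseN d m) :
    Integrable (fun w => (gradV ((z e.1).1 - w.1) e.2 : ℂ) * g (Function.update z e.1 w))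
      (phaseMeasure d β) := by
  obtain ⟨C, hC⟩ := hg.exists_bound
  have hc := hg.continuous.comp (continuous_update_right e.1 z)
  refine (integrable_const (K * C)).mono'
    ((measurable_grad_sub_right hm e z).mul hc.measurable).aestronglyMeasurable
    (ae_of_all _ fun w => ?_)
  rw [norm_mul, Complex.norm_real]
  exact mul_le_mul (hb _ _) (hC _) (norm_nonneg _) ((abs_nonneg _).trans (hb 0 e.2))

lemma iL_add {gradV : UnitAddTorus (Fin d) → Fin d → ℝ} {K : ℝ}
    (hm : Measurable gradV) (hb : ∀ x i, |gradV x i| ≤ K) (N : ℕ) {g h : PhaseN d m → ℂ}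
    (hg : IsTestFunction g) (hh : IsTestFunction h) (z : PhaseN d m) :
    iL N β gradV (g + h) z = iL N β gradV g z + iL N β gradV h z := by
  rw [iL_eq_sum, iL_eq_sum, iL_eq_sum, ← Finset.sum_add_distrib]
  refine Finset.sum_congr rfl fun e _ => ?_
  have h1 : convTerm β gradV e.1 e.2 (g + h) z =
      convTerm β gradV e.1 e.2 g z + convTerm β gradV e.1 e.2 h z := by
    rw [convTerm, convTerm, convTerm, ← integral_add (hg.integrable_grad_mul hm hb e z)
      (hh.integrable_grad_mul hm hb e z)]
    simp only [Pi.add_apply, mul_add]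
  rw [derivX_add hg hh, h1]
  ring

lemma iL_smul (gradV : UnitAddTorus (Fin d) → Fin d → ℝ) (N : ℕ) {g : PhaseN d m → ℂ}
    (hg : IsTestFunction g) (c : ℂ) (z : PhaseN d m) :
    iL N β gradV (c • g) z = c * iL N β gradV g z := by
  rw [iL_eq_sum, iL_eq_sum, Finset.mul_sum]
  refine Finset.sum_congr rfl fun e _ => ?_
  have h1 : convTerm β gradV e.1 e.2 (c • g) z = c * convTerm β gradV e.1 e.2 g z := by
    rw [convTerm, convTerm, ← integral_const_mul]
    refine integral_congr_ae (ae_of_all _ fun w => ?_)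
    simp only [Pi.smul_apply, smul_eq_mul]
    ring
  rw [derivX_smul hg, h1]
  ring

/-- The graph of the linearized Vlasov operator on test functions. -/
def testGraph (N : ℕ) {gradV : UnitAddTorus (Fin d) → Fin d → ℝ} {K : ℝ}
    (hm : Measurable gradV) (hb : ∀ x i, |gradV x i| ≤ K) :
    Submodule ℂ (L2 d m β × L2 d m β) where
  carrier := {p | ∃ g : PhaseN d m → ℂ, IsTestFunction g ∧
    p.1 =ᵐ[phaseMeasureN d m β] g ∧ p.2 =ᵐ[phaseMeasureN d m β] iL N β gradV g}
  add_mem' := by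
    rintro ⟨x, y⟩ ⟨x', y'⟩ ⟨g, hg, hx, hy⟩ ⟨g', hg', hx', hy'⟩
    refine ⟨g + g', hg.add hg', ?_, ?_⟩
    · exact (Lp.coeFn_add x x').trans (hx.add hx')
    · refine (Lp.coeFn_add y y').trans ((hy.add hy').trans (ae_of_all _ fun z => ?_))
      exact (iL_add hm hb N hg hg' z).symm
  zero_mem' := by
    refine ⟨0, isTestFunction_zero, Lp.coeFn_zero _ _ _, (Lp.coeFn_zero _ _ _).trans
      (ae_of_all _ fun z => ?_)⟩
    have := iL_smul (β := β) gradV N (isTestFunction_zero (d := d) (m := m)) 0 z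
    rw [zero_mul, smul_zero] at this
    exact this.symm
  smul_mem' := by
    rintro c ⟨x, y⟩ ⟨g, hg, hx, hy⟩
    refine ⟨c • g, hg.smul c, (Lp.coeFn_smul c x).trans (hx.const_smul c),
      (Lp.coeFn_smul c y).trans ((hy.const_smul c).trans (ae_of_all _ fun z => ?_))⟩
    exact (iL_smul gradV N hg c z).symm

lemma coeffMap_fhHilbertBasis (p : FHIndex' d m) :
    coeffMap d m β (fhHilbertBasis d m β p) = unitVec p := by
  classical
  rw [coeffMap, HilbertBasis.repr_self]
  ext q
  by_cases h : q = p
  · subst h; rw [lp.single_apply_self, unitVec_self]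
  · rw [lp.single_apply_ne _ _ _ h, unitVec_ne h]

lemma totalWeight_eq (p : FHIndex' d m) :
    totalWeight β freqX 1 p = fhWeight β ((indexEquiv d m).symm p) := by
  rw [totalWeight, fhWeight, Fintype.sum_prod_type, Fintype.sum_prod_type]
  simp only [Finset.sum_add_distrib, Finset.mul_sum]
  simp [freqX, indexEquiv, add_assoc]

lemma sobolevNorm_eq (s : ℝ) (G : L2 d m β) :
    sobolevNorm s G =
      wsum (fun p => totalWeight β freqX 1 p ^ s) (coeffMap d m β G) ^ (1 / 2 : ℝ) := by
  rw [sobolevNorm, wsum]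
  simp_rw [totalWeight_eq, coeffMap_eq_fhCoeff]
  congr 1
  exact ((indexEquiv d m).symm.tsum_eq
    (fun p => ENNReal.ofReal (fhWeight β p ^ s) * ‖fhCoeff G p‖ₑ ^ 2)).symm

lemma sobolevNorm_smul (s : ℝ) (c : ℂ) (G : L2 d m β) :
    sobolevNorm s (c • G) = ‖c‖ₑ * sobolevNorm s G := by
  have h1 : wsum (fun p => totalWeight β freqX 1 p ^ s) (c • coeffMap d m β G : Ell2 _) =
      ‖c‖ₑ ^ 2 * wsum (fun p => totalWeight β freqX 1 p ^ s) (coeffMap d m β G) := wsum_smul _ c _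
  rw [sobolevNorm_eq, sobolevNorm_eq, map_smul, h1,
    ENNReal.mul_rpow_of_nonneg _ _ (by norm_num), ← ENNReal.rpow_natCast,
    ← ENNReal.rpow_mul]
  norm_num

/-- Duality: a bound for the adjoint on the Sobolev space bounds the dual norms. -/
lemma dualSobolevNorm_le {s r : ℝ} (hr : 0 < r) (T : Ell2 (FHIndex' d m) →L[ℂ] Ell2 (FHIndex' d m))
    (hT : ∀ f, wsum (fun p => totalWeight β freqX 1 p ^ s) (T.adjoint f) ≤
      ENNReal.ofReal (r ^ 2) * wsum (fun p => totalWeight β freqX 1 p ^ s) f)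
    (G : L2 d m β) :
    dualSobolevNorm s ((coeffMap d m β).symm (T (coeffMap d m β G))) ≤
      ENNReal.ofReal r * dualSobolevNorm s G := by
  refine iSup₂_le fun H hH => ?_
  set Φ := coeffMap d m β
  set H' : L2 d m β := Φ.symm (T.adjoint (Φ H))
  have h1 : inner ℂ H (Φ.symm (T (Φ G))) = inner ℂ H' G := by
    rw [← Φ.inner_map_map, Φ.apply_symm_apply, ← ContinuousLinearMap.adjoint_inner_left,
      ← Φ.inner_map_map H' G, Φ.apply_symm_apply]
  have h2 : sobolevNorm s H' ≤ ENNReal.ofReal r := by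
    have h3 : sobolevNorm s H' ≤ (ENNReal.ofReal (r ^ 2)) ^ (1 / 2 : ℝ) * sobolevNorm s H := by
      rw [sobolevNorm_eq, sobolevNorm_eq, ← ENNReal.mul_rpow_of_nonneg _ _ (by norm_num)]
      refine ENNReal.rpow_le_rpow ?_ (by norm_num)
      have := hT (Φ H)
      simpa only [H', Φ, LinearIsometryEquiv.apply_symm_apply] using this
    have h4 : (ENNReal.ofReal (r ^ 2)) ^ (1 / 2 : ℝ) = ENNReal.ofReal r := by
      rw [ENNReal.ofReal_rpow_of_nonneg (by positivity) (by norm_num), ← Real.sqrt_eq_rpow,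
        Real.sqrt_sq hr.le]
    rw [h4] at h3
    exact h3.trans (mul_le_of_le_one_right' hH)
  have hrc : ((r : ℂ)) ≠ 0 := by exact_mod_cast hr.ne'
  -- The adjoint maps the unit ball of `H^s` into the ball of radius `r`; after division by `r` the
  -- vector is admissible in the supremum for `G`.
  have h5 : sobolevNorm s ((r : ℂ)⁻¹ • H') ≤ 1 := by
    rw [sobolevNorm_smul, enorm_inv hrc]
    have h6 : ‖(r : ℂ)‖ₑ = ENNReal.ofReal r := by
      rw [← ofReal_norm, Complex.norm_real, Real.norm_of_nonneg hr.le]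
    rw [h6]
    exact (mul_le_mul_right h2 _).trans (ENNReal.inv_mul_le_one _)
  have h6 : inner ℂ H' G = (r : ℂ) * inner ℂ ((r : ℂ)⁻¹ • H') G := by
    rw [inner_smul_left, map_inv₀, Complex.conj_ofReal, mul_inv_cancel_left₀ hrc]
  rw [h1, h6, enorm_mul]
  have h7 : ‖(r : ℂ)‖ₑ = ENNReal.ofReal r := by
    rw [← ofReal_norm, Complex.norm_real, Real.norm_of_nonneg hr.le]
  rw [h7]
  gcongr
  exact le_iSup₂_of_le ((r : ℂ)⁻¹ • H') h5 le_rfl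

end

/-! ### Transfer of the group from sequences to functions. -/

section

variable {d m : ℕ} {β : ℝ} [hβ : Fact (0 < β)]

/-- The transport of a bounded operator from sequences to functions. -/
def transportOp (T : Ell2 (FHIndex' d m) →L[ℂ] Ell2 (FHIndex' d m)) : L2 d m β →L[ℂ] L2 d m β :=
  ((coeffMap d m β).symm.toContinuousLinearEquiv : Ell2 (FHIndex' d m) →L[ℂ] L2 d m β).comp
    (T.comp ((coeffMap d m β).toContinuousLinearEquiv : L2 d m β →L[ℂ] Ell2 (FHIndex' d m)))

lemma transportOp_apply (T : Ell2 (FHIndex' d m) →L[ℂ] Ell2 (FHIndex' d m)) (G : L2 d m β) :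
    transportOp T G = (coeffMap d m β).symm (T (coeffMap d m β G)) := rfl

/-- Differentiability of an orbit is invariant under a change of coordinates. -/
lemma hasDerivAt_symm_conj_iff {E F : Type*} [NormedAddCommGroup E] [NormedSpace ℂ E]
    [NormedAddCommGroup F] [NormedSpace ℂ F] [NormedSpace ℝ F] [IsScalarTower ℝ ℂ F]
    (Φ : E ≃ₗᵢ[ℂ] F) (u : ℝ → F) (y : E) :
    HasDerivAt (fun t => Φ.symm (u t)) y 0 ↔ HasDerivAt u (Φ y) 0 := by
  constructor
  · intro h
    have h1 := ((Φ.toContinuousLinearEquiv : E →L[ℂ] F).restrictScalars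
      ℝ).hasFDerivAt.comp_hasDerivAt (0 : ℝ) h
    refine h1.congr_of_eventuallyEq (Eventually.of_forall fun t => ?_)
    exact (Φ.apply_symm_apply (u t)).symm
  · intro h
    have h1 := ((Φ.symm.toContinuousLinearEquiv : F →L[ℂ] E).restrictScalars
      ℝ).hasFDerivAt.comp_hasDerivAt (0 : ℝ) h
    exact h1.congr_deriv (Φ.symm_apply_apply y)

/-- The group generated by the linearized Vlasov operator, for a bounded measurable force. -/
theorem exists_group_of_bounded (d m : ℕ) (β : ℝ) [hβ : Fact (0 < β)] {s : ℝ} (hs : 0 ≤ s)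
    {K : ℝ} (hK : 0 ≤ K) :
    ∃ C : ℝ, 0 < C ∧
      ∀ (V : UnitAddTorus (Fin d) → ℝ) (gradV : UnitAddTorus (Fin d) → Fin d → ℝ),
        IsW1Infty V gradV K → FourierNonneg V → Measurable gradV → (∀ x i, |gradV x i| ≤ K) →
        ∀ N : ℕ, m ≤ N → ∃ U : ℝ → L2 d m β →L[ℂ] L2 d m β,
          IsC0GroupGeneratedBy U (iLGraph N β gradV) ∧
          ∀ (t : ℝ) (G : L2 d m β), dualSobolevNorm s (U t G) ≤
            ENNReal.ofReal (C * bracket t ^ s) * dualSobolevNorm s G := by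
  classical
  obtain ⟨C, hC, hU⟩ := exists_vlasov_group (κ := Fin (m + 1) → Fin d → ℤ)
    (J := Fin (m + 1) × Fin d) (B := Fin (m + 1)) hβ.out Prod.fst
    (mul_nonneg hβ.out.le hK) hs
  -- `C` bounds squared norms, hence the square root; adding one makes the constant positive.
  refine ⟨√C.toReal + 1, by positivity, fun V gradV h hV hm hb N hN => ?_⟩
  -- The range `A = βK` of the couplings does not involve `N`: the mean-field factor is at most `β`,
  -- and each Fourier coefficient of `V` is at most `K`.
  have ha : ∀ k j, 0 ≤ fourierCoupling m N β V k j ∧ fourierCoupling m N β V k j ≤ β * K :=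
    fun k j => ⟨mul_nonneg (coupling_nonneg hN hβ.out.le j) (hV _).1,
      mul_le_mul (coupling_le hN hβ.out.le j) (h.fourierCoeffV_re_le _) (hV _).1 hβ.out.le⟩
  obtain ⟨U, hU0, hUadd, hUc, hUcore, hUgen, hUbd⟩ := hU freqX (fourierCoupling m N β V) ha
  refine ⟨fun t => transportOp (U t), ⟨?_, ?_, ?_, ?_⟩, ?_⟩
  · ext1 x
    rw [transportOp_apply, hU0]
    exact (coeffMap d m β).symm_apply_apply x
  · intro t t'
    ext1 x
    rw [ContinuousLinearMap.comp_apply, transportOp_apply, transportOp_apply, transportOp_apply,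
      hUadd, LinearIsometryEquiv.apply_symm_apply]
  · intro x
    exact (coeffMap d m β).symm.continuous.comp (hUc _)
  · intro x y
    refine (hasDerivAt_symm_conj_iff (coeffMap d m β) (fun t => U t (coeffMap d m β x)) y).trans ?_
    constructor
    · intro hd
      let Ψ : Ell2 (FHIndex' d m) × Ell2 (FHIndex' d m) →L[ℂ] L2 d m β × L2 d m β :=
        ((coeffMap d m β).symm.toContinuousLinearEquiv : Ell2 (FHIndex' d m) →L[ℂ] L2 d m β).prodMap
        ((coeffMap d m β).symm.toContinuousLinearEquiv : Ell2 (FHIndex' d m) →L[ℂ] L2 d m β)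
      have hmem := hUcore
        ((testGraph N hm hb : Submodule ℂ (L2 d m β × L2 d m β)).topologicalClosure.comap
          (Ψ : Ell2 (FHIndex' d m) × Ell2 (FHIndex' d m) →ₗ[ℂ] L2 d m β × L2 d m β))
        ((Submodule.isClosed_topologicalClosure _).preimage Ψ.continuous) ?_ _ _ hd
      · change ((coeffMap d m β).symm (coeffMap d m β x), (coeffMap d m β).symm (coeffMap d m β y)) ∈
          iLGraph N β gradV at hmem
        rwa [LinearIsometryEquiv.symm_apply_apply, LinearIsometryEquiv.symm_apply_apply] at hmem
      · intro p f hf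
        obtain ⟨y₀, hy₀⟩ := exists_mem_iLGraph (β := β) hm hb N p
        -- The element supplied by the cutoff argument is forced by the matrix identity to have the
        -- coordinates `f`, so the matrix on unit vectors is contained in the closure over test
        -- functions.
        have h1 : coeffMap d m β y₀ = f := by
          ext q
          rw [hf, coeffMap_of_mem_iLGraph h hV hm hb hN hy₀, coeffMap_fhHilbertBasis]
        change ((coeffMap d m β).symm (unitVec p), (coeffMap d m β).symm f) ∈ iLGraph N β gradV
        rwa [← h1, ← coeffMap_fhHilbertBasis (β := β), LinearIsometryEquiv.symm_apply_apply,
          LinearIsometryEquiv.symm_apply_apply]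
    · intro hmem
      -- The reverse inclusion: the closed graph is contained in the maximal matrix operator, which
      -- the group generates.
      exact hUgen _ _ fun p => coeffMap_of_mem_iLGraph h hV hm hb hN hmem p
  · intro t G
    have hb0 : 0 < bracket t := lt_of_lt_of_le one_pos (one_le_bracket t)
    have hbs : 0 < bracket t ^ s := Real.rpow_pos_of_pos hb0 s
    refine dualSobolevNorm_le (by positivity) (U t) (fun f => (hUbd t f).trans ?_) G
    gcongr
    rw [mul_pow, ENNReal.ofReal_mul (by positivity), ← Real.rpow_mul_natCast hb0.le]
    have h1 : C ≤ ENNReal.ofReal ((√C.toReal + 1) ^ 2) := by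
      rw [← ENNReal.ofReal_toReal hC]
      refine ENNReal.ofReal_le_ofReal ?_
      rw [ENNReal.toReal_ofReal ENNReal.toReal_nonneg]
      nlinarith [Real.sq_sqrt (ENNReal.toReal_nonneg (a := C)), Real.sqrt_nonneg C.toReal]
    have h2 : s * ((2 : ℕ) : ℝ) = 2 * s := by push_cast; ring
    rw [h2]
    gcongr

end

end LinVlasov

end

theorem lemma4p3 (d : ℕ) (hd : 1 ≤ d) (m : ℕ) (β : ℝ) (hβ : 0 < β) (s : ℝ) (hs : 0 ≤ s) (K : ℝ) :
    ∃ C : ℝ, 0 < C ∧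
      ∀ (V : UnitAddTorus (Fin d) → ℝ) (gradV : UnitAddTorus (Fin d) → Fin d → ℝ),
        IsW1Infty V gradV K → FourierNonneg V → ∀ N : ℕ, m ≤ N →
          ∃ U : ℝ → L2 d m β →L[ℂ] L2 d m β,
            IsC0GroupGeneratedBy U (iLGraph N β gradV) ∧
            ∀ (t : ℝ) (g : PhaseN d m → ℂ) (G : L2 d m β), IsTestFunction g →
              G =ᵐ[phaseMeasureN d m β] g →
                dualSobolevNorm s (U t G) ≤
                  ENNReal.ofReal (C * bracket t ^ s) * dualSobolevNorm s G := by
  have : Fact (0 < β) := ⟨hβ⟩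
  -- The sign of `K` is known only once a potential is given: a negative `K` admits none. The
  -- absolute value allows the constant to be fixed beforehand.
  obtain ⟨C, hC, hU⟩ := exists_group_of_bounded d m β hs (abs_nonneg K)
  refine ⟨C, hC, fun V gradV h hV N hN => ?_⟩
  obtain ⟨gradV', hm, hb, hae⟩ := h.exists_measurable_bounded
  have hgraph : iLGraph N β gradV = (iLGraph N β gradV' : Set (L2 d m β × L2 d m β)) := by
    rw [iLGraph, iLGraph]
    simp_rw [iL_congr hae]
  have hK : |K| = K := abs_of_nonneg h.nonneg
  rw [hK] at hU
  obtain ⟨U, hgen, hbound⟩ := hU V gradV' (h.congr_grad hae) hV hm hb N hN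
  exact ⟨U, hgraph ▸ hgen, fun t _ G _ _ => hbound t G⟩
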